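/- All manifolds are smooth real Banach manifolds (charts may take values in different Banach spaces), and $B'$ denotes the topological dual of a Banach space $B$. A *weak Riemannian metric* $\mathrm g$ on $\mathcal M$ is a smooth field of continuous symmetric positive definite bilinear forms on the tangent spaces. A *weak symplectic form* $\omega$ is a closed smooth $2$-form such that $T_x\mathcal M\to T_x'\mathcal M$, $X\mapsto\omega_x(X,\cdot)$, is injective for all $x$. A *(weak) Kähler structure* is a triple $(\mathrm g,\omega,I)$ with $\mathrm g$ a weak Riemannian metric, $\omega$ a weak symplectic form, and $I$ a smooth endomorphism of the tangent bundle with $\mathrm g(IX,Y)=\omega(X,Y)$, $I^2=-1$ and vanishing Nijenhuis tensor $[X,Y]+I[X,IY]+I[IX,Y]-[IX,IY]$. A *(weak) hyperkähler structure* is $(\mathrm g,\omega_k,I_k)_{k=1,2,3}$ such that each $(\mathrm g,\omega_k,I_k)$ is a weak Kähler structure and $I_1I_2I_3=-1$. Let $G$ be a Banach Lie group with Lie algebra $\mathfrak g$ acting smoothly, freely and properly on $\mathcal M$; let $X^{\mathfrak a}(x)$ be the derivative at $1$ of $g\mapsto g\cdot x$ in the direction $\mathfrak a\in\mathfrak g$,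 and $T_xG\!\cdot\!x=\{X^{\mathfrak a}(x):\mathfrak a\in\mathfrak g\}$. A *$G$-equivariant moment map* for an invariant weak symplectic form $\omega$ is a smooth map $\mu:\mathcal M\to\mathfrak g'$ with $\langle d\mu_x(Y),\mathfrak a\rangle=\omega_x(X^{\mathfrak a}(x),Y)$ and $\mu(g\cdot x)=\mathrm{Ad}^*(g)\mu(x)$, where $\mathrm{Ad}^*(g)\xi=\xi\circ\mathrm{Ad}(g^{-1})$. A value $\xi$ of a smooth map $\mu$ into a Banach space is *regular* if for every $x\in\mu^{-1}(\xi)$ the differential $d\mu_x$ is surjective and its kernel has a closed complement. Condition (D) is: for every $x\in\mu^{-1}(\xi)$, $$T_xG\!\cdot\!x\ \oplus\ H_x=\ker d\mu_x=T_x(\mu^{-1}(\xi)),\qquad H_x:=(T_xG\!\cdot\!x)^{\perp_{\mathrm g}}\cap\ker d\mu_x .$$ **Theorem.** (1) Let $(\mathrm g,\omega,I)$ be a weak Kähler structure on $\mathcal M$ such that $G$ preserves $\mathrm g$ and $\omega$ and has a $G$-equivariant moment map $\mu:\mathcal M\to\mathfrak g'$, and let $\xi\in\mathfrak g'$ be an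 $\mathrm{Ad}^*(G)$-invariant regular value of $\mu$ (if $\mu^{-1}(\xi)=\emptyset$ the assertion is trivial). If (D) holds, then $\mu^{-1}(\xi)/G$ with the quotient topology is Hausdorff, $\mu^{-1}(\xi)$ is a smooth submanifold of $\mathcal M$ with tangent spaces $\ker d\mu_x$, and $\mu^{-1}(\xi)/G$ has a Banach manifold structure for which the projection $\pi:\mu^{-1}(\xi)\to\mu^{-1}(\xi)/G$ is a submersion with $\ker d\pi_x=T_xG\!\cdot\!x$, together with a weak Kähler structure $(\mathrm g^{\rm red},\omega^{\rm red},I^{\rm red})$ such that $\pi^*\omega^{\rm red}=\omega|_{\mu^{-1}(\xi)}$ and, for all $x\in\mu^{-1}(\xi)$, $IH_x\subset H_x$, $\mathrm g^{\rm red}(\pi_*X,\pi_*Y)=\mathrm g(X,Y)$ and $I^{\rm red}\pi_*X=\pi_*IX$ for $X,Y\in H_x$. (2) Let $(\mathrm g,\omega_k,I_k)_{k=1,2,3}$ be a weak hyperkähler structure on $\mathcal M$ such that $G$ preserves $\mathrm g,\omega_1,\omega_2,\omega_3$ and has $G$-equivariant moment maps $\mu_k$ for $\omega_k$, let $\mu=(\mu_1,\mu_2,\mu_3):\mathcal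 M\to(\mathfrak g')^3$, and let $\xi=(\xi_1,\xi_2,\xi_3)$ be a regular value of $\mu$ with each $\xi_k$ being $\mathrm{Ad}^*(G)$-invariant. If (D) holds, then the same conclusions hold for $\mu^{-1}(\xi)$ and $\mu^{-1}(\xi)/G$, with a weak hyperkähler structure $(\mathrm g^{\rm red},\omega_k^{\rm red},I_k^{\rm red})_{k=1,2,3}$ on $\mu^{-1}(\xi)/G$ that is induced as in (1) for each $k$. -/

import Mathlib

open Set Topology
open scoped ContDiff Manifold

universe u v w

/-! ### Smooth Banach manifolds

Mathlib's `ChartedSpace` uses one fixed model space. Level sets of submersions and their quotients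
may have components modelled on non-isomorphic Banach spaces, so the model is allowed to vary. -/

/-- A smooth real Banach manifold: a topological space with an atlas of smoothly compatible charts
with values in Banach spaces (which may vary). One chart around each point is singled out; the
charts form an atlas, and the chart at `x` is used to represent the tangent space at `x`. -/
class BanachManifold (X : Type u) [TopologicalSpace X] where
  model : X → Type w
  [normedAddCommGroup : ∀ x, NormedAddCommGroup (model x)]
  [normedSpace : ∀ x, NormedSpace ℝ (model x)]
  [completeSpace : ∀ x, CompleteSpace (model x)]
  chart : ∀ x, OpenPartialHomeomorph X (model x)
  mem_chart_source : ∀ x, x ∈ (chart x).source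
  contDiffOn_transition : ∀ x y,
    ContDiffOn ℝ ∞ ((chart x).symm.trans (chart y)) ((chart x).symm.trans (chart y)).source

namespace BanachManifold

attribute [reducible, instance] normedAddCommGroup normedSpace
attribute [instance] completeSpace

/-- A Mathlib manifold without boundary modelled on a Banach space `E` is a Banach manifold. -/
@[reducible] def ofChartedSpace (E : Type w) [NormedAddCommGroup E] [NormedSpace ℝ E]
    [CompleteSpace E] (X : Type u) [TopologicalSpace X] [ChartedSpace E X]
    [IsManifold 𝓘(ℝ, E) ∞ X] : BanachManifold.{u, w} X where
  model _ := E
  chart x := chartAt E x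
  mem_chart_source x := _root_.mem_chart_source E x
  contDiffOn_transition x y := by
    have h := (contDiffGroupoid ∞ 𝓘(ℝ, E)).compatible
      (chart_mem_atlas E x) (chart_mem_atlas E y)
    rw [contDiffGroupoid, mem_groupoid_of_pregroupoid] at h
    simpa [contDiffPregroupoid] using h.1

section Calculus

variable {X : Type*} [TopologicalSpace X] [BanachManifold X]
  {Y : Type*} [TopologicalSpace Y] [BanachManifold Y]
  {F : Type*} [NormedAddCommGroup F] [NormedSpace ℝ F]

/-- The tangent space at `x`, represented in the chart at `x`. -/
abbrev Tangent (x : X) := model x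

/-- Smooth maps between Banach manifolds. -/
structure Smooth (f : X → Y) : Prop where
  continuous : Continuous f
  contDiffOn : ∀ (x : X) (y : Y), ContDiffOn ℝ ∞ (fun a ↦ chart y (f ((chart x).symm a)))
    {a | a ∈ (chart x).target ∧ f ((chart x).symm a) ∈ (chart y).source}

/-- The tangent map `T_x f : T_x X → T_{f x} Y` of a smooth map. -/
noncomputable def tangentMap (f : X → Y) (x : X) : Tangent x →L[ℝ] Tangent (f x) :=
  fderiv ℝ (fun a ↦ chart (f x) (f ((chart x).symm a))) (chart x x)

/-- Smooth maps from a Banach manifold to a normed space. -/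
def SmoothInto (f : X → F) : Prop :=
  ∀ x : X, ContDiffOn ℝ ∞ (fun a ↦ f ((chart x).symm a)) (chart x).target

/-- The differential `d f_x : T_x X → F` of a smooth map to a normed space. -/
noncomputable def differential (f : X → F) (x : X) : Tangent x →L[ℝ] F :=
  fderiv ℝ (fun a ↦ f ((chart x).symm a)) (chart x x)

/-- The derivative of the inverse of the chart at `x₀` at a point `a` of its target, as a map to
the tangent space at the corresponding point of `X`. -/
noncomputable def chartSymmDeriv (x₀ : X) (a : Tangent x₀) :
    Tangent x₀ →L[ℝ] Tangent ((chart x₀).symm a) :=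
  fderiv ℝ (fun b ↦ chart ((chart x₀).symm a) ((chart x₀).symm b)) a

/-- The derivative at `p` of the chart at `x₀`. -/
noncomputable def chartDeriv (x₀ p : X) : Tangent p →L[ℝ] Tangent x₀ :=
  fderiv ℝ (fun b ↦ chart x₀ ((chart p).symm b)) (chart p p)

variable (X) in
/-- Fields of continuous bilinear forms on the tangent spaces. -/
abbrev BilinField := ∀ x : X, Tangent x →L[ℝ] Tangent x →L[ℝ] ℝ

variable (X) in
/-- Fields of continuous endomorphisms of the tangent spaces. -/
abbrev EndField := ∀ x : X, Tangent x →L[ℝ] Tangent x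

/-- The expression of a field of bilinear forms in the chart at `x₀`. -/
noncomputable def localBilin (b : BilinField X) (x₀ : X) (a : Tangent x₀) :
    Tangent x₀ →L[ℝ] Tangent x₀ →L[ℝ] ℝ :=
  (b ((chart x₀).symm a)).bilinearComp (chartSymmDeriv x₀ a) (chartSymmDeriv x₀ a)

/-- The expression of a field of endomorphisms in the chart at `x₀`. -/
noncomputable def localEnd (J : EndField X) (x₀ : X) (a : Tangent x₀) :
    Tangent x₀ →L[ℝ] Tangent x₀ :=
  (chartDeriv x₀ ((chart x₀).symm a)).comp
    ((J ((chart x₀).symm a)).comp (chartSymmDeriv x₀ a))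

def SmoothBilin (b : BilinField X) : Prop :=
  ∀ x₀ : X, ContDiffOn ℝ ∞ (localBilin b x₀) (chart x₀).target

def SmoothEnd (J : EndField X) : Prop :=
  ∀ x₀ : X, ContDiffOn ℝ ∞ (localEnd J x₀) (chart x₀).target

/-- `d Ω = 0` for a `2`-form `Ω`. In a chart and for constant vector fields `a, b, c` the exterior
derivative `d Ω (a, b, c)` is the cyclic sum below. -/
def IsClosedForm (Ω : BilinField X) : Prop :=
  ∀ (x₀ : X), ∀ p ∈ (chart x₀).target, ∀ a b c : Tangent x₀,
    fderiv ℝ (localBilin Ω x₀) p a b c + fderiv ℝ (localBilin Ω x₀) p b c a +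
      fderiv ℝ (localBilin Ω x₀) p c a b = 0

/-- The Nijenhuis expression `[V, W] + J [V, J W] + J [J V, W] - [J V, J W]` for vector fields
`V`, `W` and a field `J` of endomorphisms on (an open subset of) a Banach space. -/
noncomputable def nijenhuis {E : Type*} [NormedAddCommGroup E] [NormedSpace ℝ E]
    (J : E → E →L[ℝ] E) (V W : E → E) (p : E) : E :=
  VectorField.lieBracket ℝ V W p
    + J p (VectorField.lieBracket ℝ V (fun q ↦ J q (W q)) p)
    + J p (VectorField.lieBracket ℝ (fun q ↦ J q (V q)) W p)
    - VectorField.lieBracket ℝ (fun q ↦ J q (V q)) (fun q ↦ J q (W q)) p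

/-- Vanishing of the Nijenhuis tensor (formal integrability). -/
def NijenhuisVanishes (J : EndField X) : Prop :=
  ∀ (x₀ : X) (V W : Tangent x₀ → Tangent x₀), ContDiffOn ℝ ∞ V (chart x₀).target →
    ContDiffOn ℝ ∞ W (chart x₀).target → ∀ p ∈ (chart x₀).target,
      nijenhuis (localEnd J x₀) V W p = 0

/-! ### Weak Kähler and hyperkähler structures -/

/-- Weak symplectic forms: closed smooth `2`-forms such that every `T_x X → (T_x X)'`,
`a ↦ Ω_x(a, ·)`, is injective. -/
structure IsWeakSymplectic (Ω : BilinField X) : Prop where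
  smooth : SmoothBilin Ω
  alternating : ∀ (x : X) (a : Tangent x), Ω x a a = 0
  closed : IsClosedForm Ω
  injective : ∀ x : X, Function.Injective (Ω x)

/-- Weak Riemannian metrics. Positivity makes `a ↦ g_x(a, ·)` injective. -/
structure IsWeakRiemannian (g : BilinField X) : Prop where
  smooth : SmoothBilin g
  symmetric : ∀ (x : X) (a b : Tangent x), g x a b = g x b a
  positive : ∀ (x : X) (a : Tangent x), a ≠ 0 → 0 < g x a a

/-- `(g, Ω, J)` is a weak Kähler structure. -/
structure IsWeakKahler (g Ω : BilinField X) (J : EndField X) : Prop where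
  riemannian : IsWeakRiemannian g
  symplectic : IsWeakSymplectic Ω
  smooth_J : SmoothEnd J
  compatible : ∀ (x : X) (a b : Tangent x), g x (J x a) b = Ω x a b
  sq_J : ∀ (x : X) (a : Tangent x), J x (J x a) = -a
  nijenhuis_J : NijenhuisVanishes J

/-- `(g, Ω₁, Ω₂, Ω₃, J₁, J₂, J₃)` is a weak hyperkähler structure. -/
structure IsWeakHyperkahler (g : BilinField X) (Ω : Fin 3 → BilinField X)
    (J : Fin 3 → EndField X) : Prop where
  kahler : ∀ k, IsWeakKahler g (Ω k) (J k)
  quaternionic : ∀ (x : X) (a : Tangent x), J 0 x (J 1 x (J 2 x a)) = -a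

/-- `ξ` is a regular value of `f`: at each point of the level set, the differential is surjective
and its kernel has a closed complement. -/
def IsRegularValue (f : X → F) (ξ : F) : Prop :=
  ∀ x : X, f x = ξ → Function.Surjective (differential f x) ∧
    (differential f x).ker.ClosedComplemented

/-- The `b`-orthogonal of `V` inside `T`. -/
def orthogonalIn {x : X} (b : Tangent x →L[ℝ] Tangent x →L[ℝ] ℝ)
    (V T : Submodule ℝ (Tangent x)) : Submodule ℝ (Tangent x) where
  carrier := {a | a ∈ T ∧ ∀ c ∈ V, b c a = 0}
  add_mem' := fun ha hb ↦ ⟨T.add_mem ha.1 hb.1, fun c hc ↦ by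
    rw [map_add, ha.2 c hc, hb.2 c hc, add_zero]⟩
  zero_mem' := ⟨T.zero_mem, fun c _ ↦ map_zero _⟩
  smul_mem' := fun r a ha ↦ ⟨T.smul_mem r ha.1, fun c hc ↦ by
    rw [map_smul, ha.2 c hc, smul_zero]⟩

/-- The subset `N` of `X`, with the given manifold structure on the subspace `N`, is a (split)
submanifold with tangent spaces `T x`. -/
structure IsSubmanifold (N : Set X) [BanachManifold N]
    (T : ∀ x : X, Submodule ℝ (Tangent x)) : Prop where
  smooth : Smooth (Subtype.val : N → X)
  injective : ∀ x : N, Function.Injective (tangentMap (Subtype.val : N → X) x)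
  range : ∀ x : N, (tangentMap (Subtype.val : N → X) x).range = T x
  complemented : ∀ x : N, (T x).ClosedComplemented

/-- Submersions: smooth maps whose tangent maps are surjective with complemented kernel. -/
structure IsSubmersion (f : X → Y) : Prop where
  smooth : Smooth f
  surjective : ∀ x : X, Function.Surjective (tangentMap f x)
  complemented : ∀ x : X, (tangentMap f x).ker.ClosedComplemented

end Calculus

/-! ### Actions of Banach Lie groups

`G` is a Lie group modelled on the Banach space `𝔤`, which is identified with `T_1 G` by the
preferred chart at `1`. -/

section Action

variable (𝔤 : Type*) [NormedAddCommGroup 𝔤] [NormedSpace ℝ 𝔤]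
  (G : Type*) [Group G] [TopologicalSpace G] [ChartedSpace 𝔤 G]
  {M : Type*} [TopologicalSpace M] [BanachManifold M] [MulAction G M]

variable (M) in
/-- The action map `G × M → M` is smooth. -/
structure SmoothAction : Prop where
  continuous : Continuous fun p : G × M ↦ p.1 • p.2
  contDiffOn : ∀ (g : G) (x y : M), ContDiffOn ℝ ∞
    (fun p : 𝔤 × Tangent x ↦ chart y ((chartAt 𝔤 g).symm p.1 • (chart x).symm p.2))
    {p | p.1 ∈ (chartAt 𝔤 g).target ∧ p.2 ∈ (chart x).target ∧
      (chartAt 𝔤 g).symm p.1 • (chart x).symm p.2 ∈ (chart y).source}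

/-- The infinitesimal action `𝔞 ↦ X^𝔞(x)`, the derivative at `1` of `g ↦ g • x`. -/
noncomputable def infinitesimalAction (x : M) : 𝔤 →L[ℝ] Tangent x :=
  fderiv ℝ (fun s ↦ chart x ((chartAt 𝔤 (1 : G)).symm s • x)) (chartAt 𝔤 (1 : G) 1)

/-- The tangent space `T_x(G • x)` of the orbit, spanned by the vectors `X^𝔞(x)`. -/
noncomputable def orbitTangent (x : M) : Submodule ℝ (Tangent x) :=
  (infinitesimalAction 𝔤 G x).range

variable {G} in
/-- The adjoint action: the derivative at `1` of `h ↦ g h g⁻¹`. -/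
noncomputable def Ad (g : G) : 𝔤 →L[ℝ] 𝔤 :=
  fderiv ℝ (fun s ↦ chartAt 𝔤 (1 : G) (g * (chartAt 𝔤 (1 : G)).symm s * g⁻¹))
    (chartAt 𝔤 (1 : G) 1)

variable {𝔤} {G} in
/-- The coadjoint action `Ad*(g) ξ = ξ ∘ Ad(g⁻¹)` on the topological dual `𝔤'`. -/
noncomputable def coAd (g : G) (ξ : 𝔤 →L[ℝ] ℝ) : 𝔤 →L[ℝ] ℝ := ξ.comp (Ad 𝔤 g⁻¹)

/-- Every `g : G` preserves the field `b` of bilinear forms. -/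
def Preserves (b : BilinField M) : Prop :=
  ∀ (g : G) (x : M) (a c : Tangent x),
    b (g • x) (tangentMap (fun y : M ↦ g • y) x a) (tangentMap (fun y : M ↦ g • y) x c) = b x a c

variable {𝔤} in
/-- `G`-equivariant moment maps `μ : M → 𝔤'` of the action, with respect to `Ω`. -/
structure IsEquivariantMomentMap (Ω : BilinField M) (μ : M → 𝔤 →L[ℝ] ℝ) : Prop where
  smooth : SmoothInto μ
  moment : ∀ (x : M) (𝔞 : 𝔤) (a : Tangent x),
    differential μ x a 𝔞 = Ω x (infinitesimalAction 𝔤 G x 𝔞) a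
  equivariant : ∀ (g : G) (x : M), μ (g • x) = coAd g (μ x)

variable {F : Type*} [NormedAddCommGroup F] [NormedSpace ℝ F]

/-- The orthogonal of `T_x(G • x)` in the tangent space `ker d f_x` of the level set of `f`. -/
noncomputable def horizontal (g : BilinField M) (f : M → F) (x : M) : Submodule ℝ (Tangent x) :=
  orthogonalIn (g x) (orbitTangent 𝔤 G x) (differential f x).ker

/-- The direct sum condition `T_x(G • x) ⊕ T_x(G • x)^⊥ = T_x f⁻¹(ξ)` at all points of the level
set. -/
def DirectSumCondition (g : BilinField M) (f : M → F) (ξ : F) : Prop :=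
  ∀ x : M, f x = ξ → orbitTangent 𝔤 G x ⊓ horizontal 𝔤 G g f x = ⊥ ∧
    orbitTangent 𝔤 G x ⊔ horizontal 𝔤 G g f x = (differential f x).ker

/-- Two points of `N` are equivalent if they lie in the same `G`-orbit. -/
def orbitSetoid (N : Set M) : Setoid N := (MulAction.orbitRel G M).comap Subtype.val

/-- The space `N / G` of `G`-orbits in `N`, with the quotient topology. -/
abbrev OrbitSpace (N : Set M) := Quotient (orbitSetoid G N)

/-- The projection `N → N / G`. -/
def orbitProj (N : Set M) : N → OrbitSpace G N := Quotient.mk _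

/-- The level set `f⁻¹(ξ)` is a submanifold with tangent spaces `ker d f_x`, and its projection to
the orbit space is a submersion whose vertical spaces are the tangent spaces of the orbits. -/
structure IsReducedManifold (f : M → F) (ξ : F) [BanachManifold (f ⁻¹' {ξ})]
    [BanachManifold (OrbitSpace G (f ⁻¹' {ξ}))] : Prop where
  submanifold : IsSubmanifold (f ⁻¹' {ξ}) fun x ↦ (differential f x).ker
  submersion : IsSubmersion (orbitProj G (f ⁻¹' {ξ}))
  vertical : ∀ x : f ⁻¹' {ξ}, (tangentMap (orbitProj G (f ⁻¹' {ξ})) x).ker =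
    (orbitTangent 𝔤 G (x : M)).comap
      (tangentMap (Subtype.val : f ⁻¹' {ξ} → M) x : Tangent x →ₗ[ℝ] Tangent (x : M))

/-- The fields `g'`, `Ω'`, `J'` on the orbit space are induced by `g`, `Ω`, `J`: the pullback of
`Ω'` to the level set is the restriction of `Ω`, and `g'`, `J'` are given by `g`, `J` on horizontal
lifts. -/
structure IsInduced (f : M → F) (ξ : F) [BanachManifold (f ⁻¹' {ξ})]
    [BanachManifold (OrbitSpace G (f ⁻¹' {ξ}))] (g Ω : BilinField M) (J : EndField M)
    (g' Ω' : BilinField (OrbitSpace G (f ⁻¹' {ξ}))) (J' : EndField (OrbitSpace G (f ⁻¹' {ξ}))) :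
    Prop where
  form : ∀ (x : f ⁻¹' {ξ}) (a c : Tangent x),
    Ω' (orbitProj G _ x) (tangentMap (orbitProj G _) x a) (tangentMap (orbitProj G _) x c) =
      Ω x (tangentMap Subtype.val x a) (tangentMap Subtype.val x c)
  metric : ∀ (x : f ⁻¹' {ξ}) (a c : Tangent x),
    tangentMap Subtype.val x a ∈ horizontal 𝔤 G g f (x : M) →
    tangentMap Subtype.val x c ∈ horizontal 𝔤 G g f (x : M) →
    g' (orbitProj G _ x) (tangentMap (orbitProj G _) x a) (tangentMap (orbitProj G _) x c) =
      g x (tangentMap Subtype.val x a) (tangentMap Subtype.val x c)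
  complex : ∀ (x : f ⁻¹' {ξ}) (a : Tangent x),
    tangentMap Subtype.val x a ∈ horizontal 𝔤 G g f (x : M) →
    ∃ c : Tangent x, tangentMap Subtype.val x c ∈ horizontal 𝔤 G g f (x : M) ∧
      tangentMap Subtype.val x c = J x (tangentMap Subtype.val x a) ∧
      J' (orbitProj G _ x) (tangentMap (orbitProj G _) x a) = tangentMap (orbitProj G _) x c

end Action

end BanachManifold

namespace BanachManifold

/-- A Banach space is a Banach manifold with a single chart. -/
@[reducible] instance ofBanachSpace (B : Type*) [NormedAddCommGroup B] [NormedSpace ℝ B]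
    [CompleteSpace B] : BanachManifold B where
  model _ := B
  chart _ := OpenPartialHomeomorph.refl B
  mem_chart_source _ := mem_univ _
  contDiffOn_transition _ _ := contDiffOn_id

/-! ### Smooth maps at a point and their tangent maps -/

section SmoothAt

variable {X : Type*} [TopologicalSpace X] [BanachManifold X]
  {Y : Type*} [TopologicalSpace Y] [BanachManifold Y]
  {Z : Type*} [TopologicalSpace Z] [BanachManifold Z]
  {B : Type*} [NormedAddCommGroup B] [NormedSpace ℝ B] [CompleteSpace B]
  {B' : Type*} [NormedAddCommGroup B'] [NormedSpace ℝ B'] [CompleteSpace B']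

theorem contDiffAt_transition {x y p : X} (hx : p ∈ (chart x).source) (hy : p ∈ (chart y).source) :
    ContDiffAt ℝ ∞ (fun a ↦ chart y ((chart x).symm a)) (chart x p) := by
  refine (contDiffOn_transition x y).contDiffAt
    (((chart x).symm.trans (chart y)).open_source.mem_nhds ?_)
  simp [hx, hy]

/-- Smoothness of a map between Banach manifolds at a point. -/
structure SmoothAt (f : X → Y) (x : X) : Prop where
  continuousAt : ContinuousAt f x
  contDiffAt : ContDiffAt ℝ ∞ (fun a ↦ chart (f x) (f ((chart x).symm a))) (chart x x)

/-- The derivative of `f` at `x` in the preferred charts at `x` and `y`. For `f x = y` this is the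
tangent map. -/
noncomputable def tangentMapTo (f : X → Y) (x : X) (y : Y) : Tangent x →L[ℝ] Tangent y :=
  fderiv ℝ (fun a ↦ chart y (f ((chart x).symm a))) (chart x x)

theorem tangentMap_eq (f : X → Y) (x : X) : tangentMap f x = tangentMapTo f x (f x) := rfl

theorem tendsto_chart_symm {x p : X} (hp : p ∈ (chart x).source) :
    Filter.Tendsto (chart x).symm (𝓝 (chart x p)) (𝓝 p) :=
  (chart x).tendsto_symm hp

theorem eventually_chart_symm {x p : X} (hp : p ∈ (chart x).source) {P : X → Prop}
    (h : ∀ᶠ z in 𝓝 p, P z) : ∀ᶠ a in 𝓝 (chart x p), P ((chart x).symm a) :=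
  tendsto_chart_symm hp h

/-- Composition with the two transition maps. Continuity of `f` is needed separately, so that nearby
points still land in the domain of the chart at `y₀`. -/
theorem contDiffAt_change_charts {f : X → Y} {x x₀ x₁ : X} {y₀ y₁ : Y} (hf : ContinuousAt f x)
    (h₀ : x ∈ (chart x₀).source) (h₁ : x ∈ (chart x₁).source)
    (k₀ : f x ∈ (chart y₀).source) (k₁ : f x ∈ (chart y₁).source)
    (h : ContDiffAt ℝ ∞ (fun a ↦ chart y₀ (f ((chart x₀).symm a))) (chart x₀ x)) :
    ContDiffAt ℝ ∞ (fun a ↦ chart y₁ (f ((chart x₁).symm a))) (chart x₁ x) := by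
  have e₁ : chart x₀ ((chart x₁).symm (chart x₁ x)) = chart x₀ x := by rw [(chart x₁).left_inv h₁]
  have e₂ : chart y₀ (f ((chart x₀).symm (chart x₀ x))) = chart y₀ (f x) := by
    rw [(chart x₀).left_inv h₀]
  have t₁ := contDiffAt_transition h₁ h₀
  have t₂ := contDiffAt_transition k₀ k₁
  have c := ContDiffAt.comp (chart x₁ x)
    (f := fun a ↦ chart x₀ ((chart x₁).symm a))
    (g := fun a ↦ chart y₁ ((chart y₀).symm (chart y₀ (f ((chart x₀).symm a)))))
    (ContDiffAt.comp (f := fun a ↦ chart y₀ (f ((chart x₀).symm a)))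
      (g := fun b ↦ chart y₁ ((chart y₀).symm b)) _ (by rw [e₁, e₂]; exact t₂) (by rwa [e₁])) t₁
  refine c.congr_of_eventuallyEq ?_
  have n₁ : ∀ᶠ z in 𝓝 x, z ∈ (chart x₀).source := (chart x₀).open_source.mem_nhds h₀
  have n₂ : ∀ᶠ z in 𝓝 x, f z ∈ (chart y₀).source :=
    hf.eventually ((chart y₀).open_source.mem_nhds k₀)
  filter_upwards [eventually_chart_symm h₁ (n₁.and n₂)] with a ha
  simp [(chart x₀).left_inv ha.1, (chart y₀).left_inv ha.2]

theorem smoothAt_iff_of_mem {f : X → Y} {x x₀ : X} {y₀ : Y}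
    (h₀ : x ∈ (chart x₀).source) (k₀ : f x ∈ (chart y₀).source) :
    SmoothAt f x ↔ ContinuousAt f x ∧
      ContDiffAt ℝ ∞ (fun a ↦ chart y₀ (f ((chart x₀).symm a))) (chart x₀ x) :=
  ⟨fun h ↦ ⟨h.1, contDiffAt_change_charts h.1 (mem_chart_source x) h₀ (mem_chart_source _) k₀ h.2⟩,
    fun h ↦ ⟨h.1, contDiffAt_change_charts h.1 h₀ (mem_chart_source x) k₀ (mem_chart_source _) h.2⟩⟩

theorem SmoothAt.comp {g : Y → Z} {f : X → Y} {x : X} {y : Y} (hg : SmoothAt g y)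
    (hf : SmoothAt f x) (h : f x = y) : SmoothAt (fun a ↦ g (f a)) x := by
  subst h
  refine ⟨hg.1.comp hf.1, ?_⟩
  have e : chart (f x) (f ((chart x).symm (chart x x))) = chart (f x) (f x) := by
    rw [(chart x).left_inv (mem_chart_source x)]
  have c := ContDiffAt.comp (chart x x) (f := fun a ↦ chart (f x) (f ((chart x).symm a)))
      (g := fun b ↦ chart (g (f x)) (g ((chart (f x)).symm b))) (by rw [e]; exact hg.2) hf.2
  refine c.congr_of_eventuallyEq ?_
  filter_upwards [eventually_chart_symm (mem_chart_source x)
    (hf.1.eventually ((chart (f x)).open_source.mem_nhds (mem_chart_source _)))] with a ha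
  simp [(chart (f x)).left_inv ha]

theorem SmoothAt.differentiableAt {f : X → Y} {x : X} {y : Y} (hf : SmoothAt f x) (h : f x = y) :
    DifferentiableAt ℝ (fun a ↦ chart y (f ((chart x).symm a))) (chart x x) := by
  subst h
  exact hf.2.differentiableAt (by simp)

/-- The chain rule. Base points enter as variables with equations, since tangent spaces at points
that are only propositionally equal are different types; this form avoids transport throughout. -/
theorem tangentMapTo_comp {g : Y → Z} {f : X → Y} {x : X} {y : Y} {z : Z} (hg : SmoothAt g y)
    (hf : SmoothAt f x) (h : f x = y) (h' : g y = z) :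
    tangentMapTo (fun a ↦ g (f a)) x z = (tangentMapTo g y z).comp (tangentMapTo f x y) := by
  subst h
  have e : chart (f x) (f ((chart x).symm (chart x x))) = chart (f x) (f x) := by
    rw [(chart x).left_inv (mem_chart_source x)]
  have c := fderiv_comp (𝕜 := ℝ) (chart x x) (f := fun a ↦ chart (f x) (f ((chart x).symm a)))
      (g := fun b ↦ chart z (g ((chart (f x)).symm b)))
      (by rw [e]; exact hg.differentiableAt h') (hf.differentiableAt rfl)
  rw [e] at c
  rw [tangentMapTo, tangentMapTo, tangentMapTo, ← c]
  refine Filter.EventuallyEq.fderiv_eq ?_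
  filter_upwards [eventually_chart_symm (mem_chart_source x)
    (hf.1.eventually ((chart (f x)).open_source.mem_nhds (mem_chart_source _)))] with a ha
  simp [(chart (f x)).left_inv ha]

theorem tangentMapTo_comp_apply {g : Y → Z} {f : X → Y} {x : X} {y : Y} {z : Z}
    (hg : SmoothAt g y) (hf : SmoothAt f x) (h : f x = y) (h' : g y = z) (v : Tangent x) :
    tangentMapTo (fun a ↦ g (f a)) x z v = tangentMapTo g y z (tangentMapTo f x y v) := by
  rw [tangentMapTo_comp hg hf h h']; rfl

theorem SmoothAt.congr {f g : X → Y} {x : X} (hf : SmoothAt f x) (h : g =ᶠ[𝓝 x] f) :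
    SmoothAt g x := by
  refine ⟨hf.1.congr_of_eventuallyEq h, ?_⟩
  rw [h.eq_of_nhds]
  refine hf.2.congr_of_eventuallyEq ?_
  filter_upwards [eventually_chart_symm (mem_chart_source x) h] with a ha
  simp [ha]

theorem tangentMapTo_congr {f g : X → Y} {x : X} (h : f =ᶠ[𝓝 x] g) (y : Y) :
    tangentMapTo f x y = tangentMapTo g x y := by
  refine Filter.EventuallyEq.fderiv_eq ?_
  filter_upwards [eventually_chart_symm (mem_chart_source x) h] with a ha
  simp [ha]

theorem smoothAt_id (x : X) : SmoothAt (fun a : X ↦ a) x :=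
  ⟨continuousAt_id, contDiffAt_transition (mem_chart_source x) (mem_chart_source x)⟩

theorem tangentMapTo_id (x : X) :
    tangentMapTo (fun a : X ↦ a) x x = ContinuousLinearMap.id ℝ (Tangent x) := by
  have : (fun a ↦ chart x ((chart x).symm a)) =ᶠ[𝓝 (chart x x)] fun a ↦ a := by
    filter_upwards [(chart x).open_target.mem_nhds ((chart x).map_source (mem_chart_source x))]
      with a ha using (chart x).right_inv ha
  rw [tangentMapTo, this.fderiv_eq, fderiv_fun_id]

theorem tangentMapTo_const (x : X) (c y : Y) :
    tangentMapTo (fun _ : X ↦ c) x y = 0 := by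
  rw [tangentMapTo, fderiv_fun_const]; rfl

theorem smoothAt_const (x : X) (y : Y) : SmoothAt (fun _ : X ↦ y) x :=
  ⟨continuousAt_const, contDiffAt_const⟩

/-- Maps between Banach spaces. -/
theorem smoothAt_iff_contDiffAt {f : B → B'} {b : B} : SmoothAt f b ↔ ContDiffAt ℝ ∞ f b :=
  ⟨fun h ↦ h.2, fun h ↦ ⟨h.continuousAt, h⟩⟩

theorem tangentMapTo_eq_fderiv (f : B → B') (b : B) (b' : B') :
    tangentMapTo f b b' = fderiv ℝ f b := rfl

theorem smoothAt_chart {x p : X} (hp : p ∈ (chart x).source) :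
    SmoothAt (Y := Tangent x) (chart x) p :=
  ⟨(chart x).continuousAt hp, contDiffAt_transition (mem_chart_source p) hp⟩

theorem smoothAt_chart_symm {x : X} {a : Tangent x} (ha : a ∈ (chart x).target) :
    SmoothAt (chart x).symm a := by
  refine ⟨(chart x).continuousAt_symm ha, ?_⟩
  have := contDiffAt_transition ((chart x).map_target ha)
    (mem_chart_source ((chart x).symm a))
  rwa [(chart x).right_inv ha] at this

theorem smooth_of_smoothAt {f : X → Y} (hf : ∀ x, SmoothAt f x) : Smooth f := by
  refine ⟨continuous_iff_continuousAt.2 fun x ↦ (hf x).1, fun x y a ha ↦ ?_⟩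
  have h := ((smoothAt_iff_of_mem (x₀ := x) (y₀ := y) ((chart x).map_target ha.1) ha.2).1
    (hf _)).2
  rw [(chart x).right_inv ha.1] at h
  exact h.contDiffWithinAt

theorem smoothInto_iff {f : X → B} : SmoothInto f ↔ ∀ x, SmoothAt f x := by
  refine ⟨fun h x ↦ ?_, fun h x a ha ↦ ?_⟩
  · have h₁ := (chart x).open_target.mem_nhds ((chart x).map_source (mem_chart_source x))
    have h₂ := (h x).contDiffAt h₁
    refine ⟨?_, h₂⟩
    have h₃ := ContinuousAt.comp (f := chart x) (g := fun a ↦ f ((chart x).symm a)) h₂.continuousAt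
      ((chart x).continuousAt (mem_chart_source x))
    refine h₃.congr ?_
    filter_upwards [(chart x).open_source.mem_nhds (mem_chart_source x)] with z hz
    simp [(chart x).left_inv hz]
  · have h' := ((smoothAt_iff_of_mem (x₀ := x) (y₀ := f ((chart x).symm a))
      ((chart x).map_target ha) (mem_univ _)).1 (h _)).2
    rw [(chart x).right_inv ha] at h'
    exact h'.contDiffWithinAt

theorem chartDeriv_eq (x₀ p : X) :
    chartDeriv x₀ p = tangentMapTo (Y := Tangent x₀) (chart x₀) p (chart x₀ p) := rfl

theorem chartSymmDeriv_eq (x₀ : X) (a : Tangent x₀) :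
    chartSymmDeriv x₀ a = tangentMapTo (chart x₀).symm a ((chart x₀).symm a) := rfl

theorem tangentMapTo_chart_symm_chart {x₀ p : X} (hp : p ∈ (chart x₀).source) (v : Tangent p) :
    tangentMapTo (chart x₀).symm (chart x₀ p) p
      (tangentMapTo (Y := Tangent x₀) (chart x₀) p (chart x₀ p) v) = v := by
  rw [← tangentMapTo_comp_apply (smoothAt_chart_symm ((chart x₀).map_source hp))
    (smoothAt_chart hp) rfl ((chart x₀).left_inv hp)]
  rw [tangentMapTo_congr (g := fun a ↦ a), tangentMapTo_id]; · rfl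
  filter_upwards [(chart x₀).open_source.mem_nhds hp] with z hz using (chart x₀).left_inv hz

theorem tangentMapTo_chart_chart_symm {x₀ p : X} (hp : p ∈ (chart x₀).source) (v : Tangent x₀) :
    tangentMapTo (Y := Tangent x₀) (chart x₀) p (chart x₀ p)
      (tangentMapTo (chart x₀).symm (chart x₀ p) p v) = v := by
  have hc := (chart x₀).map_source hp
  rw [← tangentMapTo_comp_apply (smoothAt_chart hp) (smoothAt_chart_symm hc)
    ((chart x₀).left_inv hp) rfl]
  rw [tangentMapTo_congr (g := fun a ↦ a), tangentMapTo_id]; · rfl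
  filter_upwards [(chart x₀).open_target.mem_nhds hc] with z hz using (chart x₀).right_inv hz

theorem tangentMapTo_chart_symm_self (x : X) :
    tangentMapTo (chart x).symm (chart x x) x = ContinuousLinearMap.id ℝ (Tangent x) :=
  tangentMapTo_id x

theorem SmoothAt.prodMk {f : X → B} {g : X → B'} {x : X} (hf : SmoothAt f x) (hg : SmoothAt g x) :
    SmoothAt (fun a ↦ (f a, g a)) x :=
  ⟨hf.1.prodMk hg.1, hf.2.prodMk hg.2⟩

end SmoothAt

/-! ### The action in charts -/

section Action

variable (𝔤 : Type*) [NormedAddCommGroup 𝔤] (G : Type*) [Group G] [TopologicalSpace G]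
  [ChartedSpace 𝔤 G]

theorem chartAt_one_symm : (chartAt 𝔤 (1 : G)).symm (chartAt 𝔤 (1 : G) 1) = 1 :=
  (chartAt 𝔤 (1 : G)).left_inv (_root_.mem_chart_source 𝔤 _)

theorem chartAt_one_mem_target : chartAt 𝔤 (1 : G) 1 ∈ (chartAt 𝔤 (1 : G)).target :=
  (chartAt 𝔤 (1 : G)).map_source (_root_.mem_chart_source 𝔤 _)

end Action

section Action

variable {𝔤 : Type*} [NormedAddCommGroup 𝔤] [NormedSpace ℝ 𝔤]
  {G : Type*} [Group G] [TopologicalSpace G] [ChartedSpace 𝔤 G]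
  {M : Type*} [TopologicalSpace M] [BanachManifold M] [MulAction G M]

theorem SmoothAction.isOpen_domain (h : SmoothAction 𝔤 G M) (γ : G) (x y : M) :
    IsOpen {p : 𝔤 × Tangent x | p.1 ∈ (chartAt 𝔤 γ).target ∧ p.2 ∈ (chart x).target ∧
      (chartAt 𝔤 γ).symm p.1 • (chart x).symm p.2 ∈ (chart y).source} := by
  have h₁ : IsOpen ((chartAt 𝔤 γ).target ×ˢ (chart x).target) :=
    (chartAt 𝔤 γ).open_target.prod (chart x).open_target
  have h₂ : ContinuousOn (fun p : 𝔤 × Tangent x ↦ (chartAt 𝔤 γ).symm p.1 • (chart x).symm p.2)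
      ((chartAt 𝔤 γ).target ×ˢ (chart x).target) :=
    h.continuous.comp_continuousOn
      (((chartAt 𝔤 γ).continuousOn_symm.comp continuousOn_fst fun p hp ↦ hp.1).prodMk
      ((chart x).continuousOn_symm.comp continuousOn_snd fun p hp ↦ hp.2))
  convert h₂.isOpen_inter_preimage h₁ (chart y).open_source using 1
  ext p
  simp [and_assoc]

end Action

section Action

variable {𝔤 : Type*} [NormedAddCommGroup 𝔤] [NormedSpace ℝ 𝔤] [CompleteSpace 𝔤]
  {G : Type*} [Group G] [TopologicalSpace G] [ChartedSpace 𝔤 G]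
  {M : Type*} [TopologicalSpace M] [BanachManifold M] [MulAction G M]
  {B : Type*} [NormedAddCommGroup B] [NormedSpace ℝ B] [CompleteSpace B]

theorem SmoothAction.smoothAt_pair (h : SmoothAction 𝔤 G M) {γ : G} {s : 𝔤} {x : M}
    (hs : s ∈ (chartAt 𝔤 γ).target) :
    SmoothAt (fun p : 𝔤 × Tangent x ↦ (chartAt 𝔤 γ).symm p.1 • (chart x).symm p.2)
      (s, chart x x) := by
  have hx := (chart x).map_source (mem_chart_source x)
  have h₁ : ContinuousAt (chartAt 𝔤 γ).symm s := (chartAt 𝔤 γ).continuousAt_symm hs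
  have h₂ := (chart x).continuousAt_symm hx
  have hc : ContinuousAt (fun p : 𝔤 × Tangent x ↦ (chartAt 𝔤 γ).symm p.1 • (chart x).symm p.2)
      (s, chart x x) :=
    h.continuous.continuousAt.comp
      (f := fun p : 𝔤 × Tangent x ↦ ((chartAt 𝔤 γ).symm p.1, (chart x).symm p.2))
      ((h₁.comp (f := Prod.fst) (x := (s, chart x x)) continuousAt_fst).prodMk
        (h₂.comp (f := Prod.snd) (x := (s, chart x x)) continuousAt_snd))
  refine ⟨hc, (h.contDiffOn γ x _).contDiffAt ?_⟩
  have n₁ : ∀ᶠ p : 𝔤 × Tangent x in 𝓝 (s, chart x x), p.1 ∈ (chartAt 𝔤 γ).target :=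
    continuousAt_fst.eventually ((chartAt 𝔤 γ).open_target.mem_nhds hs)
  have n₂ : ∀ᶠ p : 𝔤 × Tangent x in 𝓝 (s, chart x x), p.2 ∈ (chart x).target :=
    continuousAt_snd.eventually ((chart x).open_target.mem_nhds hx)
  filter_upwards [n₁, n₂, hc.eventually ((chart _).open_source.mem_nhds (mem_chart_source _))]
    with p h₁ h₂ h₃ using ⟨h₁, h₂, h₃⟩

/-- Reduces smoothness of translations, orbit maps and the restricted action to composition with the
action map. -/
theorem SmoothAction.smoothAt_smul (h : SmoothAction 𝔤 G M) {Y : Type*} [TopologicalSpace Y]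
    [BanachManifold Y] {γ : G} {f : Y → 𝔤} {u : Y → M} {y : Y}
    (hy : f y ∈ (chartAt 𝔤 γ).target) (hf : SmoothAt f y) (hu : SmoothAt u y) :
    SmoothAt (fun b ↦ (chartAt 𝔤 γ).symm (f b) • u b) y := by
  have h₁ := (h.smoothAt_pair (x := u y) hy).comp
    (hf.prodMk ((smoothAt_chart (mem_chart_source (u y))).comp hu rfl)) rfl
  refine h₁.congr ?_
  filter_upwards [hu.1.eventually ((chart _).open_source.mem_nhds (mem_chart_source _))] with b hb
  simp [(chart (u y)).left_inv hb]

theorem SmoothAction.smoothAt_const_smul (h : SmoothAction 𝔤 G M) (γ : G) (x : M) :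
    SmoothAt (fun y : M ↦ γ • y) x := by
  have h₁ := h.smoothAt_smul (γ := γ) (f := fun _ : M ↦ chartAt 𝔤 γ γ) (y := x)
    ((chartAt 𝔤 γ).map_source (_root_.mem_chart_source 𝔤 γ)) (smoothAt_const _ _) (smoothAt_id x)
  simpa [(chartAt 𝔤 γ).left_inv (_root_.mem_chart_source 𝔤 γ)] using h₁

variable (𝔤 G) in
theorem infinitesimalAction_eq (x : M) : infinitesimalAction 𝔤 G x =
    tangentMapTo (fun s ↦ (chartAt 𝔤 (1 : G)).symm s • x) (chartAt 𝔤 (1 : G) 1) x := rfl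

theorem SmoothAction.smoothAt_orbit (h : SmoothAction 𝔤 G M) (x : M) :
    SmoothAt (fun s ↦ (chartAt 𝔤 (1 : G)).symm s • x) (chartAt 𝔤 (1 : G) 1) :=
  h.smoothAt_smul (chartAt_one_mem_target 𝔤 G) (smoothAt_id _) (smoothAt_const _ _)

end Action

end BanachManifold

namespace BanachManifold

/-! ### The inverse function theorem on open sets -/

section InverseFunction

variable {E : Type*} [NormedAddCommGroup E] [NormedSpace ℝ E] [CompleteSpace E]
  {F : Type*} [NormedAddCommGroup F] [NormedSpace ℝ F]

/-- The inverse function theorem, with a smooth inverse on an open set. -/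
theorem exists_openPartialHomeomorph_of_contDiffOn {f : E → F} {U : Set E} (hU : IsOpen U)
    (hf : ContDiffOn ℝ ∞ f U) {a : E} (ha : a ∈ U) (f' : E ≃L[ℝ] F)
    (hf' : HasFDerivAt f (f' : E →L[ℝ] F) a) :
    ∃ e : OpenPartialHomeomorph E F, a ∈ e.source ∧ e.source ⊆ U ∧ (∀ x, e x = f x) ∧
      ∀ b ∈ e.target, ContDiffAt ℝ ∞ e.symm b := by
  have hfa := hf.contDiffAt (hU.mem_nhds ha)
  let e₀ := hfa.toOpenPartialHomeomorph f hf' (by simp)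
  have hcont : ContinuousOn (fderiv ℝ f) U := hf.continuousOn_fderiv_of_isOpen hU (by simp)
  -- Invertible operators form an open set. Restricting to the points with invertible derivative
  -- makes the inverse smooth on the whole target, not only at the image of `a`.
  have hopen : IsOpen (U ∩ fderiv ℝ f ⁻¹' range ((↑) : (E ≃L[ℝ] F) → E →L[ℝ] F)) :=
    hcont.isOpen_inter_preimage hU ContinuousLinearEquiv.isOpen
  refine ⟨e₀.restrOpen _ hopen, ⟨hfa.mem_toOpenPartialHomeomorph_source hf' (by simp), ha, f', ?_⟩,
    fun x hx ↦ hx.2.1, fun x ↦ rfl, fun b hb ↦ ?_⟩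
  · exact hf'.fderiv.symm
  · have hb' := (e₀.restrOpen _ hopen).map_target hb
    obtain ⟨g', hg'⟩ := hb'.2.2
    have hd := hf.contDiffAt (hU.mem_nhds hb'.2.1)
    refine OpenPartialHomeomorph.contDiffAt_symm (f₀' := g') _ hb ?_ hd
    rw [hg']
    exact (hd.differentiableAt (by simp)).hasFDerivAt

end InverseFunction

/-! ### Coercive forms on Banach spaces -/

section Coercive

variable {V : Type*} [NormedAddCommGroup V] [NormedSpace ℝ V] [CompleteSpace V]

/-- The Riesz representation theorem for a symmetric coercive form on a Banach space. -/
theorem bijective_of_coercive (B : V →L[ℝ] V →L[ℝ] ℝ) (hB : ∀ x y, B x y = B y x) {c : ℝ}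
    (hc : 0 < c) (h : ∀ x, c * ‖x‖ ^ 2 ≤ B x x) : Function.Bijective B := by
  have hdef : ∀ x, B x x = 0 → x = 0 := fun x hx ↦ by
    have h₁ := h x
    rw [hx] at h₁
    have h₂ : ‖x‖ ^ 2 = 0 := le_antisymm (by nlinarith) (sq_nonneg _)
    exact norm_eq_zero.1 (pow_eq_zero_iff two_ne_zero |>.1 h₂)
  refine ⟨(injective_iff_map_eq_zero B).2 fun x hx ↦ hdef x (by rw [hx]; rfl), fun φ ↦ ?_⟩
  -- The norm of the form is placed on a separate type `W`, so that it does not clash with the given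
  -- norm of `V`.
  obtain ⟨W, _, _, e, he⟩ : ∃ (W : Type _) (_ : NormedAddCommGroup W)
      (_ : InnerProductSpace ℝ W) (e : V ≃ₗ[ℝ] W), ∀ x y, inner ℝ (e x) (e y) = B x y := by
    let core : InnerProductSpace.Core ℝ V :=
      { inner x y := B x y
        conj_inner_symm x y := hB y x
        re_inner_nonneg x := (by positivity : (0 : ℝ) ≤ c * ‖x‖ ^ 2).trans (h x)
        add_left x y z := by simp
        smul_left x y r := by simp
        definite := hdef }
    exact ⟨V, core.toNormedAddCommGroup, InnerProductSpace.ofCore core.toCore, LinearEquiv.refl ℝ V,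
      fun x y ↦ rfl⟩
  have hnorm : ∀ x, ‖e x‖ ^ 2 = B x x := fun x ↦ by
    rw [← he, real_inner_self_eq_norm_sq]
  have hle : ∀ x, ‖e x‖ ≤ √‖B‖ * ‖x‖ := fun x ↦ by
    refine le_of_sq_le_sq ?_ (by positivity)
    rw [hnorm, mul_pow, Real.sq_sqrt (norm_nonneg B), sq, ← mul_assoc]
    exact (le_abs_self _).trans (B.le_opNorm₂ x x)
  have hge : ∀ y, ‖e.symm y‖ ≤ (√c)⁻¹ * ‖y‖ := fun y ↦ by
    refine le_of_sq_le_sq ?_ (by positivity)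
    have h₁ := h (e.symm y)
    rw [← hnorm, e.apply_symm_apply] at h₁
    rw [mul_pow, inv_pow, Real.sq_sqrt hc.le, inv_mul_eq_div, le_div_iff₀ hc]
    linarith
  let e' : V ≃L[ℝ] W := e.toContinuousLinearEquivOfBounds _ _ hle hge
  -- Boundedness and coercivity make the two norms equivalent, so completeness passes from `V` to
  -- `W`.
  have : CompleteSpace W := e'.symm.isUniformEmbedding.isUniformInducing.completeSpace_congr
    e'.symm.surjective |>.2 inferInstance
  refine ⟨e.symm ((InnerProductSpace.toDual ℝ W).symm (φ.comp (e'.symm : W →L[ℝ] V))), ?_⟩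
  ext y
  rw [← he, e.apply_symm_apply, InnerProductSpace.toDual_symm_apply]
  exact congrArg φ (e.symm_apply_apply y)

omit [CompleteSpace V] in
/-- A positive form all of whose bounded functionals are bounded in the norm of the form is
coercive. -/
theorem exists_coercive_of_bounded (B : V →L[ℝ] V →L[ℝ] ℝ) (hpos : ∀ x, 0 ≤ B x x)
    (h : ∀ φ : V →L[ℝ] ℝ, ∃ C, ∀ x, |φ x| ≤ C * √(B x x)) :
    ∃ c > 0, ∀ x, c * ‖x‖ ^ 2 ≤ B x x := by
  -- The unit ball of the form is weakly bounded by assumption, hence bounded in norm when viewed in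
  -- the bidual.
  obtain ⟨C, hC⟩ := banach_steinhaus
    (g := fun x : {x : V // B x x ≤ 1} ↦ NormedSpace.inclusionInDoubleDual ℝ V x.1) fun φ ↦ by
      obtain ⟨C, hC⟩ := h φ
      refine ⟨|C|, fun x ↦ ?_⟩
      calc ‖φ x.1‖ ≤ C * √(B x.1 x.1) := hC x
        _ ≤ |C| * 1 := mul_le_mul (le_abs_self C) (Real.sqrt_le_one.2 x.2) (by positivity)
          (abs_nonneg C)
        _ = |C| := mul_one _
  have hC' : ∀ x : V, B x x ≤ 1 → ‖x‖ ≤ C := fun x hx ↦ by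
    have := hC ⟨x, hx⟩
    rwa [← (NormedSpace.inclusionInDoubleDualLi ℝ (E := V)).norm_map x]
  have hC₀ : 0 ≤ C := (norm_nonneg _).trans (hC' 0 (by simp))
  -- A vector violating coercivity, rescaled to norm `C + 1`, would still lie in the unit ball of
  -- the form, whose norm bound is `C`. Using `C + 1` also avoids division by zero.
  refine ⟨((C + 1) ^ 2)⁻¹, by positivity, fun x ↦ ?_⟩
  by_contra! hx
  have hx₀ : 0 < ‖x‖ := by
    by_contra! h₀
    have : ‖x‖ = 0 := le_antisymm h₀ (norm_nonneg _)
    rw [this] at hx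
    linarith [hpos x]
  have h₁ : B (((C + 1) / ‖x‖) • x) (((C + 1) / ‖x‖) • x) ≤ 1 := by
    simp only [map_smul, smul_apply, smul_eq_mul]
    have : (C + 1) / ‖x‖ * ((C + 1) / ‖x‖ * B x x) = (C + 1) ^ 2 * B x x / ‖x‖ ^ 2 := by
      field_simp
    rw [this, div_le_one (by positivity)]
    rw [inv_mul_eq_div, lt_div_iff₀ (by positivity)] at hx
    linarith
  have h₂ := hC' _ h₁
  rw [norm_smul, Real.norm_of_nonneg (by positivity), div_mul_cancel₀ _ hx₀.ne'] at h₂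
  linarith

end Coercive

/-! ### Pullbacks of forms and brackets of related fields -/

section Forms

variable {E : Type*} [NormedAddCommGroup E] [NormedSpace ℝ E]
  {H : Type*} [NormedAddCommGroup H] [NormedSpace ℝ H]
  {F : Type*} [NormedAddCommGroup F] [NormedSpace ℝ F]

theorem two_le_infty : (2 : WithTop ℕ∞) ≤ ∞ := WithTop.coe_le_coe.2 (le_top (a := (2 : ℕ∞)))

theorem contDiff_flip {n : WithTop ℕ∞} :
    ContDiff ℝ n (ContinuousLinearMap.flip : (E →L[ℝ] H →L[ℝ] F) → H →L[ℝ] E →L[ℝ] F) :=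
  LinearIsometryEquiv.contDiff (𝕜 := ℝ) (E := E →L[ℝ] H →L[ℝ] F) (F := H →L[ℝ] E →L[ℝ] F)
    (ContinuousLinearMap.flipₗᵢ ℝ E H F)

theorem contDiffAt_bilinearComp {n : WithTop ℕ∞} {H' : Type*} [NormedAddCommGroup H']
    [NormedSpace ℝ H'] {b : F → E →L[ℝ] E →L[ℝ] ℝ} {A : F → H →L[ℝ] E} {A' : F → H' →L[ℝ] E} {x : F}
    (hb : ContDiffAt ℝ n b x) (hA : ContDiffAt ℝ n A x) (hA' : ContDiffAt ℝ n A' x) :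
    ContDiffAt ℝ n (fun y ↦ (b y).bilinearComp (A y) (A' y)) x :=
  contDiff_flip.contDiffAt.comp x
    ((contDiff_flip.contDiffAt.comp x (hb.clm_comp hA)).clm_comp hA')

/-- The pullback of a closed form is closed. -/
theorem closed_pullback {s : H → E} {Ω : E → E →L[ℝ] E →L[ℝ] ℝ} {h : H} (hs : ContDiffAt ℝ ∞ s h)
    (hΩ : ContDiffAt ℝ ∞ Ω (s h)) (hanti : ∀ a b, Ω (s h) a b = -Ω (s h) b a)
    (hclosed : ∀ a b c, fderiv ℝ Ω (s h) a b c + fderiv ℝ Ω (s h) b c a +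
      fderiv ℝ Ω (s h) c a b = 0) (a b c : H) :
    fderiv ℝ (fun y ↦ (Ω (s y)).bilinearComp (fderiv ℝ s y) (fderiv ℝ s y)) h a b c +
      fderiv ℝ (fun y ↦ (Ω (s y)).bilinearComp (fderiv ℝ s y) (fderiv ℝ s y)) h b c a +
      fderiv ℝ (fun y ↦ (Ω (s y)).bilinearComp (fderiv ℝ s y) (fderiv ℝ s y)) h c a b = 0 := by
  have hds : ContDiffAt ℝ ∞ (fderiv ℝ s) h := hs.fderiv_right (by simp)
  have hF := (contDiffAt_bilinearComp (hΩ.comp h hs) hds hds).differentiableAt (by simp)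
  -- The product rule. In the cyclic sum the second derivatives of `s` cancel by their symmetry and
  -- the antisymmetry of `Ω`.
  have key : ∀ a b c : H,
      fderiv ℝ (fun y ↦ (Ω (s y)).bilinearComp (fderiv ℝ s y) (fderiv ℝ s y)) h a b c =
      fderiv ℝ Ω (s h) (fderiv ℝ s h a) (fderiv ℝ s h b) (fderiv ℝ s h c) +
      Ω (s h) (fderiv ℝ (fderiv ℝ s) h a b) (fderiv ℝ s h c) +
      Ω (s h) (fderiv ℝ s h b) (fderiv ℝ (fderiv ℝ s) h a c) := by
    intro a b c
    have h₁ := (hF.hasFDerivAt.clm_apply (hasFDerivAt_const b h)).clm_apply (hasFDerivAt_const c h)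
    have hd := (hds.differentiableAt (by simp)).hasFDerivAt
    have h₂ := (((hΩ.differentiableAt (by simp)).hasFDerivAt.comp h
      (hs.differentiableAt (by simp)).hasFDerivAt).clm_apply
      (hd.clm_apply (hasFDerivAt_const b h))).clm_apply (hd.clm_apply (hasFDerivAt_const c h))
    have h₃ := DFunLike.congr_fun (h₁.unique h₂) a
    simp at h₃
    rw [h₃]
    ring
  have hsymm : ∀ a b, fderiv ℝ (fderiv ℝ s) h a b = fderiv ℝ (fderiv ℝ s) h b a :=
    hs.isSymmSndFDerivAt (by simpa using two_le_infty)
  rw [key, key, key, hsymm b a, hsymm c a, hsymm c b]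
  have e₁ := hanti (fderiv ℝ (fderiv ℝ s) h a b) (fderiv ℝ s h c)
  have e₂ := hanti (fderiv ℝ (fderiv ℝ s) h a c) (fderiv ℝ s h b)
  have e₃ := hanti (fderiv ℝ (fderiv ℝ s) h b c) (fderiv ℝ s h a)
  linarith [hclosed (fderiv ℝ s h a) (fderiv ℝ s h b) (fderiv ℝ s h c)]

/-- The value of the Nijenhuis expression at a point depends only on the values of the vector
fields there. -/
theorem nijenhuis_eq_tensor {J : E → E →L[ℝ] E} {V W : E → E} {p : E}
    (hJ : DifferentiableAt ℝ J p) (hV : DifferentiableAt ℝ V p) (hW : DifferentiableAt ℝ W p)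
    (hsq : ∀ x, J p (J p x) = -x) :
    nijenhuis J V W p = J p (fderiv ℝ J p (V p) (W p)) - J p (fderiv ℝ J p (W p) (V p))
      - fderiv ℝ J p (J p (V p)) (W p) + fderiv ℝ J p (J p (W p)) (V p) := by
  have h₁ : ∀ {V : E → E}, DifferentiableAt ℝ V p → ∀ x, fderiv ℝ (fun q ↦ J q (V q)) p x =
      fderiv ℝ J p x (V p) + J p (fderiv ℝ V p x) := fun hV x ↦ by
    have := (hJ.hasFDerivAt.clm_apply hV.hasFDerivAt).fderiv
    rw [this]
    simp [add_comm]
  -- The derivatives of `V` and `W` cancel because `J` squares to `-1` at `p`.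
  simp only [nijenhuis, VectorField.lieBracket, h₁ hV, h₁ hW, map_add, map_sub, hsq]
  abel

/-- The fields are `f`-related only along the image of `s`, so the relation may be differentiated
only in directions from the range of `s'`. That is enough: the bracket uses only the directions `V`
and `W` at the point, and the second derivatives of `f` cancel by symmetry. -/
theorem lieBracket_of_related_along {s : H → E} {s' : H →L[ℝ] E} {f : E → F} {h : H}
    {V W : E → E} {v w : F → F} (hs : HasFDerivAt s s' h) (hf : ContDiffAt ℝ ∞ f (s h))
    (hV : DifferentiableAt ℝ V (s h)) (hW : DifferentiableAt ℝ W (s h))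
    (hv : DifferentiableAt ℝ v (f (s h))) (hw : DifferentiableAt ℝ w (f (s h)))
    (rV : ∀ᶠ y in 𝓝 h, fderiv ℝ f (s y) (V (s y)) = v (f (s y)))
    (rW : ∀ᶠ y in 𝓝 h, fderiv ℝ f (s y) (W (s y)) = w (f (s y)))
    (tV : V (s h) ∈ s'.range) (tW : W (s h) ∈ s'.range) :
    fderiv ℝ f (s h) (VectorField.lieBracket ℝ V W (s h)) =
      VectorField.lieBracket ℝ v w (f (s h)) := by
  have hdf : DifferentiableAt ℝ (fderiv ℝ f) (s h) :=
    (hf.fderiv_right (m := ∞) (by simp)).differentiableAt (by simp)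
  have hff := (hf.differentiableAt (by simp)).hasFDerivAt
  have key : ∀ {V : E → E} {v : F → F}, DifferentiableAt ℝ V (s h) →
      DifferentiableAt ℝ v (f (s h)) → (∀ᶠ y in 𝓝 h, fderiv ℝ f (s y) (V (s y)) = v (f (s y))) →
      ∀ b, fderiv ℝ (fderiv ℝ f) (s h) (s' b) (V (s h)) + fderiv ℝ f (s h) (fderiv ℝ V (s h) (s' b))
        = fderiv ℝ v (f (s h)) (fderiv ℝ f (s h) (s' b)) := fun {V v} hV hv r b ↦ by
    have h₁ := (hdf.hasFDerivAt.comp h hs).clm_apply (hV.hasFDerivAt.comp h hs)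
    have h₂ := (hv.hasFDerivAt.comp h (hff.comp h hs))
    have h₃ := DFunLike.congr_fun (h₁.unique (h₂.congr_of_eventuallyEq r)) b
    simp at h₃
    rw [← h₃, add_comm]
  obtain ⟨a, ha⟩ := tV
  obtain ⟨b, hb⟩ := tW
  have k₁ := key hV hv rV b
  have k₂ := key hW hw rW a
  change s' a = _ at ha
  change s' b = _ at hb
  rw [hb] at k₁
  rw [ha] at k₂
  have hsymm : fderiv ℝ (fderiv ℝ f) (s h) (W (s h)) (V (s h)) =
      fderiv ℝ (fderiv ℝ f) (s h) (V (s h)) (W (s h)) :=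
    hf.isSymmSndFDerivAt (by simpa using two_le_infty) _ _
  rw [VectorField.lieBracket, VectorField.lieBracket, map_sub, ← rV.self_of_nhds,
    ← rW.self_of_nhds, ← k₁, ← k₂, hsymm]
  abel

end Forms

end BanachManifold

namespace BanachManifold

/-! ### Descent of integrability -/

section Nijenhuis

variable {E : Type*} [NormedAddCommGroup E] [NormedSpace ℝ E]
  {H : Type*} [NormedAddCommGroup H] [NormedSpace ℝ H]
  {F : Type*} [NormedAddCommGroup F] [NormedSpace ℝ F]

theorem nijenhuis_congr {J : E → E →L[ℝ] E} {V W V' W' : E → E} {p : E}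
    (hJ : DifferentiableAt ℝ J p) (hV : DifferentiableAt ℝ V p) (hW : DifferentiableAt ℝ W p)
    (hV' : DifferentiableAt ℝ V' p) (hW' : DifferentiableAt ℝ W' p)
    (hsq : ∀ x, J p (J p x) = -x) (eV : V p = V' p) (eW : W p = W' p) :
    nijenhuis J V W p = nijenhuis J V' W' p := by
  rw [nijenhuis_eq_tensor hJ hV hW hsq, nijenhuis_eq_tensor hJ hV' hW' hsq, eV, eW]

/-- Integrability descends to quotients: `s` is a local section of the projection `r` on the zero
set of a map, `L` are the horizontal lifts along `s`, which are `J`-invariant, and `s` is horizontal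
at the point `h`. -/
theorem nijenhuis_of_horizontal {J : E → E →L[ℝ] E} {s : H → E} {r : E → H} {L : H → H →L[ℝ] E}
    {J' : H → H →L[ℝ] H} {m : E → F} {h : H} (T : Submodule ℝ E)
    (hJ : DifferentiableAt ℝ J (s h)) (hsq : ∀ x, J (s h) (J (s h) x) = -x)
    (hN : ∀ x y : E, nijenhuis J (fun _ ↦ x) (fun _ ↦ y) (s h) = 0)
    (hs : HasFDerivAt s (L h) h) (hr : ContDiffAt ℝ ∞ r (s h)) (hrs : ∀ᶠ y in 𝓝 h, r (s y) = y)
    (hL : DifferentiableAt ℝ L h) (hJ' : DifferentiableAt ℝ J' h)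
    (hJL : ∀ᶠ y in 𝓝 h, ∀ u, J (s y) (L y u) = L y (J' y u))
    (hrL : ∀ᶠ y in 𝓝 h, ∀ u, fderiv ℝ r (s y) (L y u) = u)
    (hm : ContDiffAt ℝ ∞ m (s h)) (hmL : ∀ᶠ y in 𝓝 h, ∀ u, fderiv ℝ m (s y) (L y u) = 0)
    (hdec : ∀ z, fderiv ℝ m (s h) z = 0 → z - L h (fderiv ℝ r (s h) z) ∈ T)
    (hT : ∀ a ∈ T, ∀ b ∈ T, ∀ w, a + J (s h) b + L h w = 0 → w = 0) (u v : H) :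
    nijenhuis J' (fun _ ↦ u) (fun _ ↦ v) h = 0 := by
  have hrh : r (s h) = h := hrs.self_of_nhds
  -- The lifts exist only along `s`; composing with `r` extends them to fields near `s h`. These
  -- need not be horizontal or tangent to the level set away from the section.
  have hLr : DifferentiableAt ℝ (fun a ↦ L (r a)) (s h) :=
    DifferentiableAt.comp (s h) (by rwa [hrh]) (hr.differentiableAt (by simp))
  have d₁ : ∀ u, DifferentiableAt ℝ (fun a ↦ L (r a) u) (s h) := fun u ↦
    hLr.clm_apply (differentiableAt_const u)
  have d₂ : ∀ u, DifferentiableAt ℝ (fun a ↦ J a (L (r a) u)) (s h) := fun u ↦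
    hJ.clm_apply (d₁ u)
  have d₃ : ∀ u, DifferentiableAt ℝ (fun y ↦ J' y u) (r (s h)) := fun u ↦ by
    rw [hrh]; exact hJ'.clm_apply (differentiableAt_const u)
  have r₁ : ∀ u, ∀ᶠ y in 𝓝 h, fderiv ℝ r (s y) (L (r (s y)) u) = u := fun u ↦ by
    filter_upwards [hrs, hrL] with y h₁ h₂ using by rw [h₁, h₂]
  have r₂ : ∀ u, ∀ᶠ y in 𝓝 h, fderiv ℝ r (s y) (J (s y) (L (r (s y)) u)) = J' (r (s y)) u :=
    fun u ↦ by filter_upwards [hrs, hrL, hJL] with y h₁ h₂ h₃ using by rw [h₁, h₃, h₂]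
  have m₁ : ∀ u, ∀ᶠ y in 𝓝 h, fderiv ℝ m (s y) (L (r (s y)) u) = 0 := fun u ↦ by
    filter_upwards [hrs, hmL] with y h₁ h₂ using by rw [h₁, h₂]
  have m₂ : ∀ u, ∀ᶠ y in 𝓝 h, fderiv ℝ m (s y) (J (s y) (L (r (s y)) u)) = 0 :=
    fun u ↦ by filter_upwards [hrs, hmL, hJL] with y h₁ h₂ h₃ using by rw [h₁, h₃, h₂]
  have t₁ : ∀ u, L (r (s h)) u ∈ (L h).range := fun u ↦ ⟨u, by rw [hrh]; rfl⟩
  have t₂ : ∀ u, J (s h) (L (r (s h)) u) ∈ (L h).range := fun u ↦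
    ⟨J' h u, by rw [hrh, hJL.self_of_nhds]; rfl⟩
  -- Upstairs brackets are tangent to the level set (relatedness to zero under `m`) and project to
  -- downstairs brackets (relatedness under `r`), so they agree with the lifted brackets modulo `T`.
  have key : ∀ {V W : E → E} {v w : H → H}, DifferentiableAt ℝ V (s h) →
      DifferentiableAt ℝ W (s h) → DifferentiableAt ℝ v (r (s h)) →
      DifferentiableAt ℝ w (r (s h)) → (∀ᶠ y in 𝓝 h, fderiv ℝ r (s y) (V (s y)) = v (r (s y))) →
      (∀ᶠ y in 𝓝 h, fderiv ℝ r (s y) (W (s y)) = w (r (s y))) →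
      (∀ᶠ y in 𝓝 h, fderiv ℝ m (s y) (V (s y)) = 0) →
      (∀ᶠ y in 𝓝 h, fderiv ℝ m (s y) (W (s y)) = 0) →
      V (s h) ∈ (L h).range → W (s h) ∈ (L h).range →
      VectorField.lieBracket ℝ V W (s h) - L h (VectorField.lieBracket ℝ v w h) ∈ T := by
    intro V W v w hV hW hv hw rV rW mV mW tV tW
    have e₁ := lieBracket_of_related_along hs hr hV hW hv hw rV rW tV tW
    have e₂ := lieBracket_of_related_along hs hm hV hW (differentiableAt_const (0 : F))
      (differentiableAt_const (0 : F)) mV mW tV tW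
    have e₃ := hdec _ (e₂.trans (by simp [VectorField.lieBracket]))
    rwa [e₁, hrh] at e₃
  have c : ∀ u : H, DifferentiableAt ℝ (fun _ : H ↦ u) (r (s h)) :=
    fun u ↦ differentiableAt_const u
  have kA := key (d₁ u) (d₁ v) (c u) (c v) (r₁ u) (r₁ v) (m₁ u) (m₁ v) (t₁ u) (t₁ v)
  have kB := key (d₁ u) (d₂ v) (c u) (d₃ v) (r₁ u) (r₂ v) (m₁ u) (m₂ v) (t₁ u) (t₂ v)
  have kC := key (d₂ u) (d₁ v) (d₃ u) (c v) (r₂ u) (r₁ v) (m₂ u) (m₁ v) (t₂ u) (t₁ v)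
  have kD := key (d₂ u) (d₂ v) (d₃ u) (d₃ v) (r₂ u) (r₂ v) (m₂ u) (m₂ v) (t₂ u) (t₂ v)
  -- Tensoriality replaces the extended lifts by constant fields with the same values at the point.
  have hz : nijenhuis J (fun a ↦ L (r a) u) (fun a ↦ L (r a) v) (s h) = 0 := by
    rw [← hN (L (r (s h)) u) (L (r (s h)) v)]
    exact nijenhuis_congr hJ (d₁ u) (d₁ v) (differentiableAt_const _) (differentiableAt_const _)
      hsq rfl rfl
  refine hT _ (T.sub_mem kA kD) _ (T.add_mem kB kC) _ ?_
  rw [← hz]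
  simp only [nijenhuis, map_add, map_sub, ← hJL.self_of_nhds]
  abel

end Nijenhuis

end BanachManifold

/-! ### Level sets of regular values -/

namespace BanachManifold

/-- A subset of `X` with a manifold structure for which the inclusion is smooth and which is locally
a smooth retract. -/
structure IsEmbedded {X : Type*} [TopologicalSpace X] [BanachManifold X] (N : Set X)
    [BanachManifold N] : Prop where
  smoothAt_val : ∀ y : N, SmoothAt (Subtype.val : N → X) y
  exists_retraction : ∀ y : N, ∃ r : X → N,
    (∀ᶠ z in 𝓝 (y : X), SmoothAt r z) ∧ ∀ᶠ z : N in 𝓝 y, r (z : X) = z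

section LevelSet

variable {F : Type*} [NormedAddCommGroup F] [NormedSpace ℝ F] [CompleteSpace F]

/-- With `P` a continuous projection onto the kernel, `a ↦ (P (a - a₀), f a)` has invertible
derivative at `a₀`. Its inverse restricted to second coordinate `ξ` is the parametrization `ψ`. The
last clause makes the tangent map of the inclusion at `x` the inclusion of the kernel itself. -/
theorem exists_levelSet_chart {X : Type*} [TopologicalSpace X] [BanachManifold X]
    {f : X → F} {ξ : F} (hf : SmoothInto f) (hξ : IsRegularValue f ξ) (x : f ⁻¹' {ξ}) :
    ∃ (P : Tangent (x : X) →L[ℝ] (differential f (x : X)).ker)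
      (c : OpenPartialHomeomorph (f ⁻¹' {ξ}) (differential f (x : X)).ker)
      (ψ : (differential f (x : X)).ker → Tangent (x : X)),
      x ∈ c.source ∧ (∀ y ∈ c.source, (y : X) ∈ (chart (x : X)).source) ∧
      (∀ y, c y = P (chart (x : X) y - chart (x : X) x)) ∧
      (∀ k ∈ c.target, (c.symm k : X) = (chart (x : X)).symm (ψ k) ∧
        ψ k ∈ (chart (x : X)).target ∧ ContDiffAt ℝ ∞ ψ k) ∧
      ∀ k, fderiv ℝ ψ (c x) k = k := by
  classical
  obtain ⟨hsurj, P, hP⟩ := hξ x x.2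
  set a₀ := chart (x : X) x with ha₀
  have hm := hf (x : X)
  have ha₀t : a₀ ∈ (chart (x : X)).target := (chart (x : X)).map_source (mem_chart_source _)
  have ht := (chart (x : X)).open_target
  have hda : HasFDerivAt (fun a ↦ f ((chart (x : X)).symm a)) (differential f (x : X)) a₀ :=
    ((hm.contDiffAt (ht.mem_nhds ha₀t)).differentiableAt (by simp)).hasFDerivAt
  have hbij : Function.Bijective (P.prod (differential f (x : X))) := by
    refine ⟨(injective_iff_map_eq_zero _).2 fun v hv ↦ ?_, fun ⟨k, b⟩ ↦ ?_⟩
    · have h₁ : P v = 0 := congrArg Prod.fst hv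
      have h₂ : differential f (x : X) v = 0 := congrArg Prod.snd hv
      rw [hP ⟨v, h₂⟩] at h₁
      exact congrArg Subtype.val h₁
    · obtain ⟨v, hv⟩ := hsurj b
      refine ⟨v - P v + k, ?_⟩
      have h₁ : ∀ k : (differential f (x : X)).ker, differential f (x : X) k = 0 := fun k ↦ k.2
      ext1
      · simp [hP]
      · simp [h₁, hv]
  have : CompleteSpace (differential f (x : X)).ker :=
    (ContinuousLinearMap.isClosed_ker (differential f (x : X))).completeSpace_coe
  let Θ' := ContinuousLinearEquiv.ofBijective (P.prod (differential f (x : X)))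
    (LinearMap.ker_eq_bot.2 hbij.1) (LinearMap.range_eq_top.2 hbij.2)
  obtain ⟨e, hea, heU, hef, hes⟩ := exists_openPartialHomeomorph_of_contDiffOn ht
    (f := fun a ↦ (P (a - a₀), f ((chart (x : X)).symm a)))
    ((P.contDiff.comp (contDiff_id.sub contDiff_const)).contDiffOn.prodMk hm) ha₀t Θ'
    (by
      refine HasFDerivAt.prodMk (f₁' := P) ?_ hda
      exact P.hasFDerivAt.comp a₀ ((hasFDerivAt_id a₀).sub_const a₀))
  have hx0 : e a₀ = (0, ξ) := by
    rw [hef, sub_self, map_zero, (chart (x : X)).left_inv (mem_chart_source _)]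
    exact congrArg _ x.2
  have hval : ∀ k : (differential f (x : X)).ker, (k, ξ) ∈ e.target →
      f ((chart (x : X)).symm (e.symm (k, ξ))) = ξ := fun k hk ↦ by
    have := e.right_inv hk
    rw [hef] at this
    exact congrArg Prod.snd this
  have hfst : ∀ k : (differential f (x : X)).ker, (k, ξ) ∈ e.target →
      P (e.symm (k, ξ) - a₀) = k := fun k hk ↦ by
    have := e.right_inv hk
    rw [hef] at this
    exact congrArg Prod.fst this
  have hsrc : ∀ k : (differential f (x : X)).ker, (k, ξ) ∈ e.target →
      e.symm (k, ξ) ∈ (chart (x : X)).target := fun k hk ↦ heU (e.map_target hk)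
  have heq : ∀ y : f ⁻¹' {ξ}, e (chart (x : X) y) = (P (chart (x : X) y - a₀), ξ) ∨
      (y : X) ∉ (chart (x : X)).source := fun y ↦ by
    by_cases hy : (y : X) ∈ (chart (x : X)).source
    · left
      rw [hef, (chart (x : X)).left_inv hy]
      exact congrArg _ y.2
    · exact Or.inr hy
  let inv : (differential f (x : X)).ker → f ⁻¹' {ξ} := fun k ↦
    if hk : (k, ξ) ∈ e.target then ⟨(chart (x : X)).symm (e.symm (k, ξ)), hval k hk⟩ else x
  have hinv : ∀ k, (k, ξ) ∈ e.target → (inv k : X) = (chart (x : X)).symm (e.symm (k, ξ)) :=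
    fun k hk ↦ by simp only [inv, dif_pos hk]
  have hopen : IsOpen {k : (differential f (x : X)).ker | (k, ξ) ∈ e.target} :=
    e.open_target.preimage (by fun_prop)
  let c : OpenPartialHomeomorph (f ⁻¹' {ξ}) (differential f (x : X)).ker :=
    { toFun y := P (chart (x : X) y - a₀)
      invFun := inv
      source := {y | (y : X) ∈ ((chart (x : X)).trans e).source}
      target := {k | (k, ξ) ∈ e.target}
      map_source' y hy := by
        simp only [OpenPartialHomeomorph.trans_source, mem_inter_iff, mem_preimage,
          mem_ofPred_eq] at hy ⊢
        rw [← (heq y).resolve_right (not_not.2 hy.1)]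
        exact e.map_source hy.2
      map_target' k hk := by
        simp only [OpenPartialHomeomorph.trans_source, mem_inter_iff, mem_preimage,
          mem_ofPred_eq, hinv k hk]
        rw [(chart (x : X)).right_inv (hsrc k hk)]
        exact ⟨(chart (x : X)).map_target (hsrc k hk), e.map_target hk⟩
      left_inv' y hy := by
        simp only [OpenPartialHomeomorph.trans_source, mem_inter_iff, mem_preimage,
          mem_ofPred_eq] at hy
        have h₁ := (heq y).resolve_right (not_not.2 hy.1)
        have h₂ := e.map_source hy.2
        rw [h₁] at h₂
        refine Subtype.ext ?_
        rw [hinv _ h₂, ← h₁, e.left_inv hy.2, (chart (x : X)).left_inv hy.1]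
      right_inv' k hk := by
        change P (chart (x : X) (inv k) - a₀) = k
        rw [hinv k hk, (chart (x : X)).right_inv (hsrc k hk), hfst k hk]
      open_source := ((chart (x : X)).trans e).open_source.preimage continuous_subtype_val
      open_target := hopen
      continuousOn_toFun := by
        refine P.continuous.comp_continuousOn (ContinuousOn.sub ?_ continuousOn_const)
        exact (chart (x : X)).continuousOn.comp continuous_subtype_val.continuousOn
          fun y hy ↦ hy.1
      continuousOn_invFun := by
        rw [Topology.IsInducing.subtypeVal.continuousOn_iff]
        refine ContinuousOn.congr (f := fun k ↦ (chart (x : X)).symm (e.symm (k, ξ))) ?_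
          fun k hk ↦ hinv k hk
        exact (chart (x : X)).continuousOn_symm.comp (e.continuousOn_symm.comp
          (by fun_prop) fun k hk ↦ hk) hsrc }
  have hcx : c x = 0 := by
    change P (a₀ - a₀) = 0
    rw [sub_self, map_zero]
  have hψ : ∀ k ∈ c.target, ContDiffAt ℝ ∞ (fun k ↦ e.symm (k, ξ)) k := fun k hk ↦
    (hes (k, ξ) hk).comp k (by fun_prop)
  have hxs : x ∈ c.source := ⟨mem_chart_source _, hea⟩
  refine ⟨P, c, fun k ↦ e.symm (k, ξ), hxs, fun y hy ↦ hy.1, fun y ↦ rfl,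
    fun k hk ↦ ⟨hinv k hk, hsrc k hk, hψ k hk⟩, fun k ↦ ?_⟩
  have hct := c.map_source hxs
  have hd := ((hψ _ hct).differentiableAt (by simp)).hasFDerivAt
  have hat : e.symm (c x, ξ) = a₀ := by rw [hcx, ← hx0, e.left_inv hea]
  -- Differentiating `P (ψ k - a₀) = k` and `f (ψ k) = ξ` shows that the derivative of `ψ` takes
  -- values in the kernel, where `P` is the identity.
  have h₁ := P.hasFDerivAt.comp (c x) (hd.sub_const a₀)
  have h₂ := (h₁.unique ((hasFDerivAt_id (c x)).congr_of_eventuallyEq (by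
    filter_upwards [hopen.mem_nhds hct] with k hk using hfst k hk)))
  have h₃ := HasFDerivAt.comp (c x) (g := fun a ↦ f ((chart (x : X)).symm a))
    (by rw [hat]; exact hda) hd
  have h₄ := (h₃.unique ((hasFDerivAt_const ξ (c x)).congr_of_eventuallyEq (by
    filter_upwards [hopen.mem_nhds hct] with k hk using hval k hk)))
  have h₅ : P (fderiv ℝ (fun k ↦ e.symm (k, ξ)) (c x) k) = k := DFunLike.congr_fun h₂ k
  have h₆ : differential f (x : X) (fderiv ℝ (fun k ↦ e.symm (k, ξ)) (c x) k) = 0 :=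
    DFunLike.congr_fun h₄ k
  rw [hP ⟨_, h₆⟩] at h₅
  exact congrArg Subtype.val h₅

/-- The level set of a regular value is an embedded submanifold. -/
theorem exists_levelSet_manifold {X : Type u} [TopologicalSpace X] [BanachManifold.{u, w} X]
    {f : X → F} {ξ : F} (hf : SmoothInto f) (hξ : IsRegularValue f ξ) :
    ∃ _ : BanachManifold.{u, w} (f ⁻¹' {ξ}), IsEmbedded (f ⁻¹' {ξ}) ∧
      ∀ x : f ⁻¹' {ξ}, (tangentMap (Subtype.val : f ⁻¹' {ξ} → X) x).range =
        (differential f (x : X)).ker := by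
  choose P c ψ hxs hsrc hc hψ hd using exists_levelSet_chart hf hξ
  let iN : BanachManifold.{u, w} (f ⁻¹' {ξ}) :=
    { model x := (differential f (x : X)).ker
      completeSpace x :=
        (ContinuousLinearMap.isClosed_ker (differential f (x : X))).completeSpace_coe
      chart := c
      mem_chart_source := hxs
      contDiffOn_transition x y k hk := by
        rw [OpenPartialHomeomorph.trans_source, OpenPartialHomeomorph.symm_source] at hk
        obtain ⟨h₁, h₂, h₃⟩ := hψ x k hk.1
        have h₄ : ((c x).symm k : X) ∈ (chart (y : X)).source := hsrc y _ hk.2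
        have h₅ := contDiffAt_transition (hsrc x _ ((c x).map_target hk.1)) h₄
        rw [h₁, (chart (x : X)).right_inv h₂] at h₅
        refine ContDiffAt.contDiffWithinAt (ContDiffAt.congr_of_eventuallyEq
          (f := fun k ↦ P y (chart (y : X) ((chart (x : X)).symm (ψ x k)) - chart (y : X) y)) ?_ ?_)
        · exact (P y).contDiff.contDiffAt.comp k ((ContDiffAt.comp k h₅ h₃).sub contDiffAt_const)
        · filter_upwards [(c x).open_target.mem_nhds hk.1] with k' hk'
          simp only [OpenPartialHomeomorph.coe_trans, Function.comp_apply, hc y, (hψ x k' hk').1] }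
  have hsm : ∀ y : f ⁻¹' {ξ}, SmoothAt (Subtype.val : f ⁻¹' {ξ} → X) y ∧
      tangentMap (Subtype.val : f ⁻¹' {ξ} → X) y = (differential f (y : X)).ker.subtypeL := by
    intro y
    have hct := (c y).map_source (hxs y)
    have he : (fun k ↦ chart (y : X) ((c y).symm k)) =ᶠ[𝓝 (c y y)] ψ y := by
      filter_upwards [(c y).open_target.mem_nhds hct] with k hk
      rw [(hψ y k hk).1, (chart (y : X)).right_inv (hψ y k hk).2.1]
    refine ⟨⟨continuous_subtype_val.continuousAt, (hψ y _ hct).2.2.congr_of_eventuallyEq he⟩, ?_⟩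
    refine ContinuousLinearMap.ext fun k ↦ ?_
    exact (DFunLike.congr_fun he.fderiv_eq k).trans (hd y k)
  -- The formula for the chart at `y` makes sense on the ambient manifold near `y`; followed by the
  -- inverse chart it is the retraction.
  refine ⟨iN, ⟨fun y ↦ (hsm y).1, fun y ↦
    ⟨fun z ↦ (c y).symm (P y (chart (y : X) z - chart (y : X) y)), ?_, ?_⟩⟩, fun y ↦ ?_⟩
  · have h₁ : ContinuousAt (fun z ↦ P y (chart (y : X) z - chart (y : X) y)) (y : X) :=
      (P y).continuous.continuousAt.comp
        (((chart (y : X)).continuousAt (mem_chart_source _)).sub continuousAt_const)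
    have h₂ : ∀ᶠ z in 𝓝 (y : X), P y (chart (y : X) z - chart (y : X) y) ∈ (c y).target :=
      h₁.eventually ((c y).open_target.mem_nhds (by
        have h := (c y).map_source (hxs y)
        rwa [hc y] at h))
    filter_upwards [h₂, (chart (y : X)).open_source.mem_nhds (mem_chart_source _)] with z h₃ h₄
    have h₅ : SmoothAt (fun a ↦ P y (a - chart (y : X) y)) (chart (y : X) z) :=
      smoothAt_iff_contDiffAt.2 ((P y).contDiff.contDiffAt.comp _
        (contDiffAt_id.sub contDiffAt_const))
    exact (smoothAt_chart_symm (x := y) h₃).comp (h₅.comp (smoothAt_chart h₄) rfl) rfl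
  · filter_upwards [(c y).open_source.mem_nhds (hxs y)] with z hz
    rw [← hc y, (c y).left_inv hz]
  · rw [(hsm y).2]
    exact Submodule.range_subtype _

end LevelSet

end BanachManifold

namespace BanachManifold

/-! ### Slices and the manifold structure of the orbit space -/

section Slice

/-- A smooth action with quotient map `π`, locally uniformly free near the identity, whose orbits
are immersed with complements `H y` to their tangent spaces. -/
structure IsSplitAction (𝔤 : Type*) [NormedAddCommGroup 𝔤] [NormedSpace ℝ 𝔤]
    (G : Type*) [Group G] [TopologicalSpace G] [ChartedSpace 𝔤 G]
    {N : Type*} [TopologicalSpace N] [BanachManifold N] [MulAction G N]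
    {Q : Type*} [TopologicalSpace Q] (π : N → Q) (H : ∀ y : N, Submodule ℝ (Tangent y)) :
    Prop where
  smooth : SmoothAction 𝔤 G N
  quotient : IsQuotientMap π
  eq_iff : ∀ y z, π y = π z ↔ ∃ g : G, g • y = z
  proper : ∀ y : N, ∀ V ∈ 𝓝 (1 : G), ∃ W ∈ 𝓝 y, ∀ (g : G), ∀ z ∈ W, g • z ∈ W → g ∈ V
  injective : ∀ y : N, Function.Injective (infinitesimalAction 𝔤 G y)
  isCompl : ∀ y : N, IsCompl (orbitTangent 𝔤 G y) (H y)

variable {𝔤 : Type*} [NormedAddCommGroup 𝔤] [NormedSpace ℝ 𝔤] [CompleteSpace 𝔤]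
  {G : Type*} [Group G] [TopologicalSpace G] [ChartedSpace 𝔤 G]
  {N : Type*} [TopologicalSpace N] [BanachManifold N] [MulAction G N]
  {Q : Type*} [TopologicalSpace Q] {π : N → Q} {H : ∀ y : N, Submodule ℝ (Tangent y)}
  [∀ y, CompleteSpace (H y)]

/-- The local diffeomorphism `(s, h) ↦ exp s • σ h`, in charts, where `σ` is a slice. -/
theorem IsSplitAction.exists_local_diffeo (hG : IsSplitAction 𝔤 G π H) (y : N) :
    ∃ e : OpenPartialHomeomorph (𝔤 × H y) (Tangent y),
      (chartAt 𝔤 (1 : G) 1, (0 : H y)) ∈ e.source ∧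
      (∀ p ∈ e.source, p.1 ∈ (chartAt 𝔤 (1 : G)).target ∧
        chart y y + p.2 ∈ (chart y).target ∧
        (chartAt 𝔤 (1 : G)).symm p.1 • (chart y).symm (chart y y + p.2) ∈ (chart y).source ∧
        e p = chart y ((chartAt 𝔤 (1 : G)).symm p.1 • (chart y).symm (chart y y + p.2))) ∧
      ∀ b ∈ e.target, ContDiffAt ℝ ∞ e.symm b := by
  let S := {p : 𝔤 × Tangent y | p.1 ∈ (chartAt 𝔤 (1 : G)).target ∧ p.2 ∈ (chart y).target ∧
      (chartAt 𝔤 (1 : G)).symm p.1 • (chart y).symm p.2 ∈ (chart y).source}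
  have hS : IsOpen S := hG.smooth.isOpen_domain 1 y y
  let A : 𝔤 × H y → 𝔤 × Tangent y := fun p ↦ (p.1, chart y y + p.2)
  have hA : ContDiff ℝ ∞ A :=
    contDiff_fst.prodMk (contDiff_const.add ((H y).subtypeL.contDiff.comp contDiff_snd))
  let f : 𝔤 × H y → Tangent y := fun p ↦
    chart y ((chartAt 𝔤 (1 : G)).symm p.1 • (chart y).symm (chart y y + p.2))
  have hU : IsOpen (A ⁻¹' S) := hS.preimage hA.continuous
  have hf : ContDiffOn ℝ ∞ f (A ⁻¹' S) :=
    (hG.smooth.contDiffOn 1 y y).comp hA.contDiffOn fun p hp ↦ hp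
  have hl : (chart y).symm (chart y y) = y := (chart y).left_inv (mem_chart_source y)
  have h₀ : (chartAt 𝔤 (1 : G) 1, (0 : H y)) ∈ A ⁻¹' S := by
    refine ⟨chartAt_one_mem_target 𝔤 G, ?_, ?_⟩
    · simpa [A] using (chart y).map_source (mem_chart_source y)
    · simp only [A, chartAt_one_symm, one_smul, Submodule.coe_zero, add_zero, hl]
      exact mem_chart_source y
  have hd := ((hf.contDiffAt (hU.mem_nhds h₀)).differentiableAt (by simp)).hasFDerivAt
  have d₁ : ∀ a, fderiv ℝ f (chartAt 𝔤 (1 : G) 1, (0 : H y)) (a, 0) =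
      infinitesimalAction 𝔤 G y a := by
    intro a
    have h₁ := HasFDerivAt.comp (g := f) (f := fun s ↦ (s, (0 : H y))) (chartAt 𝔤 (1 : G) 1) hd
      (hasFDerivAt_prodMk_left (chartAt 𝔤 (1 : G) 1) (0 : H y))
    have h₂ : (f ∘ fun s ↦ (s, (0 : H y))) =
        fun s ↦ chart y ((chartAt 𝔤 (1 : G)).symm s • y) := by
      ext s
      simp only [f, Function.comp_apply, Submodule.coe_zero, add_zero, hl]
    rw [h₂] at h₁
    exact (DFunLike.congr_fun h₁.fderiv a).symm
  have d₂ : ∀ h : H y, fderiv ℝ f (chartAt 𝔤 (1 : G) 1, (0 : H y)) (0, h) = h := by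
    intro h
    have h₁ := HasFDerivAt.comp (g := f) (f := fun h ↦ (chartAt 𝔤 (1 : G) 1, h)) (0 : H y) hd
      (hasFDerivAt_prodMk_right (chartAt 𝔤 (1 : G) 1) (0 : H y))
    have h₂ : (fun h : H y ↦ chart y y + h) =ᶠ[𝓝 0]
        (f ∘ fun h ↦ (chartAt 𝔤 (1 : G) 1, h)) := by
      have : ContinuousAt (fun h : H y ↦ chart y y + (h : Tangent y)) 0 := by fun_prop
      have h₃ : chart y y + ((0 : H y) : Tangent y) ∈ (chart y).target := by
        simpa using (chart y).map_source (mem_chart_source y)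
      filter_upwards [this.eventually ((chart y).open_target.mem_nhds h₃)] with h hh
      simp only [f, Function.comp_apply, chartAt_one_symm, one_smul, (chart y).right_inv hh]
    have h₄ := h₁.congr_of_eventuallyEq h₂
    have h₅ : HasFDerivAt (fun h : H y ↦ chart y y + (h : Tangent y)) (H y).subtypeL 0 :=
      (H y).subtypeL.hasFDerivAt.const_add _
    exact DFunLike.congr_fun (h₄.unique h₅) h
  have d : ∀ p : 𝔤 × H y, fderiv ℝ f (chartAt 𝔤 (1 : G) 1, (0 : H y)) p =
      infinitesimalAction 𝔤 G y p.1 + p.2 := fun p ↦ by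
    rw [← d₁, ← d₂, ← map_add]
    simp
  -- The derivative is `(a, h) ↦ X^a + h`, bijective because the infinitesimal action is injective
  -- and `H y` complements its range.
  have hbij : Function.Bijective (fderiv ℝ f (chartAt 𝔤 (1 : G) 1, (0 : H y))) := by
    refine ⟨(injective_iff_map_eq_zero _).2 fun p hp ↦ ?_, fun v ↦ ?_⟩
    · rw [d] at hp
      have h₁ : infinitesimalAction 𝔤 G y p.1 ∈ orbitTangent 𝔤 G y := ⟨p.1, rfl⟩
      have h₂ : infinitesimalAction 𝔤 G y p.1 ∈ H y := by
        rw [eq_neg_of_add_eq_zero_left hp]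
        exact (H y).neg_mem p.2.2
      have h₃ := Submodule.disjoint_def.1 (hG.isCompl y).disjoint _ h₁ h₂
      rw [h₃, zero_add] at hp
      refine Prod.ext (hG.injective y ?_) (Subtype.ext hp)
      rw [h₃]
      simp
    · obtain ⟨v₁, ⟨a, rfl⟩, v₂, h₂, rfl⟩ := Submodule.mem_sup.1
        ((hG.isCompl y).sup_eq_top ▸ Submodule.mem_top : v ∈ orbitTangent 𝔤 G y ⊔ H y)
      exact ⟨(a, ⟨v₂, h₂⟩), d _⟩
  obtain ⟨e, h₁, h₂, h₃, h₄⟩ := exists_openPartialHomeomorph_of_contDiffOn hU hf h₀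
    (ContinuousLinearEquiv.ofBijective (fderiv ℝ f (chartAt 𝔤 (1 : G) 1, (0 : H y)))
      (LinearMap.ker_eq_bot.2 hbij.1) (LinearMap.range_eq_top.2 hbij.2)) hd
  exact ⟨e, h₁, fun p hp ↦ ⟨(h₂ hp).1, (h₂ hp).2.1, (h₂ hp).2.2, h₃ p⟩, h₄⟩

/-- Slice charts of the orbit space. -/
theorem IsSplitAction.exists_slice (hG : IsSplitAction 𝔤 G π H) (y : N) :
    ∃ (c : OpenPartialHomeomorph Q (H y)) (σ : H y → N),
      π y ∈ c.source ∧ c (π y) = 0 ∧ σ 0 = y ∧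
      (∀ h ∈ c.target, SmoothAt σ h ∧ π (σ h) = c.symm h) ∧
      (∀ z, π z ∈ c.source → SmoothAt (fun z ↦ c (π z)) z) ∧
      ∀ h : H y, tangentMapTo σ 0 y h = h := by
  obtain ⟨e, he₀, he, hes⟩ := hG.exists_local_diffeo y
  have hl : (chart y).symm (chart y y) = y := (chart y).left_inv (mem_chart_source y)
  have hπ : ∀ (g : G) z, π (g • z) = π z := fun g z ↦ ((hG.eq_iff _ _).2 ⟨g, rfl⟩).symm
  let σ : H y → N := fun h ↦ (chart y).symm (chart y y + h)
  have hσ₀ : σ 0 = y := by simp only [σ, Submodule.coe_zero, add_zero, hl]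
  obtain ⟨V, hV, S, hS, hVS⟩ := mem_nhds_prod_iff.1 (e.open_source.mem_nhds he₀)
  obtain ⟨V', hV', hV'o, h1V'⟩ := mem_nhds_iff.1 hV
  -- Properness is applied to a neighbourhood of `1` inside the group chart and inside the domain of
  -- the local diffeomorphism: only such group elements can identify two points of the slice.
  obtain ⟨W, hW, hWV⟩ := hG.proper y ((chartAt 𝔤 (1 : G)).source ∩ chartAt 𝔤 (1 : G) ⁻¹' V')
    (((chartAt 𝔤 (1 : G)).isOpen_inter_preimage hV'o).mem_nhds
      ⟨_root_.mem_chart_source 𝔤 _, h1V'⟩)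
  obtain ⟨W', hW'W, hW'o, hyW'⟩ := mem_nhds_iff.1 hW
  obtain ⟨S', hS'S, hS'o, h0S'⟩ := mem_nhds_iff.1 hS
  let T : Set (H y) := {h | h ∈ S' ∧ chart y y + h ∈ (chart y).target ∧ σ h ∈ W'}
  have hTo : IsOpen T := by
    have h₁ : IsOpen ((chart y).target ∩ (chart y).symm ⁻¹' W') :=
      (chart y).continuousOn_symm.isOpen_inter_preimage (chart y).open_target hW'o
    exact hS'o.inter (h₁.preimage (f := fun h : H y ↦ chart y y + (h : Tangent y)) (by fun_prop))
  have h0T : (0 : H y) ∈ T :=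
    ⟨h0S', by simpa using (chart y).map_source (mem_chart_source y), by rwa [hσ₀]⟩
  have hTe : ∀ h ∈ T, (chartAt 𝔤 (1 : G) 1, h) ∈ e.source ∧
      e (chartAt 𝔤 (1 : G) 1, h) = chart y (σ h) := fun h hh ↦ by
    have h₁ : (chartAt 𝔤 (1 : G) 1, h) ∈ e.source := hVS ⟨mem_of_mem_nhds hV, hS'S hh.1⟩
    refine ⟨h₁, ?_⟩
    rw [(he _ h₁).2.2.2, chartAt_one_symm, one_smul]
  have hσs : ∀ h ∈ T, σ h ∈ (chart y).source := fun h hh ↦ (chart y).map_target hh.2.1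
  -- If `g • σ h = σ h'`, then `(g, h)` and `(1, h')` have the same image under the local
  -- diffeomorphism, so `h = h'`.
  have hinj : InjOn (fun h ↦ π (σ h)) T := by
    intro h hh h' hh' hhh'
    obtain ⟨g, hg⟩ := (hG.eq_iff _ _).1 hhh'
    obtain ⟨hg₁, hg₂⟩ := hWV g (σ h) (hW'W hh.2.2) (by rw [hg]; exact hW'W hh'.2.2)
    have h₁ : (chartAt 𝔤 (1 : G) g, h) ∈ e.source := hVS ⟨hV' hg₂, hS'S hh.1⟩
    have h₂ : e (chartAt 𝔤 (1 : G) g, h) = e (chartAt 𝔤 (1 : G) 1, h') := by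
      rw [(he _ h₁).2.2.2, (hTe h' hh').2, ← hg, (chartAt 𝔤 (1 : G)).left_inv hg₁]
    exact congrArg Prod.snd (e.injOn h₁ (hTe h' hh').1 h₂)
  -- the slice coordinate, near a point of the orbit of `σ h`
  have hcoord : ∀ (g : G), ∀ h ∈ T, ∀ z, g • z = σ h →
      SmoothAt (fun z ↦ (e.symm (chart y (g • z))).2) z ∧
      (e.symm (chart y (g • z))).2 = h ∧
      ∀ᶠ z' in 𝓝 z, π (σ (e.symm (chart y (g • z'))).2) = π z' := by
    intro g h hh z hz
    have h₁ := hG.smooth.smoothAt_const_smul g z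
    have h₂ : chart y (g • z) ∈ e.target := by
      rw [hz, ← (hTe h hh).2]; exact e.map_source (hTe h hh).1
    have h₃ : SmoothAt (Y := Tangent y) (fun z ↦ chart y (g • z)) z :=
      (smoothAt_chart (by rw [hz]; exact hσs h hh)).comp h₁ rfl
    have h₄ : SmoothAt (fun b ↦ (e.symm b).2) (chart y (g • z)) :=
      smoothAt_iff_contDiffAt.2 (contDiffAt_snd.comp _ (hes _ h₂))
    refine ⟨h₄.comp h₃ rfl, ?_, ?_⟩
    · rw [hz, ← (hTe h hh).2, e.left_inv (hTe h hh).1]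
    · filter_upwards [h₃.1.eventually (e.open_target.mem_nhds h₂),
        h₁.1.eventually ((chart y).open_source.mem_nhds (hz ▸ hσs h hh : g • z ∈ _))]
        with z' h₅ h₆
      have h₇ := e.map_target h₅
      have h₈ := e.right_inv h₅
      rw [(he _ h₇).2.2.2] at h₈
      have h₉ := (chart y).injOn (he _ h₇).2.2.1 h₆ h₈
      rw [← hπ g z']
      conv_rhs => rw [← h₉, hπ]
  -- The saturation of a piece of the slice is open: a point moved onto the slice by `g` has a
  -- continuous slice coordinate nearby.
  have hopen : ∀ O ⊆ T, IsOpen O → IsOpen ((fun h ↦ π (σ h)) '' O) := by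
    intro O hOT hO
    rw [← hG.quotient.isOpen_preimage, isOpen_iff_mem_nhds]
    rintro z ⟨h, hh, hhz⟩
    obtain ⟨g, hg⟩ := (hG.eq_iff _ _).1 hhz.symm
    obtain ⟨h₁, h₂, h₃⟩ := hcoord g h (hOT hh) z hg
    filter_upwards [h₃, h₁.1.eventually (hO.mem_nhds (h₂.symm ▸ hh : (e.symm (chart y (g • z))).2 ∈ O))] with z' h₄ h₅
    exact ⟨_, h₅, h₄⟩
  have hσ : ∀ h ∈ T, SmoothAt σ h := fun h hh ↦
    (smoothAt_chart_symm hh.2.1).comp (smoothAt_iff_contDiffAt.2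
      ((contDiff_const.add (H y).subtypeL.contDiff).contDiffAt)) rfl
  let p : PartialEquiv (H y) Q := hinj.toPartialEquiv (fun h ↦ π (σ h)) T
  have hpt : ∀ O, IsOpen O → IsOpen (p.target ∩ p.symm ⁻¹' O) := fun O hO ↦ by
    rw [← p.image_source_inter_eq']
    exact hopen _ inter_subset_left (hTo.inter hO)
  have hpo : IsOpen p.target := by simpa using hpt univ isOpen_univ
  let c : OpenPartialHomeomorph Q (H y) :=
    { p.symm with
      open_source := hpo
      open_target := hTo
      continuousOn_toFun := (continuousOn_open_iff hpo).2 hpt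
      continuousOn_invFun := fun h hh ↦
        (hG.quotient.continuous.continuousAt.comp (hσ h hh).1).continuousWithinAt }
  have hc : ∀ h ∈ T, π (σ h) ∈ c.source ∧ c (π (σ h)) = h := fun h hh ↦
    ⟨p.map_source hh, p.left_inv hh⟩
  refine ⟨c, σ, by have h₁ := (hc 0 h0T).1; rwa [hσ₀] at h₁, ?_, hσ₀, fun h hh ↦ ⟨hσ h hh, rfl⟩, fun z hz ↦ ?_, fun v ↦ ?_⟩
  · have h₁ := (hc 0 h0T).2
    rwa [hσ₀] at h₁
  · obtain ⟨h, hh, hhz⟩ := hz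
    obtain ⟨g, hg⟩ := (hG.eq_iff _ _).1 hhz.symm
    obtain ⟨h₁, h₂, h₃⟩ := hcoord g h hh z hg
    refine h₁.congr ?_
    filter_upwards [h₃, h₁.1.eventually (hTo.mem_nhds (h₂.symm ▸ hh :
      (e.symm (chart y (g • z))).2 ∈ T))] with z' h₄ h₅
    rw [← h₄, (hc _ h₅).2]
  · have h₁ : HasFDerivAt (fun h : H y ↦ chart y y + (h : Tangent y)) (H y).subtypeL 0 :=
      (H y).subtypeL.hasFDerivAt.const_add _
    have h₂ : chart y y + ((0 : H y) : Tangent y) = chart y y := by simp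
    have h₃ := tangentMapTo_comp_apply (f := fun h : H y ↦ chart y y + (h : Tangent y)) (x := 0)
      (smoothAt_chart_symm ((chart y).map_source (mem_chart_source y)))
      (smoothAt_iff_contDiffAt.2 ((contDiff_const.add (H y).subtypeL.contDiff).contDiffAt)) h₂ hl v
    rw [tangentMapTo_chart_symm_self, tangentMapTo_eq_fderiv, h₁.fderiv] at h₃
    exact h₃

/-- The orbit space of a split action is a manifold, the projection is a submersion, and there are
local sections through every point which are tangent to the given complements. -/
theorem IsSplitAction.exists_quotient_manifold {N : Type u} [TopologicalSpace N]
    [BanachManifold.{u, w} N] [MulAction G N] {Q : Type v} [TopologicalSpace Q] {π : N → Q}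
    {H : ∀ y : N, Submodule ℝ (Tangent y)} [∀ y, CompleteSpace (H y)]
    (hG : IsSplitAction 𝔤 G π H) :
    ∃ _ : BanachManifold.{v, w} Q, (∀ y, SmoothAt π y) ∧
      (∀ y, (tangentMap π y).ker = orbitTangent 𝔤 G y) ∧
      ∀ (y : N) (q : Q), π y ∈ (chart q).source → ∃ σ : Tangent q → N,
        σ (chart q (π y)) = y ∧
        (∀ᶠ h in 𝓝 (chart q (π y)), SmoothAt σ h ∧ π (σ h) = (chart q).symm h) ∧
        ∀ v, tangentMapTo σ (chart q (π y)) y v ∈ H y := by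
  choose c σ hs hc₀ hσ₀ hσ hc hd using hG.exists_slice
  have hcont := hG.quotient.continuous
  have htrans : ∀ (x y : N) (h : H x), h ∈ (c x).target → (c x).symm h ∈ (c y).source →
      SmoothAt (fun h ↦ c y (π (σ x h))) h := fun x y h hh hhy ↦
    (hc y (σ x h) (by rwa [(hσ x h hh).2])).comp (hσ x h hh).1 rfl
  -- The chart at `q` is the slice through a chosen representative, so the model space at `q` is the
  -- complement `H` there.
  let rep := Function.surjInv hG.quotient.surjective
  have hrep : ∀ q, π (rep q) = q := Function.surjInv_eq hG.quotient.surjective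
  let iQ : BanachManifold.{v, w} Q :=
    { model q := H (rep q)
      chart q := c (rep q)
      mem_chart_source q := by
        have h := hs (rep q)
        rwa [hrep] at h
      contDiffOn_transition q q' h hh := by
        rw [OpenPartialHomeomorph.trans_source, OpenPartialHomeomorph.symm_source] at hh
        refine ContDiffAt.contDiffWithinAt (ContDiffAt.congr_of_eventuallyEq
          (smoothAt_iff_contDiffAt.1 (htrans (rep q) (rep q') h hh.1 hh.2)) ?_)
        filter_upwards [(c (rep q)).open_target.mem_nhds hh.1] with h' hh'
        simp only [OpenPartialHomeomorph.coe_trans, Function.comp_apply, (hσ _ _ hh').2] }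
  refine ⟨iQ, fun y ↦ ⟨hcont.continuousAt, (hc (rep (π y)) y (mem_chart_source (π y))).2⟩,
    fun y ↦ le_antisymm ?_ ?_, fun y q hy ↦ ?_⟩
  -- Modulo orbit directions a kernel vector is some `h ∈ H y`. In the slice chart through `y` its
  -- image is `h` itself, while the transition from the chart at `π y` sends the vanishing
  -- derivative to zero; hence `h = 0`.
  · set x := rep (π y) with hx
    have hyx : π y ∈ (c x).source := mem_chart_source (π y)
    have hrx := hc x y hyx
    have hry := hc y y (hs y)
    have h0t : (0 : H y) ∈ (c y).target := by
      rw [← hc₀ y]; exact (c y).map_source (hs y)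
    intro v hv
    have hv' : tangentMapTo (Y := H x) (fun z ↦ c x (π z)) y (c x (π y)) v = 0 := hv
    have horb : ∀ a, tangentMapTo (Y := H x) (fun z ↦ c x (π z)) y (c x (π y))
        (infinitesimalAction 𝔤 G y a) = 0 := fun a ↦ by
      have h₁ := tangentMapTo_comp_apply hrx (hG.smooth.smoothAt_orbit y)
        (by rw [chartAt_one_symm, one_smul]) rfl a
      rw [infinitesimalAction_eq, ← h₁]
      have h₂ : (fun s ↦ c x (π ((chartAt 𝔤 (1 : G)).symm s • y))) = fun _ ↦ c x (π y) := by
        funext s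
        rw [← (hG.eq_iff y _).2 ⟨(chartAt 𝔤 (1 : G)).symm s, rfl⟩]
      rw [h₂, tangentMapTo_const]
      rfl
    obtain ⟨v₁, ⟨a, rfl⟩, h, hh, rfl⟩ := Submodule.mem_sup.1
      ((hG.isCompl y).sup_eq_top ▸ Submodule.mem_top : v ∈ orbitTangent 𝔤 G y ⊔ H y)
    have h₁ : tangentMapTo (Y := H x) (fun z ↦ c x (π z)) y (c x (π y)) h = 0 := by
      rw [map_add] at hv'
      exact (congrArg (· + _) (horb a)).symm.trans hv' |> fun h ↦ by simpa using h
    have h₂ : tangentMapTo (Y := H y) (fun z ↦ c y (π z)) y 0 h = ⟨h, hh⟩ := by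
      have h₃ := tangentMapTo_comp_apply (Y := N) (Z := H y) (z := 0) hry (hσ y 0 h0t).1
        (hσ₀ y) (hc₀ y) ⟨h, hh⟩
      rw [hd y, tangentMapTo_congr (g := fun b ↦ b), tangentMapTo_id] at h₃
      · exact h₃.symm
      · filter_upwards [(c y).open_target.mem_nhds h0t] with b hb
        rw [(hσ y b hb).2, (c y).right_inv hb]
    have h₄ : c x (π y) ∈ (c x).target := (c x).map_source hyx
    have h₅ : tangentMapTo (Y := H y) (fun z ↦ c y (π z)) y 0 h = 0 := by
      have h₆ := htrans x y (c x (π y)) h₄ (by rw [(c x).left_inv hyx]; exact hs y)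
      have h₇ := tangentMapTo_comp_apply (Y := H x) (Z := H y) (z := 0) h₆ hrx rfl
        (by rw [(hσ x _ h₄).2, (c x).left_inv hyx, hc₀]) h
      rw [h₁, map_zero] at h₇
      refine Eq.trans ?_ h₇
      refine DFunLike.congr_fun (tangentMapTo_congr ?_ _) _
      filter_upwards [hcont.continuousAt.eventually ((c x).open_source.mem_nhds hyx)] with z hz
      rw [(hσ x _ ((c x).map_source hz)).2, (c x).left_inv hz]
    have h₈ : h = 0 := congrArg Subtype.val (h₂.symm.trans h₅)
    rw [h₈, add_zero]
    exact ⟨a, rfl⟩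
  · rintro _ ⟨a, rfl⟩
    have h₁ := tangentMapTo_comp_apply (g := fun z ↦ c (rep (π y)) (π z))
      (hc (rep (π y)) y (mem_chart_source (π y))) (hG.smooth.smoothAt_orbit y)
      (by rw [chartAt_one_symm, one_smul]) rfl a
    refine h₁.symm.trans ?_
    have h₂ : (fun s ↦ c (rep (π y)) (π ((chartAt 𝔤 (1 : G)).symm s • y))) =
        fun _ ↦ c (rep (π y)) (π y) := by
      funext s
      rw [← (hG.eq_iff y _).2 ⟨(chartAt 𝔤 (1 : G)).symm s, rfl⟩]
    rw [h₂, tangentMapTo_const]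
    rfl
  · set x := rep q with hx
    change π y ∈ (c x).source at hy
    have h₁ : c x (π y) ∈ (c x).target := (c x).map_source hy
    have h₂ : π (σ x (c x (π y))) = π y := by rw [(hσ x _ h₁).2, (c x).left_inv hy]
    have h0t : (0 : H y) ∈ (c y).target := by
      rw [← hc₀ y]; exact (c y).map_source (hs y)
    have h₃ : c y (π (σ x (c x (π y)))) = 0 := by rw [h₂, hc₀]
    -- The slice through `y` reparametrized by the chart at `q`. It is tangent to `H y` at `y`
    -- because `σ y` has the inclusion of `H y` as derivative at `0`.
    refine ⟨fun h ↦ σ y (c y (π (σ x h))), ?_, ?_, fun v ↦ ?_⟩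
    · change σ y (c y (π (σ x (c x (π y))))) = y
      rw [h₃, hσ₀]
    · have h₄ : ∀ᶠ h in 𝓝 (c x (π y)), (c x).symm h ∈ (c y).source :=
        ((c x).continuousAt_symm h₁).eventually ((c y).open_source.mem_nhds
          (by rw [(c x).left_inv hy]; exact hs y))
      have h₅ : ∀ᶠ h in 𝓝 (c x (π y)), h ∈ (c x).target := (c x).open_target.mem_nhds h₁
      change ∀ᶠ h in 𝓝 (c x (π y)), _
      filter_upwards [h₄, h₅] with h h₆ h₇
      have h₈ : c y (π (σ x h)) ∈ (c y).target := by
        rw [(hσ x h h₇).2]; exact (c y).map_source h₆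
      refine ⟨(hσ y _ h₈).1.comp (htrans x y h h₇ h₆) rfl, ?_⟩
      rw [(hσ y _ h₈).2, (hσ x h h₇).2, (c y).left_inv h₆]
      rfl
    · have h₉ := tangentMapTo_comp_apply (g := σ y) (f := fun h ↦ c y (π (σ x h)))
        (x := c x (π y)) (hσ y 0 h0t).1
        (htrans x y (c x (π y)) h₁ (by rw [(c x).left_inv hy]; exact hs y)) h₃ (hσ₀ y) v
      rw [hd y] at h₉
      exact (congrArg (· ∈ H y) h₉).mpr (Submodule.coe_mem _)

end Slice

end BanachManifold

namespace BanachManifold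

/-! ### Embedded submanifolds -/

section Embedded

variable {M : Type*} [TopologicalSpace M] [BanachManifold M] {N : Set M} [BanachManifold N]

/-- The tangent map of the inclusion of a submanifold. -/
noncomputable abbrev incl (y : N) : Tangent y →L[ℝ] Tangent (y : M) :=
  tangentMap (Subtype.val : N → M) y

/-- Such a `κ` is the derivative of a local smooth retraction. -/
theorem IsEmbedded.exists_leftInverse (h : IsEmbedded N) (y : N) :
    ∃ κ : Tangent (y : M) →L[ℝ] Tangent y, ∀ a, κ (incl y a) = a := by
  obtain ⟨r, hr, hry⟩ := h.exists_retraction y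
  refine ⟨tangentMapTo r y y, fun a ↦ ?_⟩
  have h₁ := tangentMapTo_comp_apply hr.self_of_nhds (h.smoothAt_val y) rfl hry.self_of_nhds a
  rw [tangentMapTo_congr hry, tangentMapTo_id] at h₁
  exact h₁.symm

theorem IsEmbedded.incl_injective (h : IsEmbedded N) (y : N) : Function.Injective (incl y) := by
  obtain ⟨κ, hκ⟩ := h.exists_leftInverse y
  exact Function.LeftInverse.injective hκ

/-- Maps into a submanifold are smooth if they are smooth as maps to the ambient manifold. -/
theorem IsEmbedded.smoothAt_of_val (h : IsEmbedded N) {X : Type*} [TopologicalSpace X]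
    [BanachManifold X] {φ : X → N} {x : X} (hφ : SmoothAt (fun a ↦ (φ a : M)) x) :
    SmoothAt φ x := by
  obtain ⟨r, hr, hry⟩ := h.exists_retraction (φ x)
  have hc : ContinuousAt φ x := Topology.IsInducing.subtypeVal.continuousAt_iff.2 hφ.1
  refine (hr.self_of_nhds.comp hφ rfl).congr ?_
  filter_upwards [hc.eventually hry] with a ha using ha.symm

end Embedded

section Equivariance

variable {G : Type*} [Group G] {M : Type*} [TopologicalSpace M] [BanachManifold M] [MulAction G M]

theorem Preserves.apply {b : BilinField M} (h : Preserves G b) (γ : G) {x z : M} (hz : γ • x = z)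
    (a c : Tangent x) :
    b z (tangentMapTo (fun y ↦ γ • y) x z a) (tangentMapTo (fun y ↦ γ • y) x z c) = b x a c := by
  subst hz
  exact h γ x a c

theorem IsEmbedded.incl_infinitesimalAction {𝔤 : Type*} [NormedAddCommGroup 𝔤] [NormedSpace ℝ 𝔤]
    [CompleteSpace 𝔤] {G : Type*} [Group G] [TopologicalSpace G] [ChartedSpace 𝔤 G]
    {M : Type*} [TopologicalSpace M] [BanachManifold M] [MulAction G M]
    {N : Set M} [BanachManifold N] [MulAction G N] (h : IsEmbedded N) (hN : SmoothAction 𝔤 G N)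
    (hc : ∀ (γ : G) (y : N), ((γ • y : N) : M) = γ • (y : M)) (y : N) (b : 𝔤) :
    incl y (infinitesimalAction 𝔤 G y b) = infinitesimalAction 𝔤 G (y : M) b := by
  have h₁ := tangentMapTo_comp_apply (h.smoothAt_val y) (hN.smoothAt_orbit y)
    (by rw [chartAt_one_symm, one_smul]) rfl b
  rw [infinitesimalAction_eq, infinitesimalAction_eq]
  refine h₁.symm.trans ?_
  simp only [hc]

end Equivariance

/-! ### Horizontal lifts and the fields induced on the quotient -/

/-- The setting of the reduction theorem: `N` is an embedded invariant submanifold of `M` with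
tangent spaces `ker d f`, and `π : N → Q` is a submersion whose fibres are the orbits, together with
an invariant metric for which there are horizontal local sections. -/
structure IsReduction (𝔤 : Type*) [NormedAddCommGroup 𝔤] [NormedSpace ℝ 𝔤]
    (G : Type*) [Group G] [TopologicalSpace G] [ChartedSpace 𝔤 G]
    {M : Type*} [TopologicalSpace M] [BanachManifold M] [MulAction G M]
    {N : Set M} [BanachManifold N] [MulAction G N]
    {Q : Type*} [TopologicalSpace Q] [BanachManifold Q] (π : N → Q)
    {F : Type*} [NormedAddCommGroup F] [NormedSpace ℝ F] (f : M → F) (g : BilinField M) :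
    Prop where
  smooth_action : SmoothAction 𝔤 G M
  smooth_action' : SmoothAction 𝔤 G N
  coe_smul : ∀ (γ : G) (y : N), ((γ • y : N) : M) = γ • (y : M)
  embedded : IsEmbedded N
  smooth_map : SmoothInto f
  range_incl : ∀ y : N, (incl y).range = (differential f (y : M)).ker
  surjective : Function.Surjective π
  eq_iff : ∀ y z, π y = π z ↔ ∃ γ : G, γ • y = z
  smoothAt_proj : ∀ y, SmoothAt π y
  ker_proj : ∀ y, (tangentMap π y).ker = orbitTangent 𝔤 G y
  exists_section : ∀ (y : N) (q : Q), π y ∈ (chart q).source → ∃ σ : Tangent q → N,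
    σ (chart q (π y)) = y ∧
    (∀ᶠ h in 𝓝 (chart q (π y)), SmoothAt σ h ∧ π (σ h) = (chart q).symm h) ∧
    ∀ v b, g y (infinitesimalAction 𝔤 G (y : M) b)
      (incl y (tangentMapTo σ (chart q (π y)) y v)) = 0
  riemannian : IsWeakRiemannian g
  preserves : Preserves G g
  bijective : ∀ y : N, Function.Bijective ((g y).bilinearComp
    (infinitesimalAction 𝔤 G (y : M)) (infinitesimalAction 𝔤 G (y : M)))

namespace IsReduction

variable {𝔤 : Type*} [NormedAddCommGroup 𝔤] [NormedSpace ℝ 𝔤] [CompleteSpace 𝔤]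
  {G : Type*} [Group G] [TopologicalSpace G] [ChartedSpace 𝔤 G]
  {M : Type*} [TopologicalSpace M] [BanachManifold M] [MulAction G M]
  {N : Set M} [BanachManifold N] [MulAction G N]
  {Q : Type*} [TopologicalSpace Q] [BanachManifold Q] {π : N → Q}
  {F : Type*} [NormedAddCommGroup F] [NormedSpace ℝ F] {f : M → F} {g : BilinField M}

theorem incl_infinitesimalAction (h : IsReduction 𝔤 G π f g) (y : N) (b : 𝔤) :
    incl y (infinitesimalAction 𝔤 G y b) = infinitesimalAction 𝔤 G (y : M) b :=
  h.embedded.incl_infinitesimalAction h.smooth_action' h.coe_smul y b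

omit [CompleteSpace 𝔤] in
theorem differential_incl (h : IsReduction 𝔤 G π f g) (y : N) (a : Tangent y) :
    differential f (y : M) (incl y a) = 0 :=
  (h.range_incl y ▸ ⟨a, rfl⟩ : incl y a ∈ (differential f (y : M)).ker)

omit [CompleteSpace 𝔤] in
theorem exists_incl_eq (h : IsReduction 𝔤 G π f g) (y : N) {z : Tangent (y : M)}
    (hz : differential f (y : M) z = 0) : ∃ a, incl y a = z :=
  (h.range_incl y ▸ hz : z ∈ (incl y).range)

omit [CompleteSpace 𝔤] in
theorem tangentMapTo_proj_eq_zero_iff (h : IsReduction 𝔤 G π f g) {y : N} {q : Q} (hq : π y = q)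
    (a : Tangent y) : tangentMapTo π y q a = 0 ↔ ∃ b, infinitesimalAction 𝔤 G y b = a := by
  subst hq
  exact Iff.of_eq (congrArg (a ∈ ·) (h.ker_proj y))

/-- Horizontal tangent vectors of `N`. -/
def IsHorizontal (𝔤 : Type*) [NormedAddCommGroup 𝔤] [NormedSpace ℝ 𝔤]
    (G : Type*) [Group G] [TopologicalSpace G] [ChartedSpace 𝔤 G] [MulAction G M]
    (g : BilinField M) (y : N) (a : Tangent y) : Prop :=
  ∀ b, g y (infinitesimalAction 𝔤 G (y : M) b) (incl y a) = 0

/-- The difference of the two vectors is both vertical and horizontal, hence orthogonal to itself.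
-/
theorem eq_of_horizontal (h : IsReduction 𝔤 G π f g) {y : N} {q : Q} (hq : π y = q)
    {a c : Tangent y} (ha : IsHorizontal 𝔤 G g y a) (hc : IsHorizontal 𝔤 G g y c)
    (hac : tangentMapTo π y q a = tangentMapTo π y q c) : a = c := by
  obtain ⟨b, hb⟩ := (h.tangentMapTo_proj_eq_zero_iff hq (a - c)).1 (by rw [map_sub, hac, sub_self])
  by_contra hne
  have h₁ : incl y (a - c) ≠ 0 := fun h₀ ↦
    hne (sub_eq_zero.1 (h.embedded.incl_injective y (h₀.trans (map_zero _).symm)))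
  have h₂ : incl y (a - c) = infinitesimalAction 𝔤 G (y : M) b := by
    rw [← hb, h.incl_infinitesimalAction]
  refine (h.riemannian.positive y _ h₁).ne' ?_
  rw [congrArg (fun z ↦ g y z (incl y (a - c))) h₂, map_sub, map_sub, ha, hc, sub_zero]

omit [CompleteSpace 𝔤] in
-- The lift is the derivative of a local section that is horizontal at `y`, so its linearity and
-- continuity need no argument.
theorem exists_lift (h : IsReduction 𝔤 G π f g) {y : N} {q : Q} (hq : π y = q) :
    ∃ l : Tangent q →L[ℝ] Tangent y,
      ∀ u, tangentMapTo π y q (l u) = u ∧ IsHorizontal 𝔤 G g y (l u) := by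
  subst hq
  obtain ⟨σ, h₁, h₂, h₃⟩ := h.exists_section y (π y) (mem_chart_source _)
  refine ⟨tangentMapTo σ (chart (π y) (π y)) y, fun u ↦ ⟨?_, fun b ↦ h₃ u b⟩⟩
  rw [← tangentMapTo_comp_apply (h.smoothAt_proj y) h₂.self_of_nhds.1 h₁ rfl,
    tangentMapTo_congr (h₂.mono fun _ h ↦ h.2), tangentMapTo_chart_symm_self]
  rfl

/-- Horizontal lifts. -/
noncomputable def lift (h : IsReduction 𝔤 G π f g) {y : N} {q : Q} (hq : π y = q) :
    Tangent q →L[ℝ] Tangent y := Classical.choose (h.exists_lift hq)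

omit [CompleteSpace 𝔤] in
theorem tangentMapTo_lift (h : IsReduction 𝔤 G π f g) {y : N} {q : Q} (hq : π y = q)
    (u : Tangent q) : tangentMapTo π y q (h.lift hq u) = u :=
  (Classical.choose_spec (h.exists_lift hq) u).1

omit [CompleteSpace 𝔤] in
theorem isHorizontal_lift (h : IsReduction 𝔤 G π f g) {y : N} {q : Q} (hq : π y = q)
    (u : Tangent q) : IsHorizontal 𝔤 G g y (h.lift hq u) :=
  (Classical.choose_spec (h.exists_lift hq) u).2

theorem lift_tangentMapTo (h : IsReduction 𝔤 G π f g) {y : N} {q : Q} (hq : π y = q)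
    {a : Tangent y} (ha : IsHorizontal 𝔤 G g y a) : h.lift hq (tangentMapTo π y q a) = a :=
  h.eq_of_horizontal hq (h.isHorizontal_lift hq _) ha (h.tangentMapTo_lift hq _)

/-- A tangent vector differs from the horizontal lift of its projection by a vertical one. -/
theorem exists_lift_add (h : IsReduction 𝔤 G π f g) {y : N} {q : Q} (hq : π y = q)
    (a : Tangent y) : ∃ b, incl y a =
      incl y (h.lift hq (tangentMapTo π y q a)) + infinitesimalAction 𝔤 G (y : M) b := by
  obtain ⟨b, hb⟩ := (h.tangentMapTo_proj_eq_zero_iff hq (a - h.lift hq (tangentMapTo π y q a))).1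
    (by rw [map_sub, h.tangentMapTo_lift, sub_self])
  refine ⟨b, ?_⟩
  rw [← h.incl_infinitesimalAction, hb, map_sub, add_sub_cancel]

omit [CompleteSpace 𝔤] in
theorem incl_lift_injective (h : IsReduction 𝔤 G π f g) {y : N} {q : Q} (hq : π y = q) :
    Function.Injective fun u ↦ incl y (h.lift hq u) := fun u v huv ↦ by
  have h₁ := h.embedded.incl_injective y huv
  rw [← h.tangentMapTo_lift hq u, h₁, h.tangentMapTo_lift]

theorem incl_tangentMapTo_smul (h : IsReduction 𝔤 G π f g) (γ : G) {y z : N} (hz : γ • y = z)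
    (a : Tangent y) : incl z (tangentMapTo (fun x ↦ γ • x) y z a) =
      tangentMapTo (fun x : M ↦ γ • x) (y : M) z (incl y a) := by
  have hz' : γ • (y : M) = z := by rw [← hz, h.coe_smul]
  have h₁ := tangentMapTo_comp_apply (h.embedded.smoothAt_val z)
    (h.smooth_action'.smoothAt_const_smul γ y) hz rfl a
  have h₂ := tangentMapTo_comp_apply (h.smooth_action.smoothAt_const_smul γ (y : M))
    (h.embedded.smoothAt_val y) rfl hz' a
  refine h₁.symm.trans (Eq.trans ?_ h₂)
  simp only [h.coe_smul]

theorem tangentMapTo_proj_smul (h : IsReduction 𝔤 G π f g) (γ : G) {y z : N} (hz : γ • y = z)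
    {q : Q} (hq : π y = q) (a : Tangent y) :
    tangentMapTo π z q (tangentMapTo (fun x ↦ γ • x) y z a) = tangentMapTo π y q a := by
  have hπ : ∀ x, π (γ • x) = π x := fun x ↦ ((h.eq_iff _ _).2 ⟨γ, rfl⟩).symm
  rw [← tangentMapTo_comp_apply (h.smoothAt_proj z) (h.smooth_action'.smoothAt_const_smul γ y) hz
    (by rw [← hz, hπ, hq])]
  simp only [hπ]

/-- Translations are isometries over the identity of the quotient. They preserve vertical vectors,
characterized as the kernel of the projection, so no formula with the adjoint action is needed;
hence they preserve horizontal ones. -/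
theorem lift_smul (h : IsReduction 𝔤 G π f g) (γ : G) {y z : N} (hz : γ • y = z)
    {q : Q} (hy : π y = q) (hq : π z = q) (u : Tangent q) :
    h.lift hq u = tangentMapTo (fun x ↦ γ • x) y z (h.lift hy u) := by
  refine h.eq_of_horizontal hq (h.isHorizontal_lift hq u) (fun b ↦ ?_) ?_
  · have hz' : γ⁻¹ • z = y := by rw [← hz, inv_smul_smul]
    obtain ⟨b', hb'⟩ := (h.tangentMapTo_proj_eq_zero_iff hy
      (tangentMapTo (fun x ↦ γ⁻¹ • x) z y (infinitesimalAction 𝔤 G z b))).1 (by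
        rw [h.tangentMapTo_proj_smul γ⁻¹ hz' hq]
        exact (h.tangentMapTo_proj_eq_zero_iff hq _).2 ⟨b, rfl⟩)
    have h₁ : infinitesimalAction 𝔤 G z b =
        tangentMapTo (fun x ↦ γ • x) y z (infinitesimalAction 𝔤 G y b') := by
      rw [hb', ← tangentMapTo_comp_apply (h.smooth_action'.smoothAt_const_smul γ y)
        (h.smooth_action'.smoothAt_const_smul γ⁻¹ z) hz' hz]
      simp only [smul_inv_smul, tangentMapTo_id]
      rfl
    rw [← h.incl_infinitesimalAction, h₁, h.incl_tangentMapTo_smul γ hz,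
      h.incl_tangentMapTo_smul γ hz, h.preserves.apply γ (by rw [← hz, h.coe_smul]),
      h.incl_infinitesimalAction]
    exact h.isHorizontal_lift hy u b'
  · rw [h.tangentMapTo_proj_smul γ hz hy, h.tangentMapTo_lift, h.tangentMapTo_lift]

/-- A point of `N` over a point of the quotient. -/
noncomputable def rep (h : IsReduction 𝔤 G π f g) (q : Q) : N := Function.surjInv h.surjective q

omit [CompleteSpace 𝔤] in
theorem proj_rep (h : IsReduction 𝔤 G π f g) (q : Q) : π (h.rep q) = q :=
  Function.surjInv_eq h.surjective q

/-- The field of bilinear forms on the quotient given by the values on horizontal lifts. -/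
noncomputable def bilin (h : IsReduction 𝔤 G π f g) (b : BilinField M) : BilinField Q := fun q ↦
  (b (h.rep q)).bilinearComp ((incl (h.rep q)).comp (h.lift (h.proj_rep q)))
    ((incl (h.rep q)).comp (h.lift (h.proj_rep q)))

/-- Independence of the representative: any two points over `q` differ by a translation, which
carries lifts to lifts and preserves `b`. -/
theorem bilin_apply (h : IsReduction 𝔤 G π f g) {b : BilinField M} (hb : Preserves G b) {y : N}
    {q : Q} (hq : π y = q) (u v : Tangent q) :
    h.bilin b q u v = b y (incl y (h.lift hq u)) (incl y (h.lift hq v)) := by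
  obtain ⟨γ, hγ⟩ := (h.eq_iff (h.rep q) y).1 ((h.proj_rep q).trans hq.symm)
  rw [h.lift_smul γ hγ (h.proj_rep q) hq, h.lift_smul γ hγ (h.proj_rep q) hq,
    h.incl_tangentMapTo_smul γ hγ, h.incl_tangentMapTo_smul γ hγ,
    hb.apply γ (by rw [← hγ, h.coe_smul])]
  rfl

/-- The field of endomorphisms on the quotient given by the values on horizontal lifts. -/
noncomputable def endo (h : IsReduction 𝔤 G π f g) (J : EndField M) : EndField Q := fun q ↦
  (tangentMapTo π (h.rep q) q).comp
    ((Classical.choose (h.embedded.exists_leftInverse (h.rep q))).comp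
      ((J (h.rep q)).comp ((incl (h.rep q)).comp (h.lift (h.proj_rep q)))))

/-- Invariant fields of endomorphisms which preserve the horizontal subspaces. -/
structure IsBasic (h : IsReduction 𝔤 G π f g) (J : EndField M) : Prop where
  equivariant : ∀ (γ : G) {x z : M}, γ • x = z → ∀ a, J z (tangentMapTo (fun y ↦ γ • y) x z a) =
    tangentMapTo (fun y ↦ γ • y) x z (J x a)
  exists_horizontal : ∀ (y : N) (a : Tangent y), IsHorizontal 𝔤 G g y a →
    ∃ c, IsHorizontal 𝔤 G g y c ∧ incl y c = J y (incl y a)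

/-- The arbitrary left inverse in `endo` is harmless, since `J` of a horizontal vector is again
tangent to `N`. This identity transfers algebraic relations of `J` to the quotient. -/
theorem incl_lift_endo (h : IsReduction 𝔤 G π f g) {J : EndField M} (hJ : h.IsBasic J) {y : N}
    {q : Q} (hq : π y = q) (u : Tangent q) :
    incl y (h.lift hq (h.endo J q u)) = J y (incl y (h.lift hq u)) := by
  obtain ⟨c, hc, hcJ⟩ := hJ.exists_horizontal (h.rep q) _ (h.isHorizontal_lift (h.proj_rep q) u)
  have h₁ : h.endo J q u = tangentMapTo π (h.rep q) q c := by
    have h₂ := Classical.choose_spec (h.embedded.exists_leftInverse (h.rep q)) c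
    rw [hcJ] at h₂
    exact congrArg (tangentMapTo π (h.rep q) q) h₂
  obtain ⟨γ, hγ⟩ := (h.eq_iff (h.rep q) y).1 ((h.proj_rep q).trans hq.symm)
  rw [h.lift_smul γ hγ (h.proj_rep q) hq, h.lift_smul γ hγ (h.proj_rep q) hq,
    h.incl_tangentMapTo_smul γ hγ, h.incl_tangentMapTo_smul γ hγ,
    hJ.equivariant γ (by rw [← hγ, h.coe_smul]), h₁, h.lift_tangentMapTo _ hc, hcJ]

end IsReduction

end BanachManifold

namespace BanachManifold

/-! ### Fields in charts and the smoothness of horizontal lifts -/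

section LocalFields

variable {X : Type*} [TopologicalSpace X] [BanachManifold X]

theorem localBilin_eq (b : BilinField X) {x₀ z : X} {a : Tangent x₀} (hz : (chart x₀).symm a = z)
    (u v : Tangent x₀) : localBilin b x₀ a u v = b z (tangentMapTo (chart x₀).symm a z u)
      (tangentMapTo (chart x₀).symm a z v) := by
  subst hz
  rfl

theorem localEnd_eq (J : EndField X) {x₀ z : X} {a : Tangent x₀} (hz : (chart x₀).symm a = z)
    (u : Tangent x₀) :
    localEnd J x₀ a u = chartDeriv x₀ z (J z (tangentMapTo (chart x₀).symm a z u)) := by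
  subst hz
  rfl

theorem tangentMapTo_chart_symm_chartDeriv {x₀ p : X} (hp : p ∈ (chart x₀).source)
    (v : Tangent p) : tangentMapTo (chart x₀).symm (chart x₀ p) p (chartDeriv x₀ p v) = v :=
  tangentMapTo_chart_symm_chart hp v

theorem chartDeriv_tangentMapTo_chart_symm {x₀ p : X} (hp : p ∈ (chart x₀).source)
    (v : Tangent x₀) : chartDeriv x₀ p (tangentMapTo (chart x₀).symm (chart x₀ p) p v) = v :=
  tangentMapTo_chart_chart_symm hp v

theorem chartDeriv_chartSymmDeriv {x₀ : X} {a : Tangent x₀} (ha : a ∈ (chart x₀).target)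
    (v : Tangent x₀) : chartDeriv x₀ ((chart x₀).symm a) (chartSymmDeriv x₀ a v) = v := by
  have h := chartDeriv_tangentMapTo_chart_symm ((chart x₀).map_target ha) v
  rwa [(chart x₀).right_inv ha] at h

theorem chartSymmDeriv_chartDeriv {x₀ : X} {a : Tangent x₀} (ha : a ∈ (chart x₀).target)
    (v : Tangent ((chart x₀).symm a)) :
    chartSymmDeriv x₀ a (chartDeriv x₀ ((chart x₀).symm a) v) = v := by
  have h := tangentMapTo_chart_symm_chartDeriv ((chart x₀).map_target ha) v
  rwa [(chart x₀).right_inv ha] at h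

theorem localBilin_chartDeriv (b : BilinField X) {x₀ p : X} (hp : p ∈ (chart x₀).source)
    (u v : Tangent p) :
    localBilin b x₀ (chart x₀ p) (chartDeriv x₀ p u) (chartDeriv x₀ p v) = b p u v := by
  rw [localBilin_eq b ((chart x₀).left_inv hp), tangentMapTo_chart_symm_chartDeriv hp,
    tangentMapTo_chart_symm_chartDeriv hp]

theorem localEnd_chartDeriv (J : EndField X) {x₀ p : X} (hp : p ∈ (chart x₀).source)
    (u : Tangent p) :
    localEnd J x₀ (chart x₀ p) (chartDeriv x₀ p u) = chartDeriv x₀ p (J p u) := by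
  rw [localEnd_eq J ((chart x₀).left_inv hp), tangentMapTo_chart_symm_chartDeriv hp]

theorem chart_mem_target (x : X) : chart x x ∈ (chart x).target :=
  (chart x).map_source (mem_chart_source x)

/-- The infinitesimal action is smooth in charts. -/
theorem SmoothAction.exists_local_infinitesimalAction
    {𝔤 : Type*} [NormedAddCommGroup 𝔤] [NormedSpace ℝ 𝔤] [CompleteSpace 𝔤]
    {G : Type*} [Group G] [TopologicalSpace G] [ChartedSpace 𝔤 G] [MulAction G X]
    (h : SmoothAction 𝔤 G X) (x₀ : X) :
    ∃ ρ : Tangent x₀ → 𝔤 →L[ℝ] Tangent x₀, ContDiffAt ℝ ∞ ρ (chart x₀ x₀) ∧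
      ∀ᶠ z in 𝓝 x₀, ∀ b, ρ (chart x₀ z) b = chartDeriv x₀ z (infinitesimalAction 𝔤 G z b) := by
  let A : 𝔤 × Tangent x₀ → Tangent x₀ := fun p ↦
    chart x₀ ((chartAt 𝔤 (1 : G)).symm p.1 • (chart x₀).symm p.2)
  let S := {p : 𝔤 × Tangent x₀ | p.1 ∈ (chartAt 𝔤 (1 : G)).target ∧ p.2 ∈ (chart x₀).target ∧
      (chartAt 𝔤 (1 : G)).symm p.1 • (chart x₀).symm p.2 ∈ (chart x₀).source}
  have hS : IsOpen S := h.isOpen_domain 1 x₀ x₀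
  have hA : ContDiffOn ℝ ∞ A S := h.contDiffOn 1 x₀ x₀
  have hmem : ∀ z ∈ (chart x₀).source, (chartAt 𝔤 (1 : G) 1, chart x₀ z) ∈ S := fun z hz ↦ by
    refine ⟨chartAt_one_mem_target 𝔤 G, (chart x₀).map_source hz, ?_⟩
    simpa only [chartAt_one_symm, one_smul, (chart x₀).left_inv hz]
  have hA' : ∀ z ∈ (chart x₀).source, ContDiffAt ℝ ∞ A (chartAt 𝔤 (1 : G) 1, chart x₀ z) :=
    fun z hz ↦ hA.contDiffAt (hS.mem_nhds (hmem z hz))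
  -- The partial derivative of the action map in the group variable at `1`.
  refine ⟨fun a ↦ (fderiv ℝ A (chartAt 𝔤 (1 : G) 1, a)).comp
    (ContinuousLinearMap.inl ℝ 𝔤 (Tangent x₀)), ?_, ?_⟩
  · have h₁ : ContDiffAt ℝ ∞ (fderiv ℝ A) (chartAt 𝔤 (1 : G) 1, chart x₀ x₀) :=
      (hA' x₀ (mem_chart_source x₀)).fderiv_right (by simp)
    exact (h₁.comp (chart x₀ x₀) (contDiffAt_const.prodMk contDiffAt_id)).clm_comp contDiffAt_const
  · filter_upwards [(chart x₀).open_source.mem_nhds (mem_chart_source x₀)] with z hz b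
    rw [chartDeriv_eq, infinitesimalAction_eq, ← tangentMapTo_comp_apply (smoothAt_chart hz)
      (h.smoothAt_orbit z) (by rw [chartAt_one_symm, one_smul]) rfl, tangentMapTo_eq_fderiv]
    have h₂ := HasFDerivAt.comp (g := A) (f := fun s : 𝔤 ↦ (s, chart x₀ z)) (chartAt 𝔤 (1 : G) 1)
      ((hA' z hz).differentiableAt (by simp)).hasFDerivAt
      (hasFDerivAt_prodMk_left (chartAt 𝔤 (1 : G) 1) (chart x₀ z))
    have h₃ : (A ∘ fun s ↦ (s, chart x₀ z)) =
        fun s ↦ chart x₀ ((chartAt 𝔤 (1 : G)).symm s • z) := by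
      funext s
      simp only [A, Function.comp_apply, (chart x₀).left_inv hz]
    rw [h₃] at h₂
    exact (DFunLike.congr_fun h₂.fderiv b).symm

end LocalFields

namespace IsReduction

variable {𝔤 : Type*} [NormedAddCommGroup 𝔤] [NormedSpace ℝ 𝔤] [CompleteSpace 𝔤]
  {G : Type*} [Group G] [TopologicalSpace G] [ChartedSpace 𝔤 G]
  {M : Type*} [TopologicalSpace M] [BanachManifold M] [MulAction G M]
  {N : Set M} [BanachManifold N] [MulAction G N]
  {Q : Type*} [TopologicalSpace Q] [BanachManifold Q] {π : N → Q}
  {F : Type*} [NormedAddCommGroup F] [NormedSpace ℝ F] {f : M → F} {g : BilinField M}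

/-- In charts, a local section `σ` of the projection, a map `r` extending the projection, and the
horizontal lifts `L` along the section. All of them are smooth, and the section may be taken to be
horizontal at a given point. -/
theorem exists_local_model (H : IsReduction 𝔤 G π f g) (y₀ : N) (q₀ : Q)
    (hq₀ : π y₀ ∈ (chart q₀).source) :
    ∃ (σ : Tangent q₀ → N) (r : Tangent (y₀ : M) → Tangent q₀)
      (L : Tangent q₀ → Tangent q₀ →L[ℝ] Tangent (y₀ : M)),
      σ (chart q₀ (π y₀)) = y₀ ∧
      ContDiffAt ℝ ∞ (fun h ↦ chart (y₀ : M) (σ h)) (chart q₀ (π y₀)) ∧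
      ContDiffAt ℝ ∞ r (chart (y₀ : M) y₀) ∧
      ContDiffAt ℝ ∞ L (chart q₀ (π y₀)) ∧
      HasFDerivAt (fun h ↦ chart (y₀ : M) (σ h)) (L (chart q₀ (π y₀))) (chart q₀ (π y₀)) ∧
      ∀ᶠ h in 𝓝 (chart q₀ (π y₀)), h ∈ (chart q₀).target ∧ (σ h : M) ∈ (chart (y₀ : M)).source ∧
        ∃ hq : π (σ h) = (chart q₀).symm h, r (chart (y₀ : M) (σ h)) = h ∧
          (∀ u, L h u = chartDeriv (y₀ : M) (σ h)
            (incl (σ h) (H.lift hq (chartSymmDeriv q₀ h u)))) ∧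
          (∀ u, ∃ b, fderiv ℝ (fun h ↦ chart (y₀ : M) (σ h)) h u =
            L h u + chartDeriv (y₀ : M) (σ h) (infinitesimalAction 𝔤 G (σ h : M) b)) ∧
          ∀ a, fderiv ℝ r (chart (y₀ : M) (σ h)) (chartDeriv (y₀ : M) (σ h) (incl (σ h) a)) =
            chartDeriv q₀ ((chart q₀).symm h)
              (tangentMapTo π (σ h) ((chart q₀).symm h) a) := by
  set h₀ := chart q₀ (π y₀) with hh₀
  obtain ⟨σ, hσ₀, hσ, hσh⟩ := H.exists_section y₀ q₀ hq₀
  obtain ⟨ret, hret, hret'⟩ := H.embedded.exists_retraction y₀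
  obtain ⟨ρ, hρ, hρ'⟩ := H.smooth_action.exists_local_infinitesimalAction (y₀ : M)
  have hh₀t : h₀ ∈ (chart q₀).target := (chart q₀).map_source hq₀
  let s : Tangent q₀ → Tangent (y₀ : M) := fun h ↦ chart (y₀ : M) (σ h)
  have hσM : ∀ {h}, SmoothAt σ h → SmoothAt (fun h ↦ (σ h : M)) h := fun hh ↦
    (H.embedded.smoothAt_val _).comp hh rfl
  have hs₀ : s h₀ = chart (y₀ : M) y₀ := by simp only [s, h₀, hσ₀]
  have hs : ContDiffAt ℝ ∞ s h₀ := smoothAt_iff_contDiffAt.1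
    ((smoothAt_chart (mem_chart_source (y₀ : M))).comp (hσM hσ.self_of_nhds.1)
      (congrArg Subtype.val hσ₀))
  have hgl : ContDiffAt ℝ ∞ (localBilin g (y₀ : M)) (s h₀) := by
    rw [hs₀]
    exact (H.riemannian.smooth (y₀ : M)).contDiffAt
      ((chart (y₀ : M)).open_target.mem_nhds (chart_mem_target _))
  have hρs : ContDiffAt ℝ ∞ (fun h ↦ ρ (s h)) h₀ := ContDiffAt.comp h₀ (by rwa [hs₀]) hs
  have hgs : ContDiffAt ℝ ∞ (fun h ↦ localBilin g (y₀ : M) (s h)) h₀ := hgl.comp h₀ hs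
  have hds : ContDiffAt ℝ ∞ (fderiv ℝ s) h₀ := hs.fderiv_right (by simp)
  -- `B` is the Gram form of the orbit directions along the section and `C` pairs the derivative of
  -- the section with them. Solving `B b = C u` gives the vertical part of `ds u`; subtracting it
  -- yields the horizontal lift `L`.
  let B : Tangent q₀ → 𝔤 →L[ℝ] 𝔤 →L[ℝ] ℝ := fun h ↦
    (localBilin g (y₀ : M) (s h)).bilinearComp (ρ (s h)) (ρ (s h))
  let C : Tangent q₀ → Tangent q₀ →L[ℝ] 𝔤 →L[ℝ] ℝ := fun h ↦
    (localBilin g (y₀ : M) (s h)).bilinearComp (fderiv ℝ s h) (ρ (s h))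
  let L : Tangent q₀ → Tangent q₀ →L[ℝ] Tangent (y₀ : M) := fun h ↦
    fderiv ℝ s h - (ρ (s h)).comp ((B h).inverse.comp (C h))
  let r : Tangent (y₀ : M) → Tangent q₀ := fun a ↦ chart q₀ (π (ret ((chart (y₀ : M)).symm a)))
  -- everything that holds near `h₀`
  have hv₀ : (σ h₀ : M) = y₀ := congrArg Subtype.val hσ₀
  have hcont : Filter.Tendsto (fun h ↦ (σ h : M)) (𝓝 h₀) (𝓝 (y₀ : M)) := by
    rw [← hv₀]
    exact (hσM hσ.self_of_nhds.1).1
  have hcont' : Filter.Tendsto σ (𝓝 h₀) (𝓝 y₀) := by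
    have h := hσ.self_of_nhds.1.1
    rwa [ContinuousAt, hσ₀] at h
  have e₁ : ∀ᶠ h in 𝓝 h₀, h ∈ (chart q₀).target := (chart q₀).open_target.mem_nhds hh₀t
  have e₂ : ∀ᶠ h in 𝓝 h₀, (σ h : M) ∈ (chart (y₀ : M)).source :=
    hcont.eventually ((chart (y₀ : M)).open_source.mem_nhds (mem_chart_source _))
  have e₃ : ∀ᶠ h in 𝓝 h₀, ∀ᶠ z : N in 𝓝 (σ h), ret (z : M) = z :=
    hcont'.eventually hret'.eventually_nhds
  have e₄ : ∀ᶠ h in 𝓝 h₀, SmoothAt ret (σ h : M) := hcont.eventually hret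
  have e₅ : ∀ᶠ h in 𝓝 h₀, ∀ b, ρ (chart (y₀ : M) (σ h)) b =
      chartDeriv (y₀ : M) (σ h) (infinitesimalAction 𝔤 G (σ h : M) b) :=
    hcont.eventually hρ'
  have hfs : ∀ {h}, SmoothAt σ h → (σ h : M) ∈ (chart (y₀ : M)).source → ∀ u, fderiv ℝ s h u =
      chartDeriv (y₀ : M) (σ h) (incl (σ h) (tangentMapTo σ h (σ h) u)) := fun {h} h₁ h₂ u ↦ by
    have h₃ := tangentMapTo_comp_apply (smoothAt_chart h₂) (hσM h₁) rfl rfl u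
    have h₄ := tangentMapTo_comp_apply (H.embedded.smoothAt_val (σ h)) h₁ rfl rfl u
    rw [h₄] at h₃
    exact h₃
  have hDτ : ∀ᶠ h in 𝓝 h₀, ∀ u, tangentMapTo π (σ h) ((chart q₀).symm h)
      (tangentMapTo σ h (σ h) u) = chartSymmDeriv q₀ h u := by
    filter_upwards [hσ.eventually_nhds] with h h₁ u
    rw [← tangentMapTo_comp_apply (H.smoothAt_proj _) h₁.self_of_nhds.1 rfl h₁.self_of_nhds.2,
      tangentMapTo_congr (h₁.mono fun _ h ↦ h.2), chartSymmDeriv_eq]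
  have hBinv : ∀ᶠ h in 𝓝 h₀, ∃ e : 𝔤 ≃L[ℝ] (𝔤 →L[ℝ] ℝ), (e : 𝔤 →L[ℝ] 𝔤 →L[ℝ] ℝ) = B h ∧
      ∀ a c, B h a c = g (σ h : M) (infinitesimalAction 𝔤 G (σ h : M) a)
        (infinitesimalAction 𝔤 G (σ h : M) c) := by
    filter_upwards [e₂, e₅] with h h₁ h₂
    have h₃ : ∀ a c, B h a c = g (σ h : M) (infinitesimalAction 𝔤 G (σ h : M) a)
        (infinitesimalAction 𝔤 G (σ h : M) c) := fun a c ↦ by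
      simp only [B, s, ContinuousLinearMap.bilinearComp_apply]
      rw [h₂, h₂, localBilin_chartDeriv g h₁]
    have h₄ : Function.Bijective (B h) := by
      convert H.bijective (σ h) using 1
      ext a c
      exact h₃ a c
    exact ⟨ContinuousLinearEquiv.ofBijective (B h) (LinearMap.ker_eq_bot.2 h₄.1)
      (LinearMap.range_eq_top.2 h₄.2), ContinuousLinearEquiv.coe_ofBijective _ _ _, h₃⟩
  have hLlift : ∀ᶠ h in 𝓝 h₀, ∃ hq : π (σ h) = (chart q₀).symm h,
      (∀ u, L h u = chartDeriv (y₀ : M) (σ h)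
        (incl (σ h) (H.lift hq (chartSymmDeriv q₀ h u)))) ∧
      ∀ u, ∃ b, fderiv ℝ s h u =
        L h u + chartDeriv (y₀ : M) (σ h) (infinitesimalAction 𝔤 G (σ h : M) b) := by
    filter_upwards [hσ, e₂, e₅, hDτ, hBinv] with h h₁ h₂ h₃ h₄ h₅
    obtain ⟨e, he, hB⟩ := h₅
    have hq := h₁.2
    -- Split `ds u` into its lift and a vertical part given by `b`. Pairing with orbit directions
    -- kills the lift and leaves `C u = B b`.
    have key : ∀ u, ∃ b, fderiv ℝ s h u = chartDeriv (y₀ : M) (σ h)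
        (incl (σ h) (H.lift hq (chartSymmDeriv q₀ h u))) + ρ (s h) b ∧ (B h).inverse (C h u) = b := by
      intro u
      obtain ⟨b, hb⟩ := H.exists_lift_add hq (tangentMapTo σ h (σ h) u)
      rw [h₄] at hb
      have h₆ : fderiv ℝ s h u = chartDeriv (y₀ : M) (σ h)
          (incl (σ h) (H.lift hq (chartSymmDeriv q₀ h u))) + ρ (s h) b := by
        rw [hfs h₁.1 h₂, hb, map_add, h₃]
      refine ⟨b, h₆, ?_⟩
      have h₇ : C h u = B h b := by
        ext c
        rw [hB]
        simp only [C, s, ContinuousLinearMap.bilinearComp_apply]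
        rw [h₃, hfs h₁.1 h₂, localBilin_chartDeriv g h₂, hb, map_add, add_apply,
          H.riemannian.symmetric, H.isHorizontal_lift hq, zero_add]
      rw [h₇, ← he, ContinuousLinearMap.inverse_equiv]
      exact e.symm_apply_apply b
    have hL : ∀ u, L h u = chartDeriv (y₀ : M) (σ h)
        (incl (σ h) (H.lift hq (chartSymmDeriv q₀ h u))) := fun u ↦ by
      obtain ⟨b, h₈, h₉⟩ := key u
      simp only [L, sub_apply, ContinuousLinearMap.comp_apply, h₉]
      rw [h₈, add_sub_cancel_right]
    refine ⟨hq, hL, fun u ↦ ?_⟩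
    obtain ⟨b, h₈, -⟩ := key u
    exact ⟨b, by rw [hL, h₈, ← h₃]⟩
  have hr : ∀ᶠ h in 𝓝 h₀, SmoothAt (Y := Tangent q₀) (fun z : M ↦ chart q₀ (π (ret z))) (σ h) ∧
      SmoothAt r (s h) := by
    filter_upwards [e₁, e₂, e₃, e₄, hσ] with h h₁ h₂ h₃ h₄ h₅
    have h₆ : ret (σ h : M) = σ h := h₃.self_of_nhds
    have h₇ : SmoothAt (Y := Tangent q₀) (fun z : M ↦ chart q₀ (π (ret z))) (σ h) :=
      (smoothAt_chart (x := q₀) (p := π (σ h))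
        (by rw [h₅.2]; exact (chart q₀).map_target h₁)).comp
        ((H.smoothAt_proj (σ h)).comp h₄ h₆) (by rw [h₆])
    exact ⟨h₇, h₇.comp (smoothAt_chart_symm ((chart (y₀ : M)).map_source h₂))
      ((chart (y₀ : M)).left_inv h₂)⟩
  refine ⟨σ, r, L, hσ₀, hs, ?_, ?_, ?_, ?_⟩
  · rw [← hs₀]
    exact smoothAt_iff_contDiffAt.1 hr.self_of_nhds.2
  · obtain ⟨e, he, -⟩ := hBinv.self_of_nhds
    have h₁ : ContDiffAt ℝ ∞ B h₀ := contDiffAt_bilinearComp hgs hρs hρs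
    have h₂ : ContDiffAt ℝ ∞ C h₀ := contDiffAt_bilinearComp hgs hds hρs
    -- Inversion is smooth near the isomorphism `B h₀`; the default value of `inverse` at
    -- non-invertible operators plays no role there.
    have h₃ : ContDiffAt ℝ ∞ (fun h ↦ (B h).inverse) h₀ :=
      ContDiffAt.comp (g := fun T : 𝔤 →L[ℝ] 𝔤 →L[ℝ] ℝ ↦ T.inverse) h₀ (by rw [← he]; exact contDiffAt_map_inverse e) h₁
    exact hds.sub (hρs.clm_comp (h₃.clm_comp h₂))
  · have h₁ := (hs.differentiableAt (by simp)).hasFDerivAt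
    obtain ⟨hq, hL, -⟩ := hLlift.self_of_nhds
    convert h₁ using 1
    ext u
    rw [hL, hfs hσ.self_of_nhds.1 e₂.self_of_nhds]
    congr 2
    rw [← hDτ.self_of_nhds]
    refine H.lift_tangentMapTo hq fun b ↦ ?_
    -- The equality `σ h₀ = y₀` is not definitional, so horizontality of the section is moved to `σ
    -- h₀` through a variable point.
    have h₂ : ∀ z : N, z = y₀ → g z (infinitesimalAction 𝔤 G (z : M) b)
        (incl z (tangentMapTo σ h₀ z u)) = 0 := fun z hz ↦ by
      rw [hz]
      exact hσh u b
    exact h₂ _ hσ₀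
  · filter_upwards [e₁, e₂, e₃, hr, hLlift, hσ] with h h₁ h₂ h₃ h₄ ⟨hq, h₅, h₆⟩ h₇
    have h₈ : ret (σ h : M) = σ h := h₃.self_of_nhds
    refine ⟨h₁, h₂, hq, ?_, h₅, h₆, fun a ↦ ?_⟩
    · change chart q₀ (π (ret ((chart (y₀ : M)).symm (chart (y₀ : M) (σ h))))) = h
      rw [(chart (y₀ : M)).left_inv h₂, h₈, hq, (chart q₀).right_inv h₁]
    · have h₉ := tangentMapTo_comp_apply h₄.1
        (smoothAt_chart_symm ((chart (y₀ : M)).map_source h₂)) ((chart (y₀ : M)).left_inv h₂)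
        (z := h) (by rw [h₈, hq, (chart q₀).right_inv h₁])
        (chartDeriv (y₀ : M) (σ h) (incl (σ h) a))
      rw [tangentMapTo_chart_symm_chartDeriv h₂] at h₉
      refine h₉.trans ?_
      have h₁₀ : SmoothAt (fun z ↦ chart q₀ (π z)) (σ h) :=
        (smoothAt_chart (x := q₀) (p := (chart q₀).symm h) ((chart q₀).map_target h₁)).comp
          (H.smoothAt_proj (σ h)) hq
      have h₁₁ := tangentMapTo_comp_apply h₄.1 (H.embedded.smoothAt_val (σ h)) rfl
        (z := h) (by rw [h₈, hq, (chart q₀).right_inv h₁]) a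
      have h₁₂ := tangentMapTo_comp_apply (smoothAt_chart (x := q₀) ((chart q₀).map_target h₁))
        (H.smoothAt_proj (σ h)) hq (z := h) ((chart q₀).right_inv h₁) a
      refine h₁₁.symm.trans (Eq.trans ?_ h₁₂)
      refine DFunLike.congr_fun (tangentMapTo_congr ?_ _) a
      filter_upwards [h₃] with z hz using by rw [hz]

end IsReduction

end BanachManifold

namespace BanachManifold

/-! ### The reduced Kähler structure -/

namespace IsReduction

variable {𝔤 : Type*} [NormedAddCommGroup 𝔤] [NormedSpace ℝ 𝔤] [CompleteSpace 𝔤]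
  {G : Type*} [Group G] [TopologicalSpace G] [ChartedSpace 𝔤 G]
  {M : Type*} [TopologicalSpace M] [BanachManifold M] [MulAction G M]
  {N : Set M} [BanachManifold N] [MulAction G N]
  {Q : Type*} [TopologicalSpace Q] [BanachManifold Q] {π : N → Q}
  {F : Type*} [NormedAddCommGroup F] [NormedSpace ℝ F] {f : M → F} {g : BilinField M}

omit [CompleteSpace 𝔤] in
theorem exists_chart_proj_eq (H : IsReduction 𝔤 G π f g) {q₀ : Q} {a : Tangent q₀}
    (ha : a ∈ (chart q₀).target) :
    ∃ y : N, π y ∈ (chart q₀).source ∧ chart q₀ (π y) = a := by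
  obtain ⟨y, hy⟩ := H.surjective ((chart q₀).symm a)
  exact ⟨y, hy ▸ (chart q₀).map_target ha, hy ▸ (chart q₀).right_inv ha⟩

/-- In charts the reduced field is the local expression of `b` along a section, evaluated on the
smooth lifts `L`. -/
theorem smoothBilin_bilin (H : IsReduction 𝔤 G π f g) {b : BilinField M} (hb : SmoothBilin b)
    (hG : Preserves G b) : SmoothBilin (H.bilin b) := by
  intro q₀ a ha
  obtain ⟨y₀, hy₀, rfl⟩ := H.exists_chart_proj_eq ha
  obtain ⟨σ, r, L, hσ₀, hs, -, hL, -, hloc⟩ := H.exists_local_model y₀ q₀ hy₀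
  refine ContDiffAt.contDiffWithinAt ?_
  have h₁ : ContDiffAt ℝ ∞ (localBilin b (y₀ : M)) (chart (y₀ : M) (σ (chart q₀ (π y₀)))) := by
    rw [hσ₀]
    exact (hb (y₀ : M)).contDiffAt ((chart (y₀ : M)).open_target.mem_nhds (chart_mem_target _))
  have h₂ : ContDiffAt ℝ ∞ (fun h ↦ localBilin b (y₀ : M) (chart (y₀ : M) (σ h)))
      (chart q₀ (π y₀)) := h₁.comp (f := fun h ↦ chart (y₀ : M) (σ h)) (chart q₀ (π y₀)) hs
  refine (contDiffAt_bilinearComp h₂ hL hL).congr_of_eventuallyEq ?_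
  filter_upwards [hloc] with h ⟨h₁, h₂, hq, _, h₃, _, _⟩
  ext u v
  rw [ContinuousLinearMap.bilinearComp_apply, h₃, h₃,
    localBilin_chartDeriv b h₂, ← H.bilin_apply hG hq]
  rfl

theorem isWeakRiemannian_bilin (H : IsReduction 𝔤 G π f g) : IsWeakRiemannian (H.bilin g) where
  smooth := H.smoothBilin_bilin H.riemannian.smooth H.preserves
  symmetric _ _ _ := H.riemannian.symmetric _ _ _
  positive q u hu := H.riemannian.positive _ _ fun h ↦
    hu (H.incl_lift_injective (H.proj_rep q) (by simpa using h))

/-- The derivative of a section differs from the lift by vertical vectors, which `Ω` annihilates on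
the level set. So in charts the reduced form is an honest pullback of `Ω` along the section, and
`closed_pullback` applies. -/
theorem isClosedForm_bilin (H : IsReduction 𝔤 G π f g) {Ω : BilinField M}
    (hΩ : IsWeakSymplectic Ω) (hG : Preserves G Ω)
    (hv : ∀ (y : N) (b : 𝔤) (a : Tangent y),
      Ω y (infinitesimalAction 𝔤 G (y : M) b) (incl y a) = 0) : IsClosedForm (H.bilin Ω) := by
  intro q₀ a ha
  obtain ⟨y₀, hy₀, rfl⟩ := H.exists_chart_proj_eq ha
  obtain ⟨σ, r, L, hσ₀, hs, -, -, -, hloc⟩ := H.exists_local_model y₀ q₀ hy₀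
  have hanti : ∀ (x : M) (a b : Tangent x), Ω x a b = -Ω x b a := fun x a b ↦ by
    have h := hΩ.alternating x (a + b)
    simp only [map_add, add_apply, hΩ.alternating, zero_add, add_zero] at h
    linarith
  have he : localBilin (H.bilin Ω) q₀ =ᶠ[𝓝 (chart q₀ (π y₀))] fun h ↦
      (localBilin Ω (y₀ : M) (chart (y₀ : M) (σ h))).bilinearComp
        (fderiv ℝ (fun h ↦ chart (y₀ : M) (σ h)) h)
        (fderiv ℝ (fun h ↦ chart (y₀ : M) (σ h)) h) := by
    filter_upwards [hloc] with h ⟨h₁, h₂, hq, _, h₃, h₄, _⟩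
    ext u v
    obtain ⟨b, hb⟩ := h₄ u
    obtain ⟨c, hc⟩ := h₄ v
    have hv' : ∀ a c, Ω (σ h) (incl (σ h) a) (infinitesimalAction 𝔤 G (σ h : M) c) = 0 :=
      fun a c ↦ by rw [hanti, hv, neg_zero]
    have hvv : Ω (σ h) (infinitesimalAction 𝔤 G (σ h : M) b)
        (infinitesimalAction 𝔤 G (σ h : M) c) = 0 := by
      rw [← H.incl_infinitesimalAction (σ h) c, hv]
    rw [ContinuousLinearMap.bilinearComp_apply, hb, hc, h₃, h₃, ← map_add, ← map_add,
      localBilin_chartDeriv Ω h₂]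
    simp only [map_add, add_apply, hv, hv', hvv, add_zero]
    rw [← H.bilin_apply hG hq]
    rfl
  have hσt : chart (y₀ : M) (σ (chart q₀ (π y₀))) ∈ (chart (y₀ : M)).target := by
    rw [hσ₀]; exact chart_mem_target _
  intro u v w
  rw [he.fderiv_eq]
  refine closed_pullback hs ((hΩ.smooth (y₀ : M)).contDiffAt
    ((chart (y₀ : M)).open_target.mem_nhds hσt)) (fun a b ↦ hanti _ _ _) ?_ u v w
  exact fun a b c ↦ hΩ.closed (y₀ : M) _ hσt a b c

/-- In charts the reduced endomorphism is `dr ∘ J ∘ L` along a section, a composite of smooth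
operator fields. -/
theorem smoothEnd_endo (H : IsReduction 𝔤 G π f g) {J : EndField M} (hJ : SmoothEnd J)
    (hB : H.IsBasic J) : SmoothEnd (H.endo J) := by
  intro q₀ a ha
  obtain ⟨y₀, hy₀, rfl⟩ := H.exists_chart_proj_eq ha
  obtain ⟨σ, r, L, hσ₀, hs, hr, hL, -, hloc⟩ := H.exists_local_model y₀ q₀ hy₀
  refine ContDiffAt.contDiffWithinAt ?_
  have h₁ : ContDiffAt ℝ ∞ (localEnd J (y₀ : M)) (chart (y₀ : M) (σ (chart q₀ (π y₀)))) := by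
    rw [hσ₀]
    exact (hJ (y₀ : M)).contDiffAt ((chart (y₀ : M)).open_target.mem_nhds (chart_mem_target _))
  have h₂ : ContDiffAt ℝ ∞ (fderiv ℝ r) (chart (y₀ : M) (σ (chart q₀ (π y₀)))) := by
    rw [hσ₀]
    exact hr.fderiv_right (by simp)
  have h₃ : ContDiffAt ℝ ∞ (fun h ↦ localEnd J (y₀ : M) (chart (y₀ : M) (σ h)))
      (chart q₀ (π y₀)) := h₁.comp (f := fun h ↦ chart (y₀ : M) (σ h)) (chart q₀ (π y₀)) hs
  have h₄ : ContDiffAt ℝ ∞ (fun h ↦ fderiv ℝ r (chart (y₀ : M) (σ h))) (chart q₀ (π y₀)) :=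
    h₂.comp (f := fun h ↦ chart (y₀ : M) (σ h)) (chart q₀ (π y₀)) hs
  refine (h₄.clm_comp (h₃.clm_comp hL)).congr_of_eventuallyEq ?_
  filter_upwards [hloc] with h ⟨h₁, h₂, hq, _, h₃, _, h₄⟩
  ext u
  rw [ContinuousLinearMap.comp_apply, ContinuousLinearMap.comp_apply, h₃,
    localEnd_chartDeriv J h₂, ← H.incl_lift_endo hB, h₄,
    H.tangentMapTo_lift]
  rfl

theorem nijenhuisVanishes_endo [CompleteSpace F] (H : IsReduction 𝔤 G π f g) 
    {Ω : BilinField M} {J : EndField M} (hK : IsWeakKahler g Ω J) (hB : H.IsBasic J)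
    (hv : ∀ (y : N) (b : 𝔤) (a : Tangent y),
      Ω y (infinitesimalAction 𝔤 G (y : M) b) (incl y a) = 0)
    (hsq : ∀ q a, H.endo J q (H.endo J q a) = -a) : NijenhuisVanishes (H.endo J) := by
  intro q₀ V W hV hW a ha
  have hJs := H.smoothEnd_endo hK.smooth_J hB
  have hJd : DifferentiableAt ℝ (localEnd (H.endo J) q₀) a :=
    ((hJs q₀).contDiffAt ((chart q₀).open_target.mem_nhds ha)).differentiableAt (by simp)
  have hsq' : ∀ x, localEnd (H.endo J) q₀ a (localEnd (H.endo J) q₀ a x) = -x := fun x ↦ by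
    change chartDeriv q₀ _ (H.endo J _ (chartSymmDeriv q₀ a (chartDeriv q₀ _
      (H.endo J _ (chartSymmDeriv q₀ a x))))) = -x
    rw [chartSymmDeriv_chartDeriv ha, hsq, map_neg, chartDeriv_chartSymmDeriv ha]
  -- By tensoriality constant vector fields suffice.
  rw [nijenhuis_congr (V' := fun _ ↦ V a) (W' := fun _ ↦ W a) hJd
    ((hV.contDiffAt ((chart q₀).open_target.mem_nhds ha)).differentiableAt (by simp))
    ((hW.contDiffAt ((chart q₀).open_target.mem_nhds ha)).differentiableAt (by simp))
    (differentiableAt_const _) (differentiableAt_const _) hsq' rfl rfl]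
  obtain ⟨y₀, hy₀, rfl⟩ := H.exists_chart_proj_eq ha
  obtain ⟨σ, r, L, hσ₀, hs, hr, hL, hds, hloc⟩ := H.exists_local_model y₀ q₀ hy₀
  have hs₀ : chart (y₀ : M) (σ (chart q₀ (π y₀))) = chart (y₀ : M) y₀ := by rw [hσ₀]
  have hmd : ∀ z ∈ (chart (y₀ : M)).source, ∀ v,
      fderiv ℝ (fun a ↦ f ((chart (y₀ : M)).symm a)) (chart (y₀ : M) z)
        (chartDeriv (y₀ : M) z v) = differential f z v := fun z hz v ↦ by
    have h₁ : SmoothAt (fun a ↦ f ((chart (y₀ : M)).symm a)) (chart (y₀ : M) z) :=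
      (smoothInto_iff.1 H.smooth_map z).comp (smoothAt_chart_symm ((chart (y₀ : M)).map_source hz))
        ((chart (y₀ : M)).left_inv hz)
    refine (tangentMapTo_comp_apply h₁ (smoothAt_chart hz) rfl (z := f z)
      (by rw [(chart (y₀ : M)).left_inv hz]) v).symm.trans ?_
    refine DFunLike.congr_fun (tangentMapTo_congr ?_ _) v
    filter_upwards [(chart (y₀ : M)).open_source.mem_nhds hz] with x hx
    rw [(chart (y₀ : M)).left_inv hx]
  obtain ⟨h₁, h₂, hq, -, h₄, -, h₆⟩ := hloc.self_of_nhds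
  have ht := (chart (y₀ : M)).map_source h₂
  have ho := (chart (y₀ : M)).open_target.mem_nhds ht
  -- The error space `T` is the vertical space at the base point, seen in the chart.
  refine nijenhuis_of_horizontal (J := localEnd J (y₀ : M))
    (s := fun h ↦ chart (y₀ : M) (σ h)) (r := r) (L := L)
    (m := fun a ↦ f ((chart (y₀ : M)).symm a)) ((chartDeriv (y₀ : M) _).comp
      (infinitesimalAction 𝔤 G (σ (chart q₀ (π y₀)) : M))).range
    (((hK.smooth_J (y₀ : M)).contDiffAt ho).differentiableAt (by simp)) (fun x ↦ ?_)
    (fun x y ↦ hK.nijenhuis_J (y₀ : M) _ _ contDiffOn_const contDiffOn_const _ ht) hds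
    (by rwa [hs₀]) ?_ (hL.differentiableAt (by simp)) hJd ?_ ?_
    ((H.smooth_map (y₀ : M)).contDiffAt ho) ?_ (fun z hz ↦ ?_) ?_ _ _
  · rw [← chartDeriv_tangentMapTo_chart_symm h₂ x, localEnd_chartDeriv J h₂,
      localEnd_chartDeriv J h₂, hK.sq_J, map_neg]
  · filter_upwards [hloc] with h ⟨_, _, _, h₃, _⟩ using h₃
  · filter_upwards [hloc] with h ⟨h₁, h₂, hq, _, h₃, _⟩ u
    rw [h₃, h₃, localEnd_chartDeriv J h₂, ← H.incl_lift_endo hB]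
    change _ = chartDeriv (y₀ : M) (σ h) (incl (σ h) (H.lift hq (chartSymmDeriv q₀ h
      (chartDeriv q₀ _ (H.endo J _ (chartSymmDeriv q₀ h u))))))
    rw [chartSymmDeriv_chartDeriv h₁]
  · filter_upwards [hloc] with h ⟨h₁, h₂, hq, _, h₃, _, h₄⟩ u
    rw [h₃, h₄, H.tangentMapTo_lift, chartDeriv_chartSymmDeriv h₁]
  · filter_upwards [hloc] with h ⟨h₁, h₂, hq, _, h₃, _⟩ u
    rw [h₃, hmd _ h₂, H.differential_incl]
  · rw [← chartDeriv_tangentMapTo_chart_symm h₂ z] at hz ⊢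
    rw [hmd _ h₂] at hz
    obtain ⟨a, ha⟩ := H.exists_incl_eq _ hz
    obtain ⟨b, hb⟩ := H.exists_lift_add hq a
    rw [← ha, h₆, h₄, chartSymmDeriv_chartDeriv h₁, hb, map_add, add_sub_cancel_left]
    exact ⟨b, rfl⟩
  -- Pair with the lift of `w`: vertical vectors are orthogonal to it, and so are their `J`-images,
  -- since `g(J X, Y) = Ω(X, Y) = 0` for `Y` tangent to the level set. The lift then has zero norm.
  · rintro _ ⟨b, rfl⟩ _ ⟨c, rfl⟩ w hw
    change chartDeriv (y₀ : M) _ (infinitesimalAction 𝔤 G _ b) + localEnd J (y₀ : M) _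
      (chartDeriv (y₀ : M) _ (infinitesimalAction 𝔤 G _ c)) + L _ w = 0 at hw
    rw [localEnd_chartDeriv J h₂, h₄, ← map_add, ← map_add] at hw
    have hw' := congrArg (tangentMapTo (chart (y₀ : M)).symm
      (chart (y₀ : M) (σ (chart q₀ (π y₀)))) (σ (chart q₀ (π y₀)) : M)) hw
    rw [tangentMapTo_chart_symm_chartDeriv h₂, map_zero] at hw'
    have hl := H.isHorizontal_lift hq (chartSymmDeriv q₀ (chart q₀ (π y₀)) w)
    have h₇ := congrArg (fun z ↦ g (σ (chart q₀ (π y₀)) : M) z (incl _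
      (H.lift hq (chartSymmDeriv q₀ (chart q₀ (π y₀)) w)))) hw'
    simp only [map_add, add_apply, hl b, hK.compatible, hv, zero_add, map_zero, zero_apply] at h₇
    have h₈ : incl _ (H.lift hq (chartSymmDeriv q₀ (chart q₀ (π y₀)) w)) = 0 := by
      by_contra hne
      exact (H.riemannian.positive _ _ hne).ne' h₇
    have h₉ : chartSymmDeriv q₀ (chart q₀ (π y₀)) w = 0 :=
      H.incl_lift_injective hq (by simpa using h₈)
    rw [← chartDeriv_chartSymmDeriv h₁ w, h₉, map_zero]

/-- The reduced weak Kähler structure. -/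
theorem isWeakKahler (H : IsReduction 𝔤 G π f g) [CompleteSpace F] {Ω : BilinField M}
    {J : EndField M} (hK : IsWeakKahler g Ω J) (hG : Preserves G Ω) (hB : H.IsBasic J)
    (hv : ∀ (y : N) (b : 𝔤) (a : Tangent y),
      Ω y (infinitesimalAction 𝔤 G (y : M) b) (incl y a) = 0) :
    IsWeakKahler (H.bilin g) (H.bilin Ω) (H.endo J) := by
  have hsq : ∀ q a, H.endo J q (H.endo J q a) = -a := fun q a ↦ by
    refine H.incl_lift_injective (H.proj_rep q) ?_
    simp only [H.incl_lift_endo hB, hK.sq_J, map_neg]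
  have hc : ∀ q a c, H.bilin g q (H.endo J q a) c = H.bilin Ω q a c := fun q a c ↦ by
    rw [H.bilin_apply H.preserves (H.proj_rep q), H.bilin_apply hG (H.proj_rep q),
      H.incl_lift_endo hB, hK.compatible]
  refine ⟨H.isWeakRiemannian_bilin, ⟨H.smoothBilin_bilin hK.symplectic.smooth hG,
    fun q a ↦ hK.symplectic.alternating _ _, H.isClosedForm_bilin hK.symplectic hG hv, fun q ↦ ?_⟩,
    H.smoothEnd_endo hK.smooth_J hB, hc, hsq, H.nijenhuisVanishes_endo hK hB hv hsq⟩
  -- If `Ω(a, ·) = 0`, then `g(J a, ·) = 0`, so `J a = 0` and `a = -J (J a) = 0`.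
  refine (injective_iff_map_eq_zero _).2 fun a ha ↦ ?_
  have h₁ : H.endo J q a = 0 := by
    by_contra hne
    refine (H.isWeakRiemannian_bilin.positive q _ hne).ne' ?_
    rw [hc, ha]
    rfl
  rw [← neg_eq_zero, ← hsq, h₁, map_zero]

theorem endo_quaternionic (H : IsReduction 𝔤 G π f g) {J : Fin 3 → EndField M}
    (hB : ∀ k, H.IsBasic (J k)) (h : ∀ x a, J 0 x (J 1 x (J 2 x a)) = -a) (q : Q) (a : Tangent q) :
    H.endo (J 0) q (H.endo (J 1) q (H.endo (J 2) q a)) = -a := by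
  refine H.incl_lift_injective (H.proj_rep q) ?_
  simp only [H.incl_lift_endo (hB _), h, map_neg]

end IsReduction

end BanachManifold

namespace BanachManifold

/-! ### Proper actions and the level set as a reduction -/

section ProperAction

variable {G : Type*} [Group G] [TopologicalSpace G] {M : Type*} [TopologicalSpace M] [MulAction G M]

/-- For a free proper action, group elements which move a point by little are close to `1`. -/
theorem exists_nhds_smul_mem [ProperSMul G M] (hfree : ∀ (g : G) (x : M), g • x = x → g = 1) (x : M)
    {V : Set G} (hV : V ∈ 𝓝 (1 : G)) :
    ∃ W ∈ 𝓝 x, ∀ (g : G), ∀ z ∈ W, g • z ∈ W → g ∈ V := by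
  have hc := (ProperSMul.isProperMap_smul_pair (G := G) (X := M)).isClosedMap
    ((interior V)ᶜ ×ˢ univ) (isOpen_interior.isClosed_compl.prod isClosed_univ)
  -- A preimage of `(x, x)` is some `(g, x)` with `g • x = x`; freeness forces `g = 1`, which lies
  -- in the interior of `V`.
  have hx : (x, x) ∈ ((fun p : G × M ↦ (p.1 • p.2, p.2)) '' ((interior V)ᶜ ×ˢ univ))ᶜ := by
    rintro ⟨⟨g, z⟩, ⟨hg, -⟩, h⟩
    obtain ⟨h₁, rfl⟩ := Prod.mk.inj h
    exact hg (hfree g z h₁ ▸ mem_interior_iff_mem_nhds.2 hV)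
  obtain ⟨U, hU, W, hW, hUW⟩ := mem_nhds_prod_iff.1 (hc.isOpen_compl.mem_nhds hx)
  refine ⟨U ∩ W, Filter.inter_mem hU hW, fun g z hz hgz ↦ interior_subset ?_⟩
  by_contra hg
  exact hUW (mk_mem_prod hgz.1 hz.2) ⟨(g, z), ⟨hg, mem_univ _⟩, rfl⟩

/-- The orbit space of `N` injects continuously into that of `M`, which is Hausdorff because the
action is proper. -/
theorem t2Space_orbitSpace [ProperSMul G M] (N : Set M) : T2Space (OrbitSpace G N) := by
  let φ : OrbitSpace G N → Quotient (MulAction.orbitRel G M) :=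
    Quotient.map Subtype.val fun _ _ h ↦ h
  have hφ : Continuous φ := continuous_subtype_val.quotient_map' _
  refine T2Space.of_injective_continuous (f := φ) ?_ hφ
  rintro ⟨a⟩ ⟨b⟩ h
  exact Quotient.sound (s := orbitSetoid G N) (Quotient.exact (s := MulAction.orbitRel G M) h)

end ProperAction

section Restriction

variable {𝔤 : Type*} [NormedAddCommGroup 𝔤] [NormedSpace ℝ 𝔤] [CompleteSpace 𝔤]
  {G : Type*} [Group G] [TopologicalSpace G] [ChartedSpace 𝔤 G]
  {M : Type*} [TopologicalSpace M] [BanachManifold M] [MulAction G M]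
  {N : Set M} [BanachManifold N] [MulAction G N]

theorem SmoothAction.restrict (h : SmoothAction 𝔤 G M) (hN : IsEmbedded N)
    (hc : ∀ (γ : G) (y : N), ((γ • y : N) : M) = γ • (y : M)) : SmoothAction 𝔤 G N where
  continuous := by
    refine Continuous.congr (f := fun p : G × N ↦ (⟨p.1 • (p.2 : M), hc p.1 p.2 ▸ (p.1 • p.2).2⟩ : N))
      ?_ fun p ↦ Subtype.ext (hc _ _).symm
    exact (h.continuous.comp (continuous_fst.prodMk
      (continuous_subtype_val.comp continuous_snd))).subtype_mk _
  contDiffOn γ x y p hp := by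
    have h₁ : SmoothAt (fun p : 𝔤 × Tangent x ↦ (chartAt 𝔤 γ).symm p.1 • (chart x).symm p.2) p := by
      refine hN.smoothAt_of_val ?_
      simp only [hc]
      refine h.smoothAt_smul hp.1 (smoothAt_iff_contDiffAt.2 contDiffAt_fst) ?_
      exact (hN.smoothAt_val _).comp ((smoothAt_chart_symm hp.2.1).comp
        (smoothAt_iff_contDiffAt.2 contDiffAt_snd) rfl) rfl
    exact ((smoothAt_iff_of_mem (mem_chart_source p) hp.2.2).1 h₁).2.contDiffWithinAt

end Restriction

section LevelSetReduction

variable {𝔤 : Type*} [NormedAddCommGroup 𝔤] [NormedSpace ℝ 𝔤] [CompleteSpace 𝔤]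
  {G : Type*} [Group G] [TopologicalSpace G] [ChartedSpace 𝔤 G]
  {F : Type*} [NormedAddCommGroup F] [NormedSpace ℝ F] [CompleteSpace F]

/-- Horizontal tangent vectors of `N` as a submodule. -/
noncomputable def horizontalIn {M : Type*} [TopologicalSpace M] [BanachManifold M]
    {N : Set M} [BanachManifold N] (𝔤 : Type*) [NormedAddCommGroup 𝔤] [NormedSpace ℝ 𝔤]
    (G : Type*) [Group G] [TopologicalSpace G] [ChartedSpace 𝔤 G] [MulAction G M]
    (g : BilinField M) (y : N) : Submodule ℝ (Tangent y) :=
  ((g y).bilinearComp (infinitesimalAction 𝔤 G (y : M)) (incl y)).flip.ker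

/-- A level set and its orbit space satisfy the assumptions of the reduction theorem. -/
theorem exists_isReduction {M : Type u} [TopologicalSpace M] [BanachManifold.{u, w} M]
    [MulAction G M] [ProperSMul G M] {f : M → F} {ξ : F} {g : BilinField M}
    (hs : SmoothAction 𝔤 G M) (hfree : ∀ (γ : G) (x : M), γ • x = x → γ = 1)
    (hf : SmoothInto f) (hξ : IsRegularValue f ξ) (hinv : ∀ (γ : G) x, f x = ξ → f (γ • x) = ξ)
    (hg : IsWeakRiemannian g) (hG : Preserves G g) (hD : DirectSumCondition 𝔤 G g f ξ)
    (hB : ∀ x, f x = ξ → Function.Bijective ((g x).bilinearComp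
      (infinitesimalAction 𝔤 G x) (infinitesimalAction 𝔤 G x))) :
    ∃ (_ : MulAction G (f ⁻¹' {ξ})) (_ : BanachManifold.{u, w} (f ⁻¹' {ξ}))
      (_ : BanachManifold.{u, w} (OrbitSpace G (f ⁻¹' {ξ}))),
      IsReduction 𝔤 G (orbitProj G (f ⁻¹' {ξ})) f g := by
  obtain ⟨iN, hN, hr⟩ := exists_levelSet_manifold hf hξ
  let iA : MulAction G (f ⁻¹' {ξ}) :=
    { smul γ y := ⟨γ • (y : M), hinv γ y y.2⟩
      one_smul y := Subtype.ext (one_smul G (y : M))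
      mul_smul γ δ y := Subtype.ext (mul_smul γ δ (y : M)) }
  have hc : ∀ (γ : G) (y : f ⁻¹' {ξ}), ((γ • y : f ⁻¹' {ξ}) : M) = γ • (y : M) := fun _ _ ↦ rfl
  have hs' := hs.restrict hN hc
  have hX := hN.incl_infinitesimalAction hs' hc
  have hdf : ∀ (y : f ⁻¹' {ξ}) (a : Tangent y), differential f (y : M) (incl y a) = 0 :=
    fun y a ↦ (hr y ▸ ⟨a, rfl⟩ : incl y a ∈ (differential f (y : M)).ker)
  have hmem : ∀ (y : f ⁻¹' {ξ}) (a : Tangent y), a ∈ horizontalIn 𝔤 G g y ↔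
      IsReduction.IsHorizontal 𝔤 G g y a := fun y a ↦
    ⟨fun h b ↦ DFunLike.congr_fun h b, fun h ↦ ContinuousLinearMap.ext h⟩
  have hiff : ∀ y z : f ⁻¹' {ξ}, orbitProj G _ y = orbitProj G _ z ↔ ∃ γ : G, γ • y = z := by
    intro y z
    refine Quotient.eq.trans ((MulAction.orbitRel G M).comm'.trans ?_)
    exact exists_congr fun γ ↦ ⟨fun h ↦ Subtype.ext h, fun h ↦ congrArg Subtype.val h⟩
  have : ∀ y : f ⁻¹' {ξ}, CompleteSpace (horizontalIn 𝔤 G g y) := fun y ↦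
    (ContinuousLinearMap.isClosed_ker _).completeSpace_coe
  have hsplit : IsSplitAction 𝔤 G (orbitProj G (f ⁻¹' {ξ})) (horizontalIn 𝔤 G g) :=
    { smooth := hs'
      quotient := isQuotientMap_quotient_mk'
      eq_iff := hiff
      proper y V hV := by
        obtain ⟨W, hW, h⟩ := exists_nhds_smul_mem hfree (y : M) hV
        exact ⟨Subtype.val ⁻¹' W, continuous_subtype_val.continuousAt.preimage_mem_nhds hW,
          fun γ z hz hγ ↦ h γ z hz hγ⟩
      injective y := by
        -- A vector acting trivially lies in the kernel of the Gram form.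
        refine (injective_iff_map_eq_zero _).2 fun b hb ↦ ?_
        refine (injective_iff_map_eq_zero _).1 (hB y y.2).1 b ?_
        ext c
        rw [ContinuousLinearMap.bilinearComp_apply, ← hX, hb]
        simp
      isCompl y := by
        -- Condition (D), transported from the kernel of the differential to the tangent space of
        -- the level set.
        refine ⟨Submodule.disjoint_def.2 ?_, Submodule.codisjoint_iff_exists_add_eq.2 fun a ↦ ?_⟩
        · rintro _ ⟨b, rfl⟩ hb
          refine hN.incl_injective y (Eq.trans ?_ (map_zero _).symm)
          rw [← Submodule.mem_bot ℝ, ← (hD y y.2).1]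
          refine ⟨⟨b, (hX y b).symm⟩, hdf y _, ?_⟩
          rintro _ ⟨c, rfl⟩
          exact (hmem y _).1 hb c
        · have ha : incl y a ∈ (differential f (y : M)).ker := hdf y a
          rw [← (hD y y.2).2] at ha
          obtain ⟨_, ⟨b, rfl⟩, c, hc, hbc⟩ := Submodule.mem_sup.1 ha
          obtain ⟨c, rfl⟩ := (hr y ▸ hc.1 : c ∈ (incl y).range)
          refine ⟨infinitesimalAction 𝔤 G y b, c, ⟨b, rfl⟩,
            (hmem y c).2 fun b ↦ hc.2 _ ⟨b, rfl⟩, hN.incl_injective y ?_⟩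
          rw [map_add, hX]
          exact hbc }
  obtain ⟨iQ, h₁, h₂, h₃⟩ := hsplit.exists_quotient_manifold
  refine ⟨iA, iN, iQ, ⟨hs, hs', hc, hN, hf, hr, Quotient.mk_surjective, hiff, h₁, h₂,
    fun y q hq ↦ ?_, hg, hG, fun y ↦ hB y y.2⟩⟩
  obtain ⟨σ, h₄, h₅, h₆⟩ := h₃ y q hq
  exact ⟨σ, h₄, h₅, fun v ↦ (hmem y _).1 (h₆ v)⟩

end LevelSetReduction

end BanachManifold

namespace BanachManifold

/-! ### Pointwise algebra of weak Kähler and hyperkähler structures -/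

section Pointwise

variable {X : Type*} [TopologicalSpace X] [BanachManifold X]

theorem IsWeakRiemannian.nonneg {g : BilinField X} (h : IsWeakRiemannian g) (x : X)
    (a : Tangent x) : 0 ≤ g x a a := by
  rcases eq_or_ne a 0 with rfl | ha
  · simp
  · exact (h.positive x a ha).le

theorem IsWeakRiemannian.abs_apply_le {g : BilinField X} (h : IsWeakRiemannian g) (x : X)
    (a b : Tangent x) : |g x a b| ≤ √(g x a a) * √(g x b b) := by
  rw [← Real.sqrt_mul (h.nonneg x a)]
  refine Real.abs_le_sqrt ?_
  have h₁ := LinearMap.BilinForm.apply_mul_apply_le_of_forall_zero_le (g x).toLinearMap₁₂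
    (h.nonneg x) a b
  calc (g x a b) ^ 2 = g x a b * g x b a := by rw [h.symmetric x b a, sq]
    _ ≤ _ := h₁

theorem IsWeakRiemannian.eq_zero_of_apply {g : BilinField X} (h : IsWeakRiemannian g) (x : X)
    {a : Tangent x} (ha : g x a a = 0) : a = 0 := by
  by_contra hne
  exact (h.positive x a hne).ne' ha

variable {g Ω : BilinField X} {J : EndField X}

theorem IsWeakKahler.apply_swap (h : IsWeakKahler g Ω J) (x : X) (a b : Tangent x) :
    Ω x a b = -Ω x b a := by
  have h₁ := h.symplectic.alternating x (a + b)
  simp only [map_add, add_apply, h.symplectic.alternating, zero_add, add_zero] at h₁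
  linarith

theorem IsWeakKahler.metric_apply_J (h : IsWeakKahler g Ω J) (x : X) (a b : Tangent x) :
    g x a (J x b) = -Ω x a b := by
  rw [h.riemannian.symmetric, h.compatible, h.apply_swap]

theorem IsWeakKahler.form_apply_J (h : IsWeakKahler g Ω J) (x : X) (a b : Tangent x) :
    Ω x a (J x b) = g x a b := by
  rw [h.apply_swap, ← h.compatible, h.sq_J, map_neg, neg_apply, neg_neg, h.riemannian.symmetric]

/-- Cauchy–Schwarz for `g(J a, b)`, where `J` is an isometry. This bound makes symplectic pairings
bounded in the norm of the metric. -/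
theorem IsWeakKahler.form_apply_le (h : IsWeakKahler g Ω J) (x : X) (a b : Tangent x) :
    |Ω x a b| ≤ √(g x a a) * √(g x b b) := by
  have h₁ : g x (J x a) (J x a) = g x a a := by rw [h.compatible, h.form_apply_J]
  rw [← h.compatible, ← h₁]
  exact h.riemannian.abs_apply_le x _ _

/-- If every functional on `V` is a symplectic pairing with vectors in the image of `T`, then the
metric restricted to the image of `T` induces an isomorphism of `V` with its dual. -/
theorem IsWeakKahler.bijective_bilinearComp (h : IsWeakKahler g Ω J) (x : X) {V : Type*}
    [NormedAddCommGroup V] [NormedSpace ℝ V] [CompleteSpace V] (T : V →L[ℝ] Tangent x)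
    (hT : ∀ φ : V →L[ℝ] ℝ, ∃ a, ∀ b, φ b = Ω x (T b) a) :
    Function.Bijective ((g x).bilinearComp T T) := by
  obtain ⟨c, hc, hcoer⟩ := exists_coercive_of_bounded ((g x).bilinearComp T T)
    (fun b ↦ h.riemannian.nonneg x _) fun φ ↦ by
      obtain ⟨a, ha⟩ := hT φ
      refine ⟨√(g x a a), fun b ↦ ?_⟩
      rw [ha, mul_comm]
      exact h.form_apply_le x _ _
  exact bijective_of_coercive _ (fun b c ↦ h.riemannian.symmetric x _ _) hc hcoer

/-- For distinct `j` and `k` the complex structure `J k` is, up to a sign, a multiple of `J j`. -/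
theorem IsWeakHyperkahler.exists_eq_smul {Ω : Fin 3 → BilinField X} {J : Fin 3 → EndField X}
    (h : IsWeakHyperkahler g Ω J) (x : X) {j k : Fin 3} (hjk : j ≠ k) :
    ∃ (i : Fin 3) (s : ℝ), ∀ a, J k x a = s • J j x (J i x a) := by
  have h₀₁ : ∀ a, J 0 x (J 1 x a) = J 2 x a := fun a ↦ by
    rw [← neg_neg (J 2 x a), ← h.quaternionic, map_neg, (h.kahler 2).sq_J, neg_neg]
  have h₁₂ : ∀ a, J 1 x (J 2 x a) = J 0 x a := fun a ↦ by
    rw [← neg_neg (J 1 x (J 2 x a)), ← (h.kahler 0).sq_J x (J 1 x (J 2 x a)), h.quaternionic,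
      map_neg, neg_neg]
  have h₂₁ : ∀ a, J 2 x (J 1 x a) = -J 0 x a := fun a ↦ by
    rw [← h₀₁, (h.kahler 1).sq_J, map_neg]
  have h₀₂ : ∀ a, J 0 x (J 2 x a) = -J 1 x a := fun a ↦ by
    rw [← h₁₂, (h.kahler 2).sq_J, map_neg]
  have h₂₀ : ∀ a, J 2 x (J 0 x a) = J 1 x a := fun a ↦ by
    rw [← neg_neg (J 0 x a), ← h₂₁, map_neg, (h.kahler 2).sq_J, neg_neg]
  have h₁₀ : ∀ a, J 1 x (J 0 x a) = -J 2 x a := fun a ↦ by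
    rw [← h₁₂, (h.kahler 1).sq_J]
  fin_cases j <;> fin_cases k
  · exact absurd rfl hjk
  · exact ⟨2, -1, fun a ↦ by simp [h₀₂]⟩
  · exact ⟨1, 1, fun a ↦ by simp [h₀₁]⟩
  · exact ⟨2, 1, fun a ↦ by simp [h₁₂]⟩
  · exact absurd rfl hjk
  · exact ⟨0, -1, fun a ↦ by simp [h₁₀]⟩
  · exact ⟨1, -1, fun a ↦ by simp [h₂₁]⟩
  · exact ⟨0, 1, fun a ↦ by simp [h₂₀]⟩
  · exact absurd rfl hjk

end Pointwise

/-! ### Invariance of the horizontal spaces and the induced structures -/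

namespace IsReduction

variable {𝔤 : Type*} [NormedAddCommGroup 𝔤] [NormedSpace ℝ 𝔤] [CompleteSpace 𝔤]
  {G : Type*} [Group G] [TopologicalSpace G] [ChartedSpace 𝔤 G]
  {M : Type*} [TopologicalSpace M] [BanachManifold M] [MulAction G M]
  {F : Type*} [NormedAddCommGroup F] [NormedSpace ℝ F] {f : M → F} {g : BilinField M}

/-- `J` commutes with translations because `g(J a, c) = Ω(a, c)` determines it by two invariant
fields. On horizontal vectors, `hJ` gives tangency of `J a`, and `g(X, J a) = -Ω(X, a) = 0` gives
orthogonality to the orbit. -/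
theorem isBasic {N : Set M} [BanachManifold N] [MulAction G N] {Q : Type*} [TopologicalSpace Q]
    [BanachManifold Q] {π : N → Q} (H : IsReduction 𝔤 G π f g) {Ω : BilinField M} {J : EndField M}
    (hK : IsWeakKahler g Ω J) (hG : Preserves G Ω)
    (hv : ∀ (y : N) (b : 𝔤) (a : Tangent y),
      Ω y (infinitesimalAction 𝔤 G (y : M) b) (incl y a) = 0)
    (hJ : ∀ (y : N) (a : Tangent y), IsHorizontal 𝔤 G g y a →
      differential f (y : M) (J y (incl y a)) = 0) : H.IsBasic J where
  equivariant γ x z hz a := by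
    have hsurj : ∀ c, tangentMapTo (fun y ↦ γ • y) x z
        (tangentMapTo (fun y ↦ γ⁻¹ • y) z x c) = c := fun c ↦ by
      rw [← tangentMapTo_comp_apply (H.smooth_action.smoothAt_const_smul γ x)
        (H.smooth_action.smoothAt_const_smul γ⁻¹ z) (by rw [← hz, inv_smul_smul]) hz]
      simp only [smul_inv_smul, tangentMapTo_id]
      rfl
    have h₁ : ∀ c, g z (J z (tangentMapTo (fun y ↦ γ • y) x z a) -
        tangentMapTo (fun y ↦ γ • y) x z (J x a)) c = 0 := fun c ↦ by
      rw [← hsurj c, map_sub, sub_apply, hK.compatible, hG.apply γ hz, H.preserves.apply γ hz,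
        hK.compatible, sub_self]
    exact sub_eq_zero.1 (H.riemannian.eq_zero_of_apply z (h₁ _))
  exists_horizontal y a ha := by
    obtain ⟨c, hc⟩ := H.exists_incl_eq y (hJ y a ha)
    refine ⟨c, fun b ↦ ?_, hc⟩
    rw [hc, hK.metric_apply_J, hv, neg_zero]

variable {ξ : F} [BanachManifold (f ⁻¹' {ξ})] [MulAction G (f ⁻¹' {ξ})]
  [BanachManifold (OrbitSpace G (f ⁻¹' {ξ}))]

theorem isReducedManifold (H : IsReduction 𝔤 G (orbitProj G (f ⁻¹' {ξ})) f g)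
    (hξ : IsRegularValue f ξ) : IsReducedManifold 𝔤 G f ξ where
  submanifold :=
    { smooth := smooth_of_smoothAt H.embedded.smoothAt_val
      injective := H.embedded.incl_injective
      range := H.range_incl
      complemented y := (hξ y y.2).2 }
  submersion :=
    { smooth := smooth_of_smoothAt H.smoothAt_proj
      surjective y v := ⟨H.lift rfl v, H.tangentMapTo_lift rfl v⟩
      -- The horizontal lift is a continuous right inverse and hence splits the kernel.
      complemented y := ContinuousLinearMap.closedComplemented_ker_of_rightInverse _
        (H.lift rfl) (H.tangentMapTo_lift (y := y) rfl) }
  vertical y := by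
    rw [H.ker_proj]
    ext a
    refine ⟨?_, ?_⟩
    · rintro ⟨b, rfl⟩
      exact ⟨b, (H.incl_infinitesimalAction y b).symm⟩
    · rintro ⟨b, hb⟩
      exact ⟨b, H.embedded.incl_injective y ((H.incl_infinitesimalAction y b).trans hb)⟩

omit [CompleteSpace 𝔤] in
theorem incl_mem_horizontal_iff (H : IsReduction 𝔤 G (orbitProj G (f ⁻¹' {ξ})) f g)
    (y : f ⁻¹' {ξ}) (a : Tangent y) :
    incl y a ∈ horizontal 𝔤 G g f (y : M) ↔ IsHorizontal 𝔤 G g y a := by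
  refine ⟨fun h b ↦ h.2 _ ⟨b, rfl⟩, fun h ↦ ⟨H.differential_incl y a, ?_⟩⟩
  rintro _ ⟨b, rfl⟩
  exact h b

theorem isInduced (H : IsReduction 𝔤 G (orbitProj G (f ⁻¹' {ξ})) f g) {Ω : BilinField M}
    {J : EndField M} (hK : IsWeakKahler g Ω J) (hG : Preserves G Ω) (hB : H.IsBasic J)
    (hv : ∀ (y : f ⁻¹' {ξ}) (b : 𝔤) (a : Tangent y),
      Ω y (infinitesimalAction 𝔤 G (y : M) b) (incl y a) = 0) :
    IsInduced 𝔤 G f ξ g Ω J (H.bilin g) (H.bilin Ω) (H.endo J) where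
  form y a c := by
    obtain ⟨b, hb⟩ := H.exists_lift_add rfl a
    obtain ⟨d, hd⟩ := H.exists_lift_add rfl c
    have h₁ : Ω y (infinitesimalAction 𝔤 G (y : M) b) (infinitesimalAction 𝔤 G (y : M) d) = 0 := by
      rw [← H.incl_infinitesimalAction y d, hv]
    rw [H.bilin_apply hG rfl]
    refine Eq.trans ?_ (congrArg₂ (fun a c ↦ Ω y a c) hb hd).symm
    simp only [map_add, add_apply, hv, h₁, add_zero]
    rw [hK.apply_swap _ _ (infinitesimalAction 𝔤 G (y : M) d), hv, neg_zero, add_zero]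
    rfl
  metric y a c ha hc := by
    rw [H.bilin_apply H.preserves rfl, tangentMap_eq,
      H.lift_tangentMapTo rfl ((H.incl_mem_horizontal_iff y a).1 ha),
      H.lift_tangentMapTo rfl ((H.incl_mem_horizontal_iff y c).1 hc)]
  complex y a ha := by
    have ha' := (H.incl_mem_horizontal_iff y a).1 ha
    obtain ⟨c, hc, hcJ⟩ := hB.exists_horizontal y a ha'
    refine ⟨c, (H.incl_mem_horizontal_iff y c).2 hc, hcJ, ?_⟩
    refine H.incl_lift_injective rfl ?_
    change incl y (H.lift rfl (H.endo J _ (tangentMapTo _ y _ a))) =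
      incl y (H.lift rfl (tangentMapTo _ y _ c))
    rw [H.incl_lift_endo hB, H.lift_tangentMapTo rfl ha', H.lift_tangentMapTo rfl hc, hcJ]

end IsReduction

end BanachManifold

namespace BanachManifold

/-! ### Triples of moment maps and the theorem -/

section Pi

variable {X : Type*} [TopologicalSpace X] [BanachManifold X] {ι : Type*} [Fintype ι]
  {F : Type*} [NormedAddCommGroup F] [NormedSpace ℝ F]

theorem smoothInto_pi {f : X → ι → F} (h : ∀ k, SmoothInto fun x ↦ f x k) : SmoothInto f :=
  fun x ↦ contDiffOn_pi.2 fun k ↦ h k x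

theorem differential_pi_apply {f : X → ι → F} (h : SmoothInto f) (x : X) (a : Tangent x) (k : ι) :
    differential f x a k = differential (fun x ↦ f x k) x a := by
  have h₁ := ((h x).contDiffAt ((chart x).open_target.mem_nhds (chart_mem_target x))).differentiableAt
    (by simp)
  exact (DFunLike.congr_fun (fderiv_apply h₁ k) a).symm

end Pi

end BanachManifold

open BanachManifold in
theorem theorem2p1 {𝔤 : Type*} [NormedAddCommGroup 𝔤] [NormedSpace ℝ 𝔤] [CompleteSpace 𝔤]
    {G : Type*} [Group G] [TopologicalSpace G] [ChartedSpace 𝔤 G] [LieGroup 𝓘(ℝ, 𝔤) ∞ G]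
    {M : Type u} [TopologicalSpace M] [BanachManifold.{u, w} M] [MulAction G M]
    (smooth_action : SmoothAction 𝔤 G M) (proper_action : ProperSMul G M)
    (free_action : ∀ (g : G) (x : M), g • x = x → g = 1) :
    (∀ (g Ω : BilinField M) (J : EndField M) (μ : M → 𝔤 →L[ℝ] ℝ) (ξ : 𝔤 →L[ℝ] ℝ),
      IsWeakKahler g Ω J → Preserves G g → Preserves G Ω →
      IsEquivariantMomentMap G Ω μ → (∀ h : G, coAd h ξ = ξ) → IsRegularValue μ ξ →
      DirectSumCondition 𝔤 G g μ ξ →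
      T2Space (OrbitSpace G (μ ⁻¹' {ξ})) ∧
      ∃ (_ : BanachManifold.{u, w} (μ ⁻¹' {ξ}))
        (_ : BanachManifold.{u, w} (OrbitSpace G (μ ⁻¹' {ξ}))),
        IsReducedManifold 𝔤 G μ ξ ∧
        ∃ (g' Ω' : BilinField (OrbitSpace G (μ ⁻¹' {ξ})))
          (J' : EndField (OrbitSpace G (μ ⁻¹' {ξ}))),
          IsWeakKahler g' Ω' J' ∧ IsInduced 𝔤 G μ ξ g Ω J g' Ω' J') ∧
    (∀ (g : BilinField M) (Ω : Fin 3 → BilinField M) (J : Fin 3 → EndField M)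
      (μ : M → Fin 3 → 𝔤 →L[ℝ] ℝ) (ξ : Fin 3 → 𝔤 →L[ℝ] ℝ),
      IsWeakHyperkahler g Ω J → Preserves G g → (∀ k, Preserves G (Ω k)) →
      (∀ k, IsEquivariantMomentMap G (Ω k) fun x ↦ μ x k) → (∀ (h : G) k, coAd h (ξ k) = ξ k) →
      IsRegularValue μ ξ → DirectSumCondition 𝔤 G g μ ξ →
      T2Space (OrbitSpace G (μ ⁻¹' {ξ})) ∧
      ∃ (_ : BanachManifold.{u, w} (μ ⁻¹' {ξ}))
        (_ : BanachManifold.{u, w} (OrbitSpace G (μ ⁻¹' {ξ}))),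
        IsReducedManifold 𝔤 G μ ξ ∧
        ∃ (g' : BilinField (OrbitSpace G (μ ⁻¹' {ξ})))
          (Ω' : Fin 3 → BilinField (OrbitSpace G (μ ⁻¹' {ξ})))
          (J' : Fin 3 → EndField (OrbitSpace G (μ ⁻¹' {ξ}))),
          IsWeakHyperkahler g' Ω' J' ∧ ∀ k, IsInduced 𝔤 G μ ξ g (Ω k) (J k) g' (Ω' k) (J' k)) := by
  refine ⟨fun g Ω J μ ξ hK hg hΩ hμ hξ hr hD ↦ ⟨t2Space_orbitSpace _, ?_⟩,
    fun g Ω J μ ξ hK hg hΩ hμ hξ hr hD ↦ ⟨t2Space_orbitSpace _, ?_⟩⟩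
  · obtain ⟨iA, iN, iQ, H⟩ := exists_isReduction smooth_action free_action hμ.smooth hr
      (fun γ x hx ↦ by rw [hμ.equivariant, hx, hξ]) hK.riemannian hg hD fun x hx ↦
        -- Surjectivity of the differential turns every functional into a symplectic pairing with
        -- the orbit directions.
        hK.bijective_bilinearComp x _ fun φ ↦ by
          obtain ⟨a, rfl⟩ := (hr x hx).1 φ
          exact ⟨a, fun b ↦ hμ.moment x b a⟩
    have hv : ∀ (y : μ ⁻¹' {ξ}) (b : 𝔤) (a : Tangent y),
        Ω y (infinitesimalAction 𝔤 G (y : M) b) (incl y a) = 0 := fun y b a ↦ by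
      rw [← hμ.moment, H.differential_incl]
      rfl
    have hB : H.IsBasic J := H.isBasic hK hΩ hv fun y a ha ↦ by
      ext b
      rw [hμ.moment, hK.form_apply_J, ha b]
      rfl
    exact ⟨iN, iQ, H.isReducedManifold hr, _, _, _, H.isWeakKahler hK hΩ hB hv,
      H.isInduced hK hΩ hB hv⟩
  · have hμs : SmoothInto μ := smoothInto_pi fun k ↦ (hμ k).smooth
    have hmom : ∀ x a b k, differential μ x a k b = Ω k x (infinitesimalAction 𝔤 G x b) a :=
      fun x a b k ↦ by rw [differential_pi_apply hμs, (hμ k).moment]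
    obtain ⟨iA, iN, iQ, H⟩ := exists_isReduction smooth_action free_action hμs hr
      (fun γ x hx ↦ funext fun k ↦ by rw [(hμ k).equivariant, hx, hξ]) (hK.kahler 0).riemannian hg
      hD fun x hx ↦ (hK.kahler 0).bijective_bilinearComp x _ fun φ ↦ by
          -- Any triple with zeroth component `φ` would do, since the Gram form involves only the
          -- common metric and `Ω 0` suffices to bound it.
          obtain ⟨a, ha⟩ := (hr x hx).1 fun _ ↦ φ
          exact ⟨a, fun b ↦ by rw [← hmom, ha]⟩
    have hv : ∀ k (y : μ ⁻¹' {ξ}) (b : 𝔤) (a : Tangent y),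
        Ω k y (infinitesimalAction 𝔤 G (y : M) b) (incl y a) = 0 := fun k y b a ↦ by
      rw [← hmom, H.differential_incl]
      rfl
    have hB : ∀ k, H.IsBasic (J k) := fun k ↦ H.isBasic (hK.kahler k) (hΩ k) (hv k) fun y a ha ↦ by
      ext j b
      rw [hmom]
      rcases eq_or_ne j k with rfl | hjk
      · rw [(hK.kahler j).form_apply_J, ha b]
        rfl
      -- For `j ≠ k` the quaternion relations give `Ω_j(X, J_k a) = s g(X, J_i a) = -s Ω_i(X, a)`,
      -- which vanishes because `a` is tangent to the level set of all three moment maps.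
      · obtain ⟨i, s, hs⟩ := hK.exists_eq_smul y hjk
        rw [hs, map_smul, (hK.kahler j).form_apply_J, (hK.kahler i).metric_apply_J, hv, neg_zero,
          smul_zero]
        rfl
    exact ⟨iN, iQ, H.isReducedManifold hr, _, _, _,
      ⟨fun k ↦ H.isWeakKahler (hK.kahler k) (hΩ k) (hB k) (hv k),
        H.endo_quaternionic hB hK.quaternionic⟩,
      fun k ↦ H.isInduced (hK.kahler k) (hΩ k) (hB k) (hv k)⟩
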